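/- Let $0<d<1$ and let $n\ge 7$ be an integer with $(2n-1)^d\ge 24$. For an integer $L>0$, let $R_L$ be the set of reduced words of length $L$ in the letters $s_1,\dots,s_n$ and their inverses, let $R$ be a $\lfloor(2n-1)^{dL}\rfloor$-tuple of elements of $R_L$ chosen uniformly at random, and let $G=\langle s_1,\dots,s_n\mid R\rangle$ be the random group at density $d$ and length $L$. Then, as $L\to\infty$, the probability of the following event tends to $1$: every action of $G$ by cubical automorphisms on a $\mathrm{CAT}(0)$ square complex $X$ fixes a point of $X$. Here a square complex is a cube complex of dimension at most $2$, and it is $\mathrm{CAT}(0)$ if it is nonempty, simply connected, and every vertex link is a flag complex. It need not be finite or locally finite, and the fixed point is a point of the geometric realization, not necessarily a vertex. -/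

import Mathlib

open Filter Topology

universe u v

/-- A cube complex of dimension at most two on the vertex set `V`. Edges are given by a simple
graph, and `IsSquare a b c d` says that the 4-cycle `a, b, c, d` (in this cyclic order) is the
boundary of a square. The last three conditions say that cubes are embedded and that two cubes
are disjoint or meet in a common face; the definition of a cubical complex asks for this, and it
holds automatically for every cube complex that is CAT(0). -/
structure SquareComplex (V : Type u) where
  graph : SimpleGraph V
  IsSquare : V → V → V → V → Prop
  rotate : ∀ {a b c d : V}, IsSquare a b c d → IsSquare b c d a
  reflect : ∀ {a b c d : V}, IsSquare a b c d → IsSquare a d c b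
  adj : ∀ {a b c d : V}, IsSquare a b c d → graph.Adj a b
  diag_ne : ∀ {a b c d : V}, IsSquare a b c d → a ≠ c
  diag_not_adj : ∀ {a b c d : V}, IsSquare a b c d → ¬ graph.Adj a c
  diag_unique : ∀ {a b c d b' d' : V}, IsSquare a b c d → IsSquare a b' c d' →
    (b = b' ∧ d = d') ∨ (b = d' ∧ d = b')

namespace SquareComplex

variable {V : Type u} (X : SquareComplex V)

/-- Homotopy of edge paths relative to their endpoints: the smallest congruence under which
backtracks may be removed and two consecutive sides of a square may be replaced by the other
two. -/
inductive Homotopic : {u v : V} → X.graph.Walk u v → X.graph.Walk u v → Prop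
  | refl {u v : V} (p : X.graph.Walk u v) : Homotopic p p
  | symm {u v : V} {p q : X.graph.Walk u v} : Homotopic p q → Homotopic q p
  | trans {u v : V} {p q r : X.graph.Walk u v} :
      Homotopic p q → Homotopic q r → Homotopic p r
  | cons {u v w : V} (h : X.graph.Adj u v) {p q : X.graph.Walk v w} :
      Homotopic p q → Homotopic (SimpleGraph.Walk.cons h p) (SimpleGraph.Walk.cons h q)
  | backtrack {u v w : V} (h : X.graph.Adj u v) (p : X.graph.Walk u w) :
      Homotopic (SimpleGraph.Walk.cons h (SimpleGraph.Walk.cons h.symm p)) p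
  | square {a b c d w : V} (hab : X.graph.Adj a b) (hbc : X.graph.Adj b c)
      (had : X.graph.Adj a d) (hdc : X.graph.Adj d c) (hsq : X.IsSquare a b c d)
      (p : X.graph.Walk c w) :
      Homotopic (SimpleGraph.Walk.cons hab (SimpleGraph.Walk.cons hbc p))
        (SimpleGraph.Walk.cons had (SimpleGraph.Walk.cons hdc p))

/-- The complex is connected (in particular nonempty) and has trivial fundamental group: every
closed edge path is null-homotopic. -/
def IsSimplyConnected : Prop :=
  X.graph.Connected ∧
    ∀ (v : V) (p : X.graph.Walk v v), X.Homotopic p SimpleGraph.Walk.nil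

/-- The link of the vertex `v`: its vertices are the edges at `v` (that is, the neighbours of
`v`), and its edges are the corners of squares at `v`. By `diag_unique`, two edges at `v` span at
most one such corner, so the link is a simple graph. -/
def link (v : V) : SimpleGraph {b : V // X.graph.Adj v b} where
  Adj b d := ∃ c, X.IsSquare v b c d
  symm := ⟨fun _ _ ⟨c, h⟩ => ⟨c, X.reflect h⟩⟩
  loopless := ⟨fun _ ⟨_, h⟩ => X.diag_ne (X.rotate h) rfl⟩

/-- Gromov's link condition: all links are flag complexes. As there are no 3-cubes, links have
dimension at most one, so that being flag means having no three pairwise adjacent vertices. -/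
def IsNonpositivelyCurved : Prop :=
  ∀ v : V, (X.link v).CliqueFree 3

/-- A CAT(0) square complex is a simply connected, nonpositively curved square complex. -/
def IsCAT0 : Prop :=
  X.IsSimplyConnected ∧ X.IsNonpositivelyCurved

/-- The group of cubical automorphisms. -/
def aut : Subgroup (Equiv.Perm V) where
  carrier := {σ | (∀ a b, X.graph.Adj (σ a) (σ b) ↔ X.graph.Adj a b) ∧
    ∀ a b c d, X.IsSquare (σ a) (σ b) (σ c) (σ d) ↔ X.IsSquare a b c d}
  mul_mem' := fun {σ τ} hσ hτ =>
    ⟨fun a b => (hσ.1 (τ a) (τ b)).trans (hτ.1 a b),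
      fun a b c d => (hσ.2 (τ a) (τ b) (τ c) (τ d)).trans (hτ.2 a b c d)⟩
  one_mem' := ⟨fun _ _ => Iff.rfl, fun _ _ _ _ => Iff.rfl⟩
  inv_mem' := fun {σ} hσ =>
    ⟨fun a b => by simpa using (hσ.1 (σ⁻¹ a) (σ⁻¹ b)).symm,
      fun a b c d => by simpa using (hσ.2 (σ⁻¹ a) (σ⁻¹ b) (σ⁻¹ c) (σ⁻¹ d)).symm⟩

/-- Points of the geometric realization, which is embedded in the space of functions on the
vertex set: a vertex `a` is the indicator function of `a`, an edge is the segment between its two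
ends, and the square `a, b, c, d` is the image of the unit square under the multilinear map that
sends the corners `(0,0), (1,0), (1,1), (0,1)` to `a, b, c, d`. -/
def IsPoint (w : V → ℝ) : Prop :=
  (∃ a, w a = 1 ∧ ∀ v, v ≠ a → w v = 0) ∨
  (∃ a b, X.graph.Adj a b ∧ ∃ t ∈ Set.Icc (0 : ℝ) 1,
    w a = 1 - t ∧ w b = t ∧ ∀ v, v ≠ a → v ≠ b → w v = 0) ∨
  (∃ a b c d, X.IsSquare a b c d ∧ ∃ s ∈ Set.Icc (0 : ℝ) 1, ∃ t ∈ Set.Icc (0 : ℝ) 1,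
    w a = (1 - s) * (1 - t) ∧ w b = s * (1 - t) ∧ w c = s * t ∧ w d = (1 - s) * t ∧
    ∀ v, v ≠ a → v ≠ b → v ≠ c → v ≠ d → w v = 0)

/-- The geometric realization. -/
def Realization : Type u := {w : V → ℝ // X.IsPoint w}

theorem IsPoint.comp_inv {X : SquareComplex V} {w : V → ℝ} (hw : X.IsPoint w) (σ : X.aut) :
    X.IsPoint (fun v => w ((σ : Equiv.Perm V)⁻¹ v)) := by
  obtain ⟨σ, hσ⟩ := σ
  have key : ∀ v a : V, v ≠ σ a → σ⁻¹ v ≠ a := by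
    rintro v a h rfl
    simp at h
  rcases hw with ⟨a, h1, h2⟩ | ⟨a, b, hab, t, ht, h1, h2, h3⟩ |
    ⟨a, b, c, d, hsq, s, hs, t, ht, h1, h2, h3, h4, h5⟩
  · exact Or.inl ⟨σ a, by simpa using h1, fun v hv => h2 _ (key v a hv)⟩
  · exact Or.inr (Or.inl ⟨σ a, σ b, (hσ.1 a b).2 hab, t, ht, by simpa using h1,
      by simpa using h2, fun v hva hvb => h3 _ (key v a hva) (key v b hvb)⟩)
  · exact Or.inr (Or.inr ⟨σ a, σ b, σ c, σ d, (hσ.2 a b c d).2 hsq, s, hs, t, ht,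
      by simpa using h1, by simpa using h2, by simpa using h3, by simpa using h4,
      fun v hva hvb hvc hvd =>
        h5 _ (key v a hva) (key v b hvb) (key v c hvc) (key v d hvd)⟩)

/-- Cubical automorphisms act on the geometric realization, affinely on each cube. -/
instance : MulAction X.aut X.Realization where
  smul σ p := ⟨fun v => p.1 ((σ : Equiv.Perm V)⁻¹ v), p.2.comp_inv σ⟩
  one_smul _ := rfl
  mul_smul _ _ _ := rfl

/-- An action `ρ` by cubical automorphisms has a global fixed point if it fixes a point of the
geometric realization (not necessarily a vertex). -/
def HasGlobalFixedPoint {G : Type v} [Group G] (ρ : G →* X.aut) : Prop :=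
  ∃ p : X.Realization, ∀ g : G, ρ g • p = p

end SquareComplex

/-- `G` does not act without global fixed point on a CAT(0) square complex. -/
def HasPropertyFC2 (G : Type v) [Group G] : Prop :=
  ∀ (V : Type u) (X : SquareComplex V), X.IsCAT0 →
    ∀ ρ : G →* X.aut, X.HasGlobalFixedPoint ρ

/-- Reduced words of length `L` in the letters `s₁, …, sₙ` and their inverses; the letter
`(i, true)` stands for `sᵢ` and `(i, false)` for its inverse. -/
abbrev ReducedWord (n L : ℕ) : Type :=
  {w : List.Vector (Fin n × Bool) L // FreeGroup.IsReduced w.toList}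

/-- The number of relators at density `d` and length `L`. -/
noncomputable def numRelators (n : ℕ) (d : ℝ) (L : ℕ) : ℕ :=
  ⌊(2 * (n : ℝ) - 1) ^ (d * (L : ℝ))⌋₊

/-- A tuple of relators at density `d` and length `L`. -/
abbrev Relators (n : ℕ) (d : ℝ) (L : ℕ) : Type :=
  Fin (numRelators n d L) → ReducedWord n L

/-- The group `⟨s₁, …, sₙ | R⟩`. -/
abbrev relatorGroup {n : ℕ} {d : ℝ} {L : ℕ} (R : Relators n d L) : Type :=
  PresentedGroup (Set.range fun i => FreeGroup.mk (R i).1.toList)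

/-- The probability that a random group on `n` generators at density `d` and length `L`, whose
tuple of relators is uniformly distributed, has the property `P`. -/
noncomputable def randomGroupProb (n : ℕ) (d : ℝ) (P : (G : Type) → [Group G] → Prop)
    (L : ℕ) : ℝ :=
  (Nat.card {R : Relators n d L // P (relatorGroup R)} : ℝ) / (Nat.card (Relators n d L) : ℝ)

/-- A random group on `n` generators at density `d` has the property `P` with overwhelming
probability. -/
def HoldsWithOverwhelmingProbability (n : ℕ) (d : ℝ)
    (P : (G : Type) → [Group G] → Prop) : Prop :=
  Tendsto (randomGroupProb n d P) atTop (𝓝 1)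

/-! A group acting on `X` with an invariant cube fixes its barycentre. So if the random group acts
without fixed point, the free group acts on the cubical subdivision without fixed vertex. From such
an action one extracts a finite automaton whose letters are the elements of the sphere of radius `m`
of the free group, for a fixed odd `m`. Its number of states depends only on `n` and `m`, each state
admits at least |sphere(m - 2)| / 2195456 letters, and every product it reads acts nontrivially
(`exists_automaton`). No relator can be conjugate to such a product.

Construction of the automaton. Let `v` minimize the total displacement over the sphere. The states
are neighbours `a` of `v`, each standing for the halfspace `half a v`, and `c` leads from `a` to `b`
when the halfspace at `a`, pulled back by `c`, lies in the halfspace at `b`. If `g` has been read,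
then `g⁻¹ • v` lies in a halfspace that misses `v`, hence `g` moves `v`. By `reset_or_pass`, a
letter `c` with `c • v` outside the halfspace at `a` either resets `a` to a direction of `c⁻¹ • v`
or carries its halfspace exactly to another one at `v`. The obstruction is a state `Bad` to depth
three: few letters reset it, and few passes lead out of the bad states. Such a state may be
discarded if few letters point towards it, which is `cnt_dir_lt`: otherwise minimality of `v`,
tested first against the bad neighbour and then against the opposite vertex of a square at `v`,
produces letters whose action contradicts the invariance of dimension, the height function on the
subdivision. This is one reason for subdividing; the other is that dimension excludes inversions of
edges.

The geometry of halfspaces (parallel edges, convexity, medians) is derived from the quadrangle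
condition. That condition comes from rewriting edge paths across squares: flag links make a path
without hidden backtracks unique up to such rewriting in its homotopy class.

Counting. Put `b = 2n - 1`. Allowing at most nine cancelled letters at each multiplication, an
automaton reads at least (b^(m-11) / 4390912)^J distinct elements as products of `J + 1` letters
(`exists_runs`). Conjugation by a power of a generator pads them to reduced words of length `L`. The
loss per letter, a factor 4390912 b^11, does not depend on `m`, while the number of relators grows
by b^(dm) per `m` letters. For `m` large the relators win (`exists_many_relators`), and a given
automaton is avoided by all relators with probability exponentially small in `L`. The number of
automata does not depend on `L`, so a union bound (`one_sub_le_ratio`) finishes the proof. -/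

namespace SquareComplex

/-! ### Edge paths up to replacement across squares, and the quadrangle condition. -/

variable {V : Type u} (X : SquareComplex V)

/-- A single replacement of two consecutive sides of a square by the other two, in an edge path
given by the list of its vertices. -/
inductive Swap : List V → List V → Prop
  | top {x y z y' : V} (l : List V) (h : X.IsSquare x y z y') :
      Swap (x :: y :: z :: l) (x :: y' :: z :: l)
  | cons (a : V) {l l' : List V} (h : Swap l l') : Swap (a :: l) (a :: l')

/-- Edge paths related by replacements across squares. -/
def SwapEq : List V → List V → Prop := Relation.ReflTransGen X.Swap

/-- The edge path contains an immediate backtrack. -/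
def Backtracks : List V → Prop
  | x :: y :: z :: l => x = z ∨ Backtracks (y :: z :: l)
  | _ => False

/-- No edge path related to `l` by replacements across squares has a backtrack. -/
def Red (l : List V) : Prop := ∀ m, X.SwapEq l m → ¬ Backtracks m

variable {X}

theorem isSquare_ne {a b c d : V} (h : X.IsSquare a b c d) : b ≠ d :=
  X.diag_ne (X.rotate h)

theorem corner_unique {a b c c' d : V} (h : X.IsSquare a b c d) (h' : X.IsSquare a b c' d) :
    c = c' := by
  rcases X.diag_unique (X.rotate h) (X.rotate h') with h | h
  · exact h.1
  · exact h.1.trans h.2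

theorem Swap.symm {l l' : List V} (h : X.Swap l l') : X.Swap l' l := by
  induction h with
  | top l h => exact .top l (X.reflect h)
  | cons a _ ih => exact .cons a ih

namespace SwapEq

theorem refl (l : List V) : X.SwapEq l l := Relation.ReflTransGen.refl

theorem trans {l m r : List V} (h : X.SwapEq l m) (h' : X.SwapEq m r) : X.SwapEq l r :=
  Relation.ReflTransGen.trans h h'

theorem symm {l m : List V} (h : X.SwapEq l m) : X.SwapEq m l := by
  induction h with
  | refl => exact refl _
  | tail _ h ih => exact trans (Relation.ReflTransGen.single h.symm) ih

theorem cons (a : V) {l m : List V} (h : X.SwapEq l m) : X.SwapEq (a :: l) (a :: m) := by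
  induction h with
  | refl => exact refl _
  | tail _ h ih => exact trans ih (Relation.ReflTransGen.single (.cons a h))

theorem top {x y z y' : V} (l : List V) (h : X.IsSquare x y z y') :
    X.SwapEq (x :: y :: z :: l) (x :: y' :: z :: l) :=
  Relation.ReflTransGen.single (.top l h)

end SwapEq

theorem Swap.length_eq {l l' : List V} (h : X.Swap l l') : l.length = l'.length := by
  induction h with
  | top l h => rfl
  | cons a _ ih => simp [ih]

theorem SwapEq.length_eq {l l' : List V} (h : X.SwapEq l l') : l.length = l'.length := by
  induction h with
  | refl => rfl
  | tail _ h ih => exact ih.trans h.length_eq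

theorem Swap.exists_cons {a : V} {l m : List V} (h : X.Swap (a :: l) m) : ∃ l', m = a :: l' := by
  cases h with
  | top l h => exact ⟨_, rfl⟩
  | cons _ h => exact ⟨_, rfl⟩

theorem SwapEq.exists_cons {a : V} {l m : List V} (h : X.SwapEq (a :: l) m) :
    ∃ l', m = a :: l' := by
  induction h with
  | refl => exact ⟨_, rfl⟩
  | tail _ h ih => obtain ⟨l', rfl⟩ := ih; exact h.exists_cons

theorem SwapEq.exists_cons_cons {a b : V} {l m : List V} (h : X.SwapEq (a :: b :: l) m) :
    ∃ b' l', m = a :: b' :: l' := by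
  obtain ⟨l', rfl⟩ := h.exists_cons
  have := h.length_eq
  cases l' with
  | nil => simp at this
  | cons b' l' => exact ⟨_, _, rfl⟩

/-- A nonpositively curved complex has no three squares around a vertex. -/
theorem link_triangle (hX : X.IsNonpositivelyCurved) {v a b c p q r : V}
    (h1 : X.IsSquare v a p b) (h2 : X.IsSquare v b q c) (h3 : X.IsSquare v a r c) : False := by
  classical
  have ha := X.adj h1
  have hb := X.adj h2
  have hc := X.adj (X.reflect h3)
  refine hX v {⟨a, ha⟩, ⟨b, hb⟩, ⟨c, hc⟩} ?_
  rw [SimpleGraph.is3Clique_triple_iff]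
  exact ⟨⟨_, h1⟩, ⟨_, h3⟩, ⟨_, h2⟩⟩

/-- Two related paths with the same first vertex have the same first edge, or their first edges
span a square that can be used to go from one to the other. -/
theorem swapEq_cons_cons (hX : X.IsNonpositivelyCurved) (n : ℕ) :
    ∀ (x y y' : V) (l l' : List V), l.length = n → X.SwapEq (x :: y :: l) (x :: y' :: l') →
      (y = y' ∧ X.SwapEq (y :: l) (y' :: l')) ∨
      ∃ z r, X.IsSquare x y z y' ∧ X.SwapEq (y :: l) (y :: z :: r) ∧
        X.SwapEq (y' :: l') (y' :: z :: r) := by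
  induction n using Nat.strong_induction_on with
  | _ n IH =>
  intro x y y' l l' hl h
  generalize hm : x :: y' :: l' = m at h
  induction h generalizing y' l' with
  | refl =>
    simp only [List.cons.injEq, true_and] at hm
    obtain ⟨rfl, rfl⟩ := hm
    exact Or.inl ⟨rfl, .refl _⟩
  | @tail b c hb hc ih =>
    obtain ⟨w, t, rfl⟩ := SwapEq.exists_cons_cons hb
    have h1 := ih w t rfl
    subst hm
    have h2 : (w = y' ∧ X.SwapEq (w :: t) (y' :: l')) ∨
      ∃ z r, X.IsSquare x w z y' ∧ X.SwapEq (w :: t) (w :: z :: r) ∧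
        X.SwapEq (y' :: l') (y' :: z :: r) := by
      cases hc with
      | top l h => exact Or.inr ⟨_, _, h, .refl _, .refl _⟩
      | cons _ h =>
        obtain ⟨l', h'⟩ := h.exists_cons
        simp only [List.cons.injEq] at h'
        obtain ⟨rfl, rfl⟩ := h'
        exact Or.inl ⟨rfl, Relation.ReflTransGen.single h⟩
    rcases h1 with ⟨rfl, h1⟩ | ⟨z, r, hs, ha, hb'⟩
    · rcases h2 with ⟨rfl, h2⟩ | ⟨z, r, hs, ha, hb⟩
      · exact Or.inl ⟨rfl, h1.trans h2⟩
      · exact Or.inr ⟨z, r, hs, h1.trans ha, hb⟩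
    · rcases h2 with ⟨rfl, h2⟩ | ⟨z2, r2, hs2, ha2, hb2⟩
      · exact Or.inr ⟨z, r, hs, ha, h2.symm.trans hb'⟩
      · have hlen : r.length < n := by
          have := ha.length_eq
          simp at this
          omega
        -- Two squares meet along the edge from `x` to `w`; compare the shorter continuations beyond
        -- `w`. If they leave `w` by the same edge, the two squares share a diagonal and coincide.
        -- Otherwise they span a third square at `w`, and `x`, `z`, `z2` form a triangle in the link
        -- of `w`.
        rcases IH r.length hlen w z z2 r r2 rfl (hb'.symm.trans ha2) with ⟨rfl, h⟩ | ⟨q, s, hq, -, -⟩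
        · rcases X.diag_unique hs (X.reflect hs2) with ⟨rfl, -⟩ | ⟨h1, h2⟩
          · exact Or.inl ⟨rfl, ha.trans ((h.cons _).trans hb2.symm)⟩
          · exact absurd h1 (isSquare_ne hs)
        · have k1 : X.IsSquare w x y z := X.rotate (X.rotate (X.rotate hs))
          have k2 : X.IsSquare w z2 y' x := X.rotate hs2
          exact (link_triangle hX k1 hq (X.reflect k2)).elim

theorem SwapEq.cancel (hX : X.IsNonpositivelyCurved) {x y : V} {l l' : List V}
    (h : X.SwapEq (x :: y :: l) (x :: y :: l')) : X.SwapEq (y :: l) (y :: l') := by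
  rcases swapEq_cons_cons hX _ x y y l l' rfl h with h | ⟨z, r, h, -, -⟩
  · exact h.2
  · exact absurd rfl (isSquare_ne h)

theorem SwapEq.exists_square (hX : X.IsNonpositivelyCurved) {x y y' : V} {l l' : List V}
    (h : X.SwapEq (x :: y :: l) (x :: y' :: l')) (hne : y ≠ y') :
    ∃ z r, X.IsSquare x y z y' ∧ X.SwapEq (y :: l) (y :: z :: r) ∧
        X.SwapEq (y' :: l') (y' :: z :: r) := by
  rcases swapEq_cons_cons hX _ x y y' l l' rfl h with h | h
  · exact absurd h.1 hne
  · exact h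

theorem Backtracks.cons {a : V} {l : List V} (h : Backtracks l) : Backtracks (a :: l) := by
  match l, h with
  | x :: y :: z :: l, h => exact Or.inr h

theorem Red.tail {a : V} {l : List V} (h : X.Red (a :: l)) : X.Red l :=
  fun _ hm hb => h _ (hm.cons a) hb.cons

theorem Red.congr {l m : List V} (h : X.Red l) (hm : X.SwapEq l m) : X.Red m :=
  fun _ hr => h _ (hm.trans hr)

theorem red_singleton (a : V) : X.Red [a] := by
  intro m hm hb
  obtain ⟨l, rfl⟩ := hm.exists_cons
  have := hm.length_eq
  cases l with
  | nil => exact hb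
  | cons => simp at this

/-- A backtrack that appears only after swaps can be traced to the first edge. If the first edge has
changed from `x` to `y`, there is a square on `w`, `x`, `z`, `y`. A backtrack at `y` forces, by
uniqueness of corners, a backtrack of `x :: l` at `z`; a later one contradicts the induction
hypothesis for the shorter path through `y` and `z`. -/
theorem red_cons (hX : X.IsNonpositivelyCurved) (n : ℕ) :
    ∀ (x w : V) (l : List V), l.length = n → X.Red (x :: l) →
      (∀ l', ¬ X.SwapEq (x :: l) (x :: w :: l')) → X.Red (w :: x :: l) := by
  induction n using Nat.strong_induction_on with
  | _ n IH =>
  intro x w l hl hr hn m hm hb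
  obtain ⟨y, l', rfl⟩ := hm.exists_cons_cons
  rcases swapEq_cons_cons hX _ w x y l l' rfl hm with ⟨rfl, h⟩ | ⟨z, r, hs, ha, hc⟩
  · match l', hb with
    | z :: t, hb =>
      rcases hb with rfl | hb
      · exact hn _ h
      · exact hr _ h hb
  · have key : ∀ t, ¬ X.SwapEq (z :: r) (z :: y :: t) := fun t ht =>
      hn _ (ha.trans ((ht.cons x).trans (.top t (X.rotate hs))))
    match l', hb with
    | w' :: t, hb =>
      rcases hb with rfl | hb
      · obtain ⟨p, s, hp, -, h2⟩ := hc.exists_square hX (X.diag_ne hs)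
        have hs' : X.IsSquare y w x z := X.rotate (X.rotate (X.rotate hs))
        obtain rfl := corner_unique hp hs'
        exact hr _ (ha.trans (h2.cons _)) (Or.inl rfl)
      · have hlen : r.length < n := by
          have := ha.length_eq
          simp at this
          omega
        exact IH _ hlen z y r rfl (hr.congr ha).tail key _ hc.symm hb

open Classical in
/-- Extension of a path class by one edge, with reduction if it backtracks. -/
noncomputable def act (X : SquareComplex V) (w : V) : List V → List V
  | [] => [w]
  | x :: l => if h : ∃ l', X.SwapEq (x :: l) (x :: w :: l') then w :: h.choose else w :: x :: l

theorem act_of_cancel (hX : X.IsNonpositivelyCurved) {w x : V} {l l' : List V}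
    (h : X.SwapEq (x :: l) (x :: w :: l')) : X.SwapEq (X.act w (x :: l)) (w :: l') := by
  have h' : ∃ l', X.SwapEq (x :: l) (x :: w :: l') := ⟨_, h⟩
  rw [act, dif_pos h']
  exact (h'.choose_spec.symm.trans h).cancel hX

theorem act_of_not {w x : V} {l : List V} (h : ∀ l', ¬ X.SwapEq (x :: l) (x :: w :: l')) :
    X.act w (x :: l) = w :: x :: l := by
  rw [act, dif_neg (not_exists.2 h)]

theorem act_exists_cons (w : V) (l : List V) : ∃ l', X.act w l = w :: l' := by
  cases l with
  | nil => exact ⟨_, rfl⟩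
  | cons x l => rw [act]; split <;> exact ⟨_, rfl⟩

theorem act_congr (hX : X.IsNonpositivelyCurved) {w : V} {l m : List V} (h : X.SwapEq l m) :
    X.SwapEq (X.act w l) (X.act w m) := by
  cases l with
  | nil =>
    have := h.length_eq
    simp only [List.length_nil] at this
    obtain rfl := List.length_eq_zero_iff.1 this.symm
    exact .refl _
  | cons x l =>
    obtain ⟨m, rfl⟩ := h.exists_cons
    by_cases h' : ∃ l', X.SwapEq (x :: l) (x :: w :: l')
    · obtain ⟨l', h'⟩ := h'
      exact (act_of_cancel hX h').trans (act_of_cancel hX (h.symm.trans h')).symm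
    · rw [not_exists] at h'
      rw [act_of_not h', act_of_not fun l' hl' => h' l' (h.trans hl')]
      exact h.cons w

theorem Red.act (hX : X.IsNonpositivelyCurved) {w : V} {l : List V} (h : X.Red l) :
    X.Red (X.act w l) := by
  cases l with
  | nil => exact red_singleton w
  | cons x l =>
    by_cases h' : ∃ l', X.SwapEq (x :: l) (x :: w :: l')
    · obtain ⟨l', h'⟩ := h'
      exact (h.congr h').tail.congr (act_of_cancel hX h').symm
    · rw [not_exists] at h'
      rw [act_of_not h']
      exact red_cons hX _ x w l rfl h h'

/-- Together with `act_square` this says that extension of reduced classes respects the two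
generators of homotopy of edge paths. Reducedness matters when `w` cancels: the remaining path must
not begin with a step to `x`. -/
theorem act_backtrack (hX : X.IsNonpositivelyCurved) {w x : V} {l : List V}
    (h : X.Red (x :: l)) : X.SwapEq (X.act x (X.act w (x :: l))) (x :: l) := by
  by_cases h' : ∃ l', X.SwapEq (x :: l) (x :: w :: l')
  · obtain ⟨l', h'⟩ := h'
    refine (act_congr hX (act_of_cancel hX h')).trans ?_
    rw [act_of_not]
    · exact h'.symm
    · intro l2 h2
      exact h _ (h'.trans (h2.cons x)) (Or.inl rfl)
  · rw [not_exists] at h'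
    rw [act_of_not h']
    exact act_of_cancel hX (.refl _)

theorem act_square_of_cancel (hX : X.IsNonpositivelyCurved) {x b c d : V} {l l1 : List V}
    (hs : X.IsSquare x b c d) (h : X.SwapEq (x :: l) (x :: b :: l1)) :
    X.SwapEq (X.act c (X.act b (x :: l))) (X.act c (X.act d (x :: l))) := by
  refine (act_congr hX (act_of_cancel hX h)).trans ?_
  by_cases h2 : ∃ l2, X.SwapEq (b :: l1) (b :: c :: l2)
  · obtain ⟨l2, h2⟩ := h2
    have h3 : X.SwapEq (x :: l) (x :: d :: c :: l2) := h.trans ((h2.cons x).trans (.top l2 hs))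
    exact (act_of_cancel hX h2).trans
      ((act_congr hX (act_of_cancel hX h3)).trans (act_of_cancel hX (.refl _))).symm
  · rw [not_exists] at h2
    rw [act_of_not h2, act_of_not (w := d)]
    · refine (act_of_cancel hX ?_).symm
      exact (h.cons d).trans (.top l1 (X.rotate (X.rotate (X.rotate hs))))
    · intro l3 h3
      obtain ⟨z, r, hz, h4, -⟩ := (h.symm.trans h3).exists_square hX (isSquare_ne hs)
      obtain rfl := corner_unique hz hs
      exact h2 _ h4

theorem act_square (hX : X.IsNonpositivelyCurved) {x b c d : V} {l : List V}
    (hs : X.IsSquare x b c d) :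
    X.SwapEq (X.act c (X.act b (x :: l))) (X.act c (X.act d (x :: l))) := by
  by_cases hb : ∃ l1, X.SwapEq (x :: l) (x :: b :: l1)
  · obtain ⟨l1, hb⟩ := hb
    exact act_square_of_cancel hX hs hb
  by_cases hd : ∃ l1, X.SwapEq (x :: l) (x :: d :: l1)
  · obtain ⟨l1, hd⟩ := hd
    exact (act_square_of_cancel hX (X.reflect hs) hd).symm
  rw [not_exists] at hb hd
  have key : ∀ b d, X.IsSquare x b c d → (∀ l1, ¬ X.SwapEq (x :: l) (x :: d :: l1)) →
      ∀ l1, ¬ X.SwapEq (b :: x :: l) (b :: c :: l1) := by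
    intro b d hs hd l1 h
    obtain ⟨z, r, hz, h4, -⟩ := h.exists_square hX (X.diag_ne hs)
    have : X.IsSquare b x d c := X.reflect (X.rotate hs)
    obtain rfl := corner_unique hz this
    exact hd _ h4
  rw [act_of_not hb, act_of_not hd, act_of_not (key b d hs hd),
    act_of_not (key d b (X.reflect hs) hb)]
  exact .top l (X.reflect (X.rotate (X.rotate hs)))

/-- The normal form of an edge path. -/
noncomputable def rho (X : SquareComplex V) : List V → List V
  | [] => []
  | w :: l => X.act w (rho X l)

theorem Red.rho_swapEq (hX : X.IsNonpositivelyCurved) {l : List V} (h : X.Red l) :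
    X.SwapEq (X.rho l) l := by
  induction l with
  | nil => exact .refl _
  | cons w l ih =>
    refine (act_congr hX (ih h.tail)).trans ?_
    cases l with
    | nil => exact .refl _
    | cons x l =>
      rw [act_of_not]
      · exact .refl _
      · intro l' hl'
        exact h _ (hl'.cons w) (Or.inl rfl)

/-- The list of vertices of an edge path that ends at `o`. -/
inductive IsPath (X : SquareComplex V) (o : V) : List V → Prop
  | single : IsPath X o [o]
  | cons {w x : V} {l : List V} (h : X.graph.Adj w x) (hl : IsPath X o (x :: l)) :
      IsPath X o (w :: x :: l)

theorem Swap.isPath {o : V} {l l' : List V} (h : X.Swap l l') (hl : X.IsPath o l) :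
    X.IsPath o l' := by
  induction h with
  | top l h =>
    cases hl with
    | cons h1 hl =>
      cases hl with
      | cons h2 hl =>
        exact .cons (X.adj (X.reflect h)) (.cons (X.adj (X.rotate (X.reflect h))) hl)
  | cons a h ih =>
    cases hl with
    | single => cases h
    | cons h1 hl =>
      obtain ⟨l2, rfl⟩ := h.exists_cons
      exact .cons h1 (ih hl)

theorem SwapEq.isPath {o : V} {l l' : List V} (h : X.SwapEq l l') (hl : X.IsPath o l) :
    X.IsPath o l' := by
  induction h with
  | refl => exact hl
  | tail _ h ih => exact h.isPath ih

theorem IsPath.dist_le (hc : X.graph.Connected) {o x : V} {l : List V}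
    (h : X.IsPath o (x :: l)) : X.graph.dist o x ≤ l.length := by
  induction l generalizing x with
  | nil => cases h; simp
  | cons y l ih =>
    cases h with
    | cons h1 hl =>
      have h2 := hc.dist_triangle (u := o) (v := y) (w := x)
      have h3 : X.graph.dist y x = 1 := SimpleGraph.dist_eq_one_iff_adj.2 h1.symm
      have := ih hl
      simp only [List.length_cons]
      omega

theorem IsPath.exists_shorter {o x : V} {l : List V} (h : X.IsPath o (x :: l))
    (hb : Backtracks (x :: l)) : ∃ l', X.IsPath o (x :: l') ∧ l'.length < l.length := by
  induction l generalizing x with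
  | nil => exact hb.elim
  | cons y l ih =>
    cases h with
    | cons h1 hl =>
      cases hl with
      | single => exact hb.elim
      | @cons _ z l h2 hl =>
        rcases hb with rfl | hb
        · exact ⟨_, hl, by simp⟩
        · obtain ⟨l', h3, h4⟩ := ih (.cons h2 hl) hb
          exact ⟨_, .cons h1 h3, by simpa using h4⟩

theorem exists_isPath (hc : X.graph.Connected) (o x : V) :
    ∃ l, X.IsPath o (x :: l) ∧ l.length = X.graph.dist o x := by
  have key : ∀ {x : V} (p : X.graph.Walk x o), ∃ l, X.IsPath o (x :: l) ∧ l.length = p.length := by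
    intro x p
    induction p with
    | nil => exact ⟨[], .single, rfl⟩
    | cons h p ih =>
      obtain ⟨l, h1, h2⟩ := ih
      exact ⟨_, .cons h h1, by simp [h2]⟩
  obtain ⟨p, hp⟩ := hc.exists_walk_length_eq_dist x o
  obtain ⟨l, h1, h2⟩ := key p
  exact ⟨l, h1, by rw [h2, hp, SimpleGraph.dist_comm]⟩

/-- The normal form of an edge path depends only on its ends. -/
def UniqueNormalForms (X : SquareComplex V) : Prop :=
  ∀ (o x : V) (l l' : List V), X.IsPath o (x :: l) → X.IsPath o (x :: l') →
    X.SwapEq (X.rho (x :: l)) (X.rho (x :: l'))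

/-- The quadrangle condition. -/
theorem quadrangle (hX : X.IsNonpositivelyCurved) (hc : X.graph.Connected)
    (hu : X.UniqueNormalForms) {o x y y' : V} (hy : X.graph.Adj x y) (hy' : X.graph.Adj x y')
    (hne : y ≠ y') (h : X.graph.dist o y + 1 = X.graph.dist o x)
    (h' : X.graph.dist o y' + 1 = X.graph.dist o x) :
    ∃ z, X.IsSquare x y z y' ∧ X.graph.dist o z + 2 = X.graph.dist o x := by
  -- Geodesics are reduced: swaps preserve length and endpoints, and a backtrack would give a
  -- strictly shorter path.
  have key : ∀ y, X.graph.Adj x y → X.graph.dist o y + 1 = X.graph.dist o x →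
      ∃ l, X.IsPath o (x :: y :: l) ∧ X.Red (x :: y :: l) ∧ l.length = X.graph.dist o y := by
    intro y hy h
    obtain ⟨l, hl, hlen⟩ := exists_isPath hc o y
    refine ⟨l, .cons hy hl, ?_, hlen⟩
    intro m hm hb
    have hp := hm.isPath (.cons hy hl)
    obtain ⟨m, rfl⟩ := hm.exists_cons
    obtain ⟨m', h1, h2⟩ := hp.exists_shorter hb
    have h3 := h1.dist_le hc
    have h4 := hm.length_eq
    simp only [List.length_cons] at h4
    omega
  obtain ⟨l, h1, h2, h3⟩ := key y hy h
  obtain ⟨l', h1', h2', h3'⟩ := key y' hy' h'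
  -- A reduced path is its own normal form, so two geodesics with the same ends are related by
  -- swaps, and different first edges must span a square.
  have h4 : X.SwapEq (x :: y :: l) (x :: y' :: l') :=
    (h2.rho_swapEq hX).symm.trans ((hu o x _ _ h1 h1').trans (h2'.rho_swapEq hX))
  obtain ⟨z, r, hz, h5, -⟩ := h4.exists_square hX hne
  refine ⟨z, hz, ?_⟩
  have h6 : X.IsPath o (y :: z :: r) := by
    refine h5.isPath ?_
    cases h1 with
    | cons _ h => exact h
  have h7 : X.graph.dist o z ≤ r.length := by
    cases h6 with
    | cons _ h => exact h.dist_le hc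
  have h8 := h5.length_eq
  simp only [List.length_cons] at h8
  have h9 := hc.dist_triangle (u := o) (v := z) (w := y)
  have h10 : X.graph.dist z y = 1 :=
    SimpleGraph.dist_eq_one_iff_adj.2 (X.adj (X.rotate hz)).symm
  omega

end SquareComplex

/-! ### The cubical subdivision. -/

namespace SquareComplex

variable {V : Type u} (X : SquareComplex V)

/-- The cubes of a square complex, as sets of vertices. -/
def Cube : Type u := {S : Set V // (∃ a, S = {a}) ∨ (∃ a b, X.graph.Adj a b ∧ S = {a, b}) ∨
  ∃ a b c d, X.IsSquare a b c d ∧ S = {a, b, c, d}}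

variable {X}

namespace Cube

/-- A vertex as a cube. -/
def vtx (X : SquareComplex V) (a : V) : X.Cube := ⟨{a}, Or.inl ⟨a, rfl⟩⟩

/-- An edge as a cube. -/
def edg {a b : V} (h : X.graph.Adj a b) : X.Cube := ⟨{a, b}, Or.inr (Or.inl ⟨a, b, h, rfl⟩)⟩

/-- A square as a cube. -/
def sqr {a b c d : V} (h : X.IsSquare a b c d) : X.Cube :=
  ⟨{a, b, c, d}, Or.inr (Or.inr ⟨a, b, c, d, h, rfl⟩)⟩

theorem edg_symm {a b : V} (h : X.graph.Adj a b) : edg h.symm = edg h :=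
  Subtype.ext (Set.pair_comm b a)

theorem sqr_rotate {a b c d : V} (h : X.IsSquare a b c d) : sqr (X.rotate h) = sqr h := by
  refine Subtype.ext ?_
  ext v
  simp only [sqr, Set.mem_insert_iff, Set.mem_singleton_iff]
  tauto

theorem sqr_reflect {a b c d : V} (h : X.IsSquare a b c d) : sqr (X.reflect h) = sqr h := by
  refine Subtype.ext ?_
  ext v
  simp only [sqr, Set.mem_insert_iff, Set.mem_singleton_iff]
  tauto

/-- The dimension of a cube. -/
noncomputable def dim (C : X.Cube) : ℤ := (Nat.log 2 C.1.ncard : ℤ)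

theorem dim_vtx (a : V) : (vtx X a).dim = 0 := by
  simp [dim, vtx]

theorem dim_edg {a b : V} (h : X.graph.Adj a b) : (edg h).dim = 1 := by
  simp only [dim, edg]
  rw [Set.ncard_pair h.ne]
  norm_num

theorem dim_sqr {a b c d : V} (h : X.IsSquare a b c d) : (sqr h).dim = 2 := by
  have h1 : a ≠ b := (X.adj h).ne
  have h2 : b ≠ c := (X.adj (X.rotate h)).ne
  have h3 : c ≠ d := (X.adj (X.rotate (X.rotate h))).ne
  have h4 : d ≠ a := (X.adj (X.rotate (X.rotate (X.rotate h)))).ne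
  have h5 := X.diag_ne h
  have h6 := isSquare_ne h
  have : ({a, b, c, d} : Set V).ncard = 4 := by
    rw [Set.ncard_insert_of_notMem (by simp [h1, h5, h4.symm]),
      Set.ncard_insert_of_notMem (by simp [h2, h6]), Set.ncard_pair h3]
  simp only [dim, sqr]
  rw [this, show 4 = 2 ^ 2 by norm_num, Nat.log_pow (by norm_num)]
  rfl

theorem vtx_inj {a b : V} (h : vtx X a = vtx X b) : a = b :=
  Set.singleton_injective (congrArg Subtype.val h)

theorem edg_inj {a b c : V} {h : X.graph.Adj a b} {h' : X.graph.Adj a c} (e : edg h = edg h') :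
    b = c := by
  have h1 : b ∈ ({a, c} : Set V) := by
    have : ({a, b} : Set V) = {a, c} := congrArg Subtype.val e
    rw [← this]
    simp
  rcases h1 with rfl | h1
  · exact absurd rfl h.ne
  · exact h1

theorem eq_or_eq_of_adj {x y z y' u : V} (h : X.IsSquare x y z y') (hu : X.graph.Adj x u)
    (hm : u ∈ (sqr h).1) : u = y ∨ u = y' := by
  rcases hm with rfl | rfl | rfl | hm
  · exact absurd rfl hu.ne
  · exact Or.inl rfl
  · exact absurd hu (X.diag_not_adj h)
  · exact Or.inr hm

/-- `C` is a codimension one face of `D`. -/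
def Cov (C D : X.Cube) : Prop :=
  (∃ (x y : V) (h : X.graph.Adj x y), C = vtx X x ∧ D = edg h) ∨
  ∃ (x y z y' : V) (h : X.IsSquare x y z y'), C = edg (X.adj h) ∧ D = sqr h

theorem Cov.dim_eq {C D : X.Cube} (h : Cov C D) : D.dim = C.dim + 1 := by
  rcases h with ⟨x, y, h, rfl, rfl⟩ | ⟨x, y, z, y', h, rfl, rfl⟩
  · rw [dim_vtx, dim_edg]; rfl
  · rw [dim_sqr, dim_edg]; rfl

/-- The square of the subdivision inside a square of `X` at one of its vertices. -/
def Corner (A B C D : X.Cube) : Prop :=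
  ∃ (x y z y' : V) (h : X.IsSquare x y z y'), A = vtx X x ∧ B = edg (X.adj h) ∧ C = sqr h ∧
    D = edg (X.adj (X.reflect h))

theorem Corner.symm {A B C D : X.Cube} (h : Corner A B C D) : Corner A D C B := by
  obtain ⟨x, y, z, y', h, rfl, rfl, rfl, rfl⟩ := h
  exact ⟨x, y', z, y, X.reflect h, rfl, rfl, (sqr_reflect h).symm, rfl⟩

theorem Corner.dims {A B C D : X.Cube} (h : Corner A B C D) :
    A.dim = 0 ∧ B.dim = 1 ∧ C.dim = 2 ∧ D.dim = 1 := by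
  obtain ⟨x, y, z, y', h, rfl, rfl, rfl, rfl⟩ := h
  exact ⟨dim_vtx _, dim_edg _, dim_sqr _, dim_edg _⟩

theorem Corner.cov₁ {A B C D : X.Cube} (h : Corner A B C D) : Cov A B := by
  obtain ⟨x, y, z, y', h, rfl, rfl, rfl, rfl⟩ := h
  exact Or.inl ⟨_, _, _, rfl, rfl⟩

theorem Corner.cov₂ {A B C D : X.Cube} (h : Corner A B C D) : Cov B C := by
  obtain ⟨x, y, z, y', h, rfl, rfl, rfl, rfl⟩ := h
  exact Or.inr ⟨_, _, _, _, _, rfl, rfl⟩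

theorem Corner.ne {A B C D : X.Cube} (h : Corner A B C D) : B ≠ D := by
  obtain ⟨x, y, z, y', h, rfl, rfl, rfl, rfl⟩ := h
  exact fun e => isSquare_ne h (edg_inj e)

theorem Corner.unique_edges {A B C D B' D' : X.Cube} (h : Corner A B C D)
    (h' : Corner A B' C D') : (B = B' ∧ D = D') ∨ (B = D' ∧ D = B') := by
  have hne := h'.ne
  obtain ⟨x, y, z, y', h, rfl, rfl, rfl, rfl⟩ := h
  obtain ⟨x1, y1, z1, y1', h1, hx, rfl, hs, rfl⟩ := h'
  obtain rfl := vtx_inj hx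
  have e1 : y1 ∈ (sqr h).1 := by rw [hs]; simp [sqr]
  have e2 : y1' ∈ (sqr h).1 := by rw [hs]; simp [sqr]
  rcases eq_or_eq_of_adj h (X.adj h1) e1 with rfl | rfl <;>
    rcases eq_or_eq_of_adj h (X.adj (X.reflect h1)) e2 with rfl | rfl
  · exact absurd rfl hne
  · exact Or.inl ⟨rfl, rfl⟩
  · exact Or.inr ⟨rfl, rfl⟩
  · exact absurd rfl hne

theorem Corner.unique_ends {A B C D A' C' : X.Cube} (h : Corner A B C D)
    (h' : Corner A' B C' D) : A = A' ∧ C = C' := by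
  obtain ⟨x, y, z, y', h, rfl, rfl, rfl, rfl⟩ := h
  obtain ⟨x1, y1, z1, y1', h1, rfl, hb, rfl, hd⟩ := h'
  have e1 : x1 ∈ ({x, y} : Set V) := by
    have : ({x, y} : Set V) = {x1, y1} := congrArg Subtype.val hb
    rw [this]; simp
  have e2 : x1 ∈ ({x, y'} : Set V) := by
    have : ({x, y'} : Set V) = {x1, y1'} := congrArg Subtype.val hd
    rw [this]; simp
  have : x1 = x := by
    rcases e1 with e1 | e1
    · exact e1
    · rcases e2 with e2 | e2
      · exact e2
      · exact absurd (e1.symm.trans e2) (isSquare_ne h)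
  subst this
  obtain rfl := edg_inj hb
  obtain rfl := edg_inj hd
  obtain rfl := corner_unique h h1
  exact ⟨rfl, rfl⟩

end Cube

open SquareComplex.Cube

variable (X) in
/-- The cubical subdivision. -/
noncomputable def subdivision : SquareComplex X.Cube where
  graph :=
    { Adj := fun C D => Cov C D ∨ Cov D C
      symm := ⟨fun _ _ h => h.symm⟩
      loopless := ⟨fun C h => by rcases h with h | h <;> have := h.dim_eq <;> omega⟩ }
  IsSquare A B C D := Corner A B C D ∨ Corner B C D A ∨ Corner C D A B ∨ Corner D A B C
  rotate := by tauto
  reflect := by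
    rintro a b c d (h | h | h | h)
    · exact Or.inl h.symm
    · exact Or.inr (Or.inr (Or.inr h.symm))
    · exact Or.inr (Or.inr (Or.inl h.symm))
    · exact Or.inr (Or.inl h.symm)
  adj := by
    rintro a b c d (h | h | h | h)
    · exact Or.inl h.cov₁
    · exact Or.inr h.symm.cov₁
    · exact Or.inr h.symm.cov₂
    · exact Or.inl h.cov₂
  diag_ne := by
    rintro a b c d (h | h | h | h) rfl
    · have := h.dims; omega
    · exact h.ne rfl
    · have := h.dims; omega
    · exact h.ne rfl
  diag_not_adj := by
    rintro a b c d (h | h | h | h) (h' | h') <;> have h1 := h.dims <;> have h2 := h'.dim_eq <;>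
      omega
  diag_unique := by
    rintro a b c d b' d' h h'
    have key : ∀ {a b c d b' d' : X.Cube}, Corner a b c d →
        (Corner a b' c d' ∨ Corner b' c d' a ∨ Corner c d' a b' ∨ Corner d' a b' c) →
        (b = b' ∧ d = d') ∨ (b = d' ∧ d = b') := by
      rintro a b c d b' d' h (h' | h' | h' | h')
      · exact h.unique_edges h'
      all_goals
        have := h.dims
        have := h'.dims
        omega
    have key' : ∀ {a b c d b' d' : X.Cube}, Corner b c d a →
        (Corner a b' c d' ∨ Corner b' c d' a ∨ Corner c d' a b' ∨ Corner d' a b' c) →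
        (b = b' ∧ d = d') ∨ (b = d' ∧ d = b') := by
      rintro a b c d b' d' h (h' | h' | h' | h')
      · have := h.dims
        have := h'.dims
        omega
      · exact Or.inl (h.unique_ends h')
      · have := h.dims
        have := h'.dims
        omega
      · exact Or.inr (h.unique_ends h'.symm)
    rcases h with h | h | h | h
    · exact key h h'
    · exact key' h h'
    · refine (key h (b' := d') (d' := b') (by tauto)).elim (fun e => ?_) (fun e => ?_)
      · exact Or.inl e.symm
      · exact Or.inr e.symm
    · have := key' h.symm h'
      tauto

theorem corner_mk {x y z y' : V} (h : X.IsSquare x y z y') :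
    X.subdivision.IsSquare (vtx X x) (edg (X.adj h)) (sqr h) (edg (X.adj (X.reflect h))) :=
  Or.inl ⟨_, _, _, _, h, rfl, rfl, rfl, rfl⟩

/-- The link at a vertex of `X` is the old link, the link at the midpoint of an edge is bipartite
between vertices and squares, and the link at the centre of a square is the 4-cycle of its edges. -/
theorem subdivision_isNonpositivelyCurved (hX : X.IsNonpositivelyCurved) :
    X.subdivision.IsNonpositivelyCurved := by
  classical
  intro S s hs
  rw [SimpleGraph.is3Clique_iff] at hs
  obtain ⟨⟨b1, k1⟩, ⟨b2, k2⟩, ⟨b3, k3⟩, ⟨p, hp⟩, ⟨q, hq⟩, ⟨r, hr⟩, -⟩ := hs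
  simp only at hp hq hr
  replace hp : Corner S b1 p b2 ∨ Corner b1 p b2 S ∨ Corner p b2 S b1 ∨ Corner b2 S b1 p := hp
  replace hq : Corner S b1 q b3 ∨ Corner b1 q b3 S ∨ Corner q b3 S b1 ∨ Corner b3 S b1 q := hq
  replace hr : Corner S b2 r b3 ∨ Corner b2 r b3 S ∨ Corner r b3 S b2 ∨ Corner b3 S b2 r := hr
  -- Dimensions rule out all but two of the 64 combinations: `S` is a vertex, or `S` is a square and
  -- three of its edges would pairwise share a corner.
  rcases hp with hp | hp | hp | hp <;> rcases hq with hq | hq | hq | hq <;>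
    rcases hr with hr | hr | hr | hr <;>
    try { have := hp.dims; have := hq.dims; have := hr.dims; omega }
  · obtain ⟨x, y, z, y', h, rfl, rfl, rfl, rfl⟩ := hp
    obtain ⟨x1, y1, z1, y1', h1, hx, hb, rfl, rfl⟩ := hq
    obtain rfl := vtx_inj hx
    obtain rfl := edg_inj hb
    obtain ⟨x1, y2, z2, y2', h2, hx, hb, rfl, hd⟩ := hr
    obtain rfl := vtx_inj hx
    obtain rfl := edg_inj hb
    obtain rfl := edg_inj hd
    exact link_triangle hX h h2 h1
  · have hne := hr.ne
    obtain ⟨x, y, z, y', h, rfl, rfl, rfl, rfl⟩ := hp.symm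
    obtain ⟨x1, y1, z1, y1', h1, rfl, rfl, hs, hb⟩ := hq
    obtain ⟨x2, y2, z2, y2', h2, rfl, hb3, -, hb2⟩ := hr
    have e1 : x1 ∈ ({x, y} : Set V) := by
      have : ({x, y} : Set V) = {x1, y1'} := congrArg Subtype.val hb
      rw [this]; simp
    have e2 : x2 ∈ ({x, y'} : Set V) := by
      have : ({x, y'} : Set V) = {x2, y2'} := congrArg Subtype.val hb2
      rw [this]; simp
    have e3 : y1 ∈ (sqr h).1 := by rw [hs]; simp [sqr]
    have e4 : x2 ∈ ({x1, y1} : Set V) := by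
      have : ({x1, y1} : Set V) = {x2, y2} := congrArg Subtype.val hb3
      rw [this]; simp
    rcases e1 with rfl | e1
    · obtain rfl := edg_inj hb
      rcases eq_or_eq_of_adj h (X.adj h1) e3 with rfl | rfl
      · exact isSquare_ne h1 rfl
      · exact hne rfl
    · replace e1 : x1 = y := e1
      subst e1
      have e5 : y1' = x := by
        have : x ∈ ({x1, y1'} : Set V) := by
          have e : ({x, x1} : Set V) = {x1, y1'} := congrArg Subtype.val hb
          rw [← e]; simp
        rcases this with e | e
        · exact absurd e (X.adj h).ne
        · exact e.symm
      subst e5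
      rcases e4 with rfl | e4
      · rcases e2 with e2 | e2
        · exact (X.adj h).ne e2.symm
        · exact isSquare_ne h e2
      · replace e4 : x2 = y1 := e4
        subst e4
        rcases e2 with rfl | e2
        · exact isSquare_ne h1 rfl
        · replace e2 : x2 = y' := e2
          subst e2
          exact X.diag_not_adj (X.rotate h) (X.adj h1)

end SquareComplex

/-! ### Simple connectivity of `X` gives unique normal forms in the subdivision. -/

namespace SquareComplex

open SquareComplex.Cube

variable {V : Type u} {X : SquareComplex V}

theorem Homotopic.append {u v w : V} {p q : X.graph.Walk u v} (h : X.Homotopic p q)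
    (r : X.graph.Walk v w) : X.Homotopic (p.append r) (q.append r) := by
  induction h with
  | refl p => exact .refl _
  | symm _ ih => exact .symm (ih r)
  | trans _ _ ih1 ih2 => exact .trans (ih1 r) (ih2 r)
  | cons h _ ih => exact .cons h (ih r)
  | backtrack h p => exact .backtrack h _
  | square hab hbc had hdc hsq p => exact .square hab hbc had hdc hsq _

theorem Homotopic.append_left {u v w : V} (r : X.graph.Walk u v) {p q : X.graph.Walk v w}
    (h : X.Homotopic p q) : X.Homotopic (r.append p) (r.append q) := by
  induction r with
  | nil => exact h
  | cons e _ ih => exact .cons e (ih h)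

theorem homotopic_of_isSimplyConnected (hX : X.IsSimplyConnected) {u v : V}
    (p q : X.graph.Walk u v) : X.Homotopic p q := by
  have h1 : X.Homotopic (p.append (q.reverse.append q)) (p.append .nil) :=
    .append_left p (hX.2 v _)
  have h2 : X.Homotopic ((p.append q.reverse).append q) (SimpleGraph.Walk.nil.append q) :=
    (hX.2 u _).append q
  rw [SimpleGraph.Walk.append_nil] at h1
  rw [SimpleGraph.Walk.nil_append, ← SimpleGraph.Walk.append_assoc] at h2
  exact h1.symm.trans h2

/-- The normal form of the subdivision of an edge path, prolonged by a given path. -/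
noncomputable def sd {o : V} (s : List X.Cube) : {x : V} → X.graph.Walk x o → List X.Cube
  | _, .nil => s
  | x, .cons h p => X.subdivision.act (vtx X x) (X.subdivision.act (edg h) (sd s p))

theorem sd_exists_cons {o x : V} {s : List X.Cube} (hs : ∃ l, s = vtx X o :: l)
    (p : X.graph.Walk x o) : ∃ l, sd s p = vtx X x :: l := by
  cases p with
  | nil => exact hs
  | cons h p => exact act_exists_cons _ _

theorem red_sd (hX : X.IsNonpositivelyCurved) {o x : V} {s : List X.Cube} (hr : X.subdivision.Red s)
    (p : X.graph.Walk x o) : X.subdivision.Red (sd s p) := by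
  have hX' := subdivision_isNonpositivelyCurved hX
  induction p with
  | nil => exact hr
  | cons h p ih => exact (Red.act hX' (Red.act hX' (ih)))

theorem sd_backtrack (hX : X.IsNonpositivelyCurved) {x y : V} {s : List X.Cube}
    (hr : X.subdivision.Red s) (h : X.graph.Adj x y) :
    X.subdivision.SwapEq (X.subdivision.act (edg h)
      (X.subdivision.act (vtx X y) (X.subdivision.act (edg h) s)))
      (X.subdivision.act (edg h) s) := by
  have hX' := subdivision_isNonpositivelyCurved hX
  have hr' := hr.act hX' (w := edg h)
  obtain ⟨l, hl⟩ := act_exists_cons (X := X.subdivision) (edg h) s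
  rw [hl] at hr' ⊢
  exact act_backtrack hX' hr'

theorem act_square' (hX : X.IsNonpositivelyCurved) {A B C D : X.Cube} {s : List X.Cube} (hs : ∃ l, s = A :: l)
    (h : X.subdivision.IsSquare A B C D) :
    X.subdivision.SwapEq (X.subdivision.act C (X.subdivision.act B s))
      (X.subdivision.act C (X.subdivision.act D s)) := by
  obtain ⟨l, rfl⟩ := hs
  exact act_square (subdivision_isNonpositivelyCurved hX) h

theorem act_backtrack' (hX : X.IsNonpositivelyCurved) {A B : X.Cube} {s : List X.Cube} (hs : ∃ l, s = A :: l)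
    (hr : X.subdivision.Red s) :
    X.subdivision.SwapEq (X.subdivision.act A (X.subdivision.act B s)) s := by
  obtain ⟨l, rfl⟩ := hs
  exact act_backtrack (subdivision_isNonpositivelyCurved hX) hr

/-- Homotopies in `X` are transported generator by generator, so that simple connectivity of the
subdivision itself never has to be established. -/
theorem sd_homotopic (hX : X.IsNonpositivelyCurved) {o x : V} {s : List X.Cube} (hr : X.subdivision.Red s)
    {o' : V} (hs : ∃ l, s = vtx X o' :: l) {p q : X.graph.Walk x o} (h : X.Homotopic p q)
    (ho : o = o') : X.subdivision.SwapEq (sd s p) (sd s q) := by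
  have hX' := subdivision_isNonpositivelyCurved hX
  induction h with
  | refl p => exact .refl _
  | symm _ ih => exact (ih ho).symm
  | trans _ _ ih1 ih2 => exact (ih1 ho).trans (ih2 ho)
  | cons h _ ih => exact act_congr hX' (act_congr hX' (ih ho))
  | backtrack h p =>
    subst ho
    simp only [sd]
    rw [edg_symm h]
    refine (act_congr hX' (sd_backtrack hX (red_sd hX hr p) h)).trans ?_
    exact act_backtrack' hX (sd_exists_cons hs p) (red_sd hX hr p)
  | @square a b c d w hab hbc had hdc hsq p =>
    subst ho
    simp only [sd]
    have e : ∃ l, sd s p = vtx X c :: l := sd_exists_cons hs p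
    have hbc' : edg hbc = edg hbc.symm := (edg_symm hbc).symm
    have hdc' : edg hdc = edg hdc.symm := (edg_symm hdc).symm
    -- the four corners of the square
    have c1 : X.subdivision.IsSquare (edg hbc) (vtx X b) (edg hab) (sqr hsq) := by
      have := X.subdivision.reflect (corner_mk (X.rotate hsq))
      rw [sqr_rotate hsq, ← edg_symm hab.symm] at this
      exact X.subdivision.rotate (X.subdivision.rotate (X.subdivision.rotate this))
    have c2 : X.subdivision.IsSquare (sqr hsq) (edg hab) (vtx X a) (edg had) := by
      exact X.subdivision.reflect (X.subdivision.rotate (X.subdivision.rotate (corner_mk hsq)))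
    have c3 : X.subdivision.IsSquare (vtx X c) (edg hbc) (sqr hsq) (edg hdc) := by
      have := X.subdivision.reflect (corner_mk (X.rotate (X.rotate hsq)))
      rw [sqr_rotate (X.rotate hsq), sqr_rotate hsq] at this
      rw [hbc', hdc']
      exact this
    have c4 : X.subdivision.IsSquare (sqr hsq) (edg hdc) (vtx X d) (edg had) := by
      have := corner_mk (X.rotate (X.rotate (X.rotate hsq)))
      rw [sqr_rotate (X.rotate (X.rotate hsq)), sqr_rotate (X.rotate hsq), sqr_rotate hsq,
        edg_symm had] at this
      exact X.subdivision.rotate (X.subdivision.rotate this)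
    have c5 : X.subdivision.IsSquare (edg hdc) (vtx X d) (edg had) (sqr hsq) :=
      X.subdivision.rotate c4
    -- The subdivided path through `b` is pushed to the centre of the square across the corners at
    -- `b`, `a` and `c`, and then out across the corner at `d`.
    refine (act_congr hX' (act_square' hX (act_exists_cons _ _) c1)).trans ?_
    refine (act_square' hX (act_exists_cons _ _) c2).trans ?_
    refine (act_congr hX' (act_congr hX' (act_square' hX e c3))).trans ?_
    exact act_congr hX' (act_square' hX (act_exists_cons _ _) c5).symm

/-- The path class `t`, ending at the cube `C`, comes from an edge path of `X` ending at the
vertex `x` of `C`. -/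
def Rep (o : V) (s : List X.Cube) (C : X.Cube) (x : V) (t : List X.Cube) : Prop :=
  ∃ p : X.graph.Walk x o,
    (C = vtx X x ∧ X.subdivision.SwapEq t (sd s p)) ∨
    (∃ (y : V) (h : X.graph.Adj x y), C = edg h ∧
      X.subdivision.SwapEq t (X.subdivision.act C (sd s p))) ∨
    ∃ (y z y' : V) (h : X.IsSquare x y z y'), C = sqr h ∧
      X.subdivision.SwapEq t (X.subdivision.act C (X.subdivision.act (edg (X.adj h)) (sd s p)))

theorem Rep.of_vtx {o : V} {s : List X.Cube} {x : V} {t : List X.Cube} (h : Rep o s (vtx X x) x t) :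
    ∃ p : X.graph.Walk x o, X.subdivision.SwapEq t (sd s p) := by
  obtain ⟨p, ⟨-, h⟩ | ⟨y, h, h1, -⟩ | ⟨y, z, y', h, h1, -⟩⟩ := h
  · exact ⟨p, h⟩
  · have := congrArg dim h1
    rw [dim_vtx, dim_edg] at this
    omega
  · have := congrArg dim h1
    rw [dim_vtx, dim_sqr] at this
    omega

theorem Rep.of_edg {o : V} {s : List X.Cube} {x y : V} {h : X.graph.Adj x y} {t : List X.Cube}
    (hR : Rep o s (edg h) x t) :
    ∃ p : X.graph.Walk x o, X.subdivision.SwapEq t (X.subdivision.act (edg h) (sd s p)) := by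
  obtain ⟨p, ⟨h1, -⟩ | ⟨y, h, h1, h2⟩ | ⟨y, z, y', h, h1, -⟩⟩ := hR
  · have := congrArg dim h1
    rw [dim_vtx, dim_edg] at this
    omega
  · exact ⟨p, h2⟩
  · have := congrArg dim h1
    rw [dim_edg, dim_sqr] at this
    omega

theorem Rep.of_sqr (hX : X.IsNonpositivelyCurved) {o : V} {s : List X.Cube}
    (hs : ∃ l, s = vtx X o :: l) {x y z y' : V} {hsq : X.IsSquare x y z y'} {t : List X.Cube}
    (hR : Rep o s (sqr hsq) x t) :
    ∃ p : X.graph.Walk x o, X.subdivision.SwapEq t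
      (X.subdivision.act (sqr hsq) (X.subdivision.act (edg (X.adj hsq)) (sd s p))) := by
  obtain ⟨p, ⟨h1, -⟩ | ⟨y, h, h1, h2⟩ | ⟨y1, z1, y1', h, h1, h2⟩⟩ := hR
  · have := congrArg dim h1
    rw [dim_vtx, dim_sqr] at this
    omega
  · have := congrArg dim h1
    rw [dim_edg, dim_sqr] at this
    omega
  · refine ⟨p, ?_⟩
    have e1 : y1 ∈ (sqr hsq).1 := by rw [h1]; simp [sqr]
    rcases eq_or_eq_of_adj hsq (X.adj h) e1 with rfl | rfl
    · exact h2
    · refine h2.trans (act_square' hX (sd_exists_cons hs p) ?_)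
      exact X.subdivision.reflect (corner_mk hsq)

theorem Rep.unique (hX : X.IsNonpositivelyCurved) {o : V} {s : List X.Cube}
    (hs : ∃ l, s = vtx X o :: l) (hc : X.IsSimplyConnected) (hr : X.subdivision.Red s) {C : X.Cube} {x : V}
    {t t' : List X.Cube} (h : Rep o s C x t) (h' : Rep o s C x t') :
    X.subdivision.SwapEq t t' := by
  have hX' := subdivision_isNonpositivelyCurved hX
  have key : ∀ p q : X.graph.Walk x o, X.subdivision.SwapEq (sd s p) (sd s q) := fun p q =>
    sd_homotopic hX hr hs (homotopic_of_isSimplyConnected hc p q) rfl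
  have h0 := h
  obtain ⟨p, ⟨rfl, h1⟩ | ⟨y, h, rfl, h1⟩ | ⟨y, z, y', h, rfl, h1⟩⟩ := h0
  · obtain ⟨q, h2⟩ := h'.of_vtx
    exact h1.trans ((key p q).trans h2.symm)
  · obtain ⟨q, h2⟩ := h'.of_edg
    exact h1.trans ((act_congr hX' (key p q)).trans h2.symm)
  · obtain ⟨q, h2⟩ := h'.of_sqr hX hs
    exact h1.trans ((act_congr hX' (act_congr hX' (key p q))).trans h2.symm)

theorem Rep.move_adj (hX : X.IsNonpositivelyCurved) {o : V} {s : List X.Cube}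
    (hs : ∃ l, s = vtx X o :: l) (hr : X.subdivision.Red s) {C : X.Cube} {x x' : V} {t : List X.Cube}
    (h : Rep o s C x t) (ha : X.graph.Adj x x') (hm : x' ∈ C.1) : Rep o s C x' t := by
  have hX' := subdivision_isNonpositivelyCurved hX
  obtain ⟨p, ⟨rfl, h1⟩ | ⟨y, h, rfl, h1⟩ | ⟨y, z, y', h, rfl, h1⟩⟩ := h
  · exact absurd hm.symm ha.ne
  · have : x' = y := by
      rcases hm with e | e
      · exact absurd e.symm ha.ne
      · exact e
    subst this
    refine ⟨.cons h.symm p, Or.inr (Or.inl ⟨x, h.symm, (edg_symm h).symm, ?_⟩)⟩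
    simp only [sd]
    rw [edg_symm h]
    exact h1.trans (sd_backtrack hX (red_sd hX hr p) h).symm
  · have key : ∀ {y y' : V} (h : X.IsSquare x y z y'), X.subdivision.SwapEq t
        (X.subdivision.act (sqr h) (X.subdivision.act (edg (X.adj h)) (sd s p))) →
        Rep o s (sqr h) y t := by
      intro y y' h h1
      have hq : X.IsSquare y x y' z := X.reflect (X.rotate h)
      have e : sqr hq = sqr h := (sqr_reflect (X.rotate h)).trans (sqr_rotate h)
      refine ⟨.cons (X.adj h).symm p, Or.inr (Or.inr ⟨x, y', z, hq, e.symm, ?_⟩)⟩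
      have e2 : edg (X.adj hq) = edg (X.adj h) := edg_symm (X.adj h)
      simp only [sd]
      rw [e2]
      exact h1.trans (act_congr hX' (sd_backtrack hX (red_sd hX hr p)
        (X.adj h)).symm)
    rcases eq_or_eq_of_adj h ha hm with rfl | rfl
    · exact key h h1
    · rw [← sqr_reflect h]
      refine key (X.reflect h) (h1.trans ?_)
      rw [sqr_reflect h]
      exact act_square' hX (sd_exists_cons hs p) (corner_mk h)

theorem Rep.move (hX : X.IsNonpositivelyCurved) {o : V} {s : List X.Cube}
    (hs : ∃ l, s = vtx X o :: l) (hr : X.subdivision.Red s) {C : X.Cube} {x x' : V} {t : List X.Cube}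
    (h : Rep o s C x t) (hm : x' ∈ C.1) : Rep o s C x' t := by
  have h0 := h
  obtain ⟨p, ⟨rfl, h1⟩ | ⟨y, h2, rfl, h1⟩ | ⟨y, z, y', h2, rfl, h1⟩⟩ := h0
  · obtain rfl : x' = x := hm
    exact h
  · rcases hm with rfl | hm
    · exact h
    · obtain rfl : x' = y := hm
      exact h.move_adj hX hs hr h2 (by simp [edg])
  · rcases hm with rfl | rfl | rfl | hm
    · exact h
    · exact h.move_adj hX hs hr (X.adj h2) (by simp [sqr])
    · exact (h.move_adj hX hs hr (X.adj h2) (by simp [sqr])).move_adj hX hs hr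
        (X.adj (X.rotate h2)) (by simp [sqr])
    · obtain rfl : x' = y' := hm
      exact h.move_adj hX hs hr (X.adj (X.reflect h2)) (by simp [sqr])

/-- Passing to a face undoes the last extension, provided the representing vertex is chosen in that
face; this is why the hypothesis is required at every vertex of `C`. Passing to a larger cube is one
more extension. -/
theorem Rep.step (hX : X.IsNonpositivelyCurved) {o : V} {s : List X.Cube}
    (hs : ∃ l, s = vtx X o :: l) (hr : X.subdivision.Red s) {C C' : X.Cube} {t : List X.Cube}
    (hC : ∀ x ∈ C.1, Rep o s C x t) (h : X.subdivision.graph.Adj C' C) :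
    ∃ x ∈ C'.1, Rep o s C' x (X.subdivision.act C' t) := by
  have hX' := subdivision_isNonpositivelyCurved hX
  rcases h with (⟨x, y, h, rfl, rfl⟩ | ⟨x, y, z, y', h, rfl, rfl⟩) |
    (⟨x, y, h, rfl, rfl⟩ | ⟨x, y, z, y', h, rfl, rfl⟩)
  · obtain ⟨p, hp⟩ := (hC x (by simp [edg])).of_edg
    refine ⟨x, by simp [vtx], p, Or.inl ⟨rfl, (act_congr hX' hp).trans ?_⟩⟩
    exact act_backtrack' hX (sd_exists_cons hs p) (red_sd hX hr p)
  · obtain ⟨p, hp⟩ := (hC x (by simp [sqr])).of_sqr hX hs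
    refine ⟨x, by simp [edg], p, Or.inr (Or.inl ⟨y, X.adj h, rfl, (act_congr hX' hp).trans ?_⟩)⟩
    exact act_backtrack' hX (act_exists_cons _ _) (Red.act hX' (red_sd hX hr p))
  · obtain ⟨p, hp⟩ := (hC x (by simp [vtx])).of_vtx
    exact ⟨x, by simp [edg], p, Or.inr (Or.inl ⟨y, h, rfl, act_congr hX' hp⟩)⟩
  · obtain ⟨p, hp⟩ := (hC x (by simp [edg])).of_edg
    exact ⟨x, by simp [sqr], p, Or.inr (Or.inr ⟨y, z, y', h, rfl, act_congr hX' hp⟩)⟩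

/-- The base point `O` need not be a vertex of `X`. The path `s` goes from a vertex of `O` to `O`
inside the cube, so that returning along it gives the trivial class. -/
theorem exists_rep (hX : X.IsNonpositivelyCurved) (O : X.Cube) :
    ∃ (o : V) (s : List X.Cube), (∃ l, s = vtx X o :: l) ∧ X.subdivision.Red s ∧
      Rep o s O o [O] := by
  have hX' := subdivision_isNonpositivelyCurved hX
  have hO : (∃ a, O = vtx X a) ∨ (∃ (a b : V) (h : X.graph.Adj a b), O = edg h) ∨
      ∃ (a b c d : V) (h : X.IsSquare a b c d), O = sqr h := by
    obtain ⟨S, ⟨a, rfl⟩ | ⟨a, b, h, rfl⟩ | ⟨a, b, c, d, h, rfl⟩⟩ := O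
    · exact Or.inl ⟨a, rfl⟩
    · exact Or.inr (Or.inl ⟨a, b, h, rfl⟩)
    · exact Or.inr (Or.inr ⟨a, b, c, d, h, rfl⟩)
  rcases hO with ⟨a, rfl⟩ | ⟨a, b, h, rfl⟩ | ⟨a, b, c, d, h, rfl⟩
  · exact ⟨a, [vtx X a], ⟨_, rfl⟩, red_singleton _, .nil, Or.inl ⟨rfl, .refl _⟩⟩
  · refine ⟨a, X.subdivision.act (vtx X a) [edg h], act_exists_cons _ _,
      (red_singleton _).act hX', .nil, Or.inr (Or.inl ⟨b, h, rfl, ?_⟩)⟩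
    exact (act_backtrack' hX ⟨_, rfl⟩ (red_singleton _)).symm
  · refine ⟨a, X.subdivision.act (vtx X a) (X.subdivision.act (edg (X.adj h)) [sqr h]),
      act_exists_cons _ _, ((red_singleton _).act hX').act hX', .nil,
      Or.inr (Or.inr ⟨b, c, d, h, rfl, ?_⟩)⟩
    refine SwapEq.symm ((act_congr hX' (act_backtrack' hX (act_exists_cons _ _)
      ((red_singleton _).act hX'))).trans ?_)
    exact act_backtrack' hX ⟨_, rfl⟩ (red_singleton _)

theorem Cube.nonempty (C : X.Cube) : ∃ x, x ∈ C.1 := by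
  obtain ⟨S, ⟨a, rfl⟩ | ⟨a, b, h, rfl⟩ | ⟨a, b, c, d, h, rfl⟩⟩ := C <;> exact ⟨a, by simp⟩

/-- By induction along the path, its normal form is represented by an edge path of `X` from any
vertex of the final cube. All such edge paths with given ends are homotopic, and hence have
equivalent subdivided normal forms. -/
theorem subdivision_uniqueNormalForms (hX : X.IsCAT0) : X.subdivision.UniqueNormalForms := by
  intro O C l l' hl hl'
  obtain ⟨o, s, hs, hr, hO⟩ := exists_rep hX.2 O
  have key : ∀ {l : List X.Cube} {C : X.Cube}, X.subdivision.IsPath O (C :: l) →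
      ∀ x ∈ C.1, Rep o s C x (X.subdivision.rho (C :: l)) := by
    intro l
    induction l with
    | nil =>
      intro C h
      cases h
      exact fun x hx => hO.move hX.2 hs hr hx
    | cons D l ih =>
      intro C h x hx
      cases h with
      | cons h1 h2 =>
        obtain ⟨y, -, h3⟩ := Rep.step hX.2 hs hr (ih h2) h1
        exact h3.move hX.2 hs hr hx
  obtain ⟨x, hx⟩ := C.nonempty
  exact (key hl x hx).unique hX.2 hs hX.1 hr (key hl' x hx)

theorem subdivision_connected (hX : X.graph.Connected) : X.subdivision.graph.Connected := by
  have h1 : ∀ {x y : V}, X.graph.Walk x y →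
      X.subdivision.graph.Reachable (vtx X x) (vtx X y) := by
    intro x y p
    induction p with
    | nil => exact .refl _
    | @cons u v w h p ih =>
      have a1 : X.subdivision.graph.Adj (vtx X u) (edg h) := Or.inl (Or.inl ⟨_, _, h, rfl, rfl⟩)
      have a2 : X.subdivision.graph.Adj (edg h) (vtx X v) :=
        Or.inr (Or.inl ⟨_, _, h.symm, rfl, (edg_symm h).symm⟩)
      exact a1.reachable.trans (a2.reachable.trans ih)
  have h2 : ∀ C : X.Cube, ∃ x, X.subdivision.graph.Reachable C (vtx X x) := by
    rintro ⟨S, ⟨a, rfl⟩ | ⟨a, b, h, rfl⟩ | ⟨a, b, c, d, h, rfl⟩⟩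
    · exact ⟨a, .refl _⟩
    · have a1 : X.subdivision.graph.Adj (edg h) (vtx X a) := Or.inr (Or.inl ⟨_, _, h, rfl, rfl⟩)
      exact ⟨a, a1.reachable⟩
    · have a1 : X.subdivision.graph.Adj (edg (X.adj h)) (vtx X a) :=
        Or.inr (Or.inl ⟨_, _, _, rfl, rfl⟩)
      have a2 : X.subdivision.graph.Adj (sqr h) (edg (X.adj h)) :=
        Or.inr (Or.inr ⟨_, _, _, _, h, rfl, rfl⟩)
      exact ⟨a, a2.reachable.trans a1.reachable⟩
  obtain ⟨hp, hne⟩ := (SimpleGraph.connected_iff _).1 hX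
  refine (SimpleGraph.connected_iff _).2 ⟨?_, hne.map (vtx X)⟩
  intro C D
  obtain ⟨x, hx⟩ := h2 C
  obtain ⟨y, hy⟩ := h2 D
  obtain ⟨p⟩ := hp x y
  exact hx.trans ((h1 p).trans hy.symm)

/-- The geometric properties of a CAT(0) square complex, in terms of the metric of its graph,
together with a height function as on a cubical subdivision. -/
structure IsGradedCAT0 (X : SquareComplex V) (ht : V → ℤ) : Prop where
  connected : X.graph.Connected
  npc : X.IsNonpositivelyCurved
  quadrangle : ∀ {o x y y' : V}, X.graph.Adj x y → X.graph.Adj x y' → y ≠ y' →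
    X.graph.dist o y + 1 = X.graph.dist o x → X.graph.dist o y' + 1 = X.graph.dist o x →
    ∃ z, X.IsSquare x y z y' ∧ X.graph.dist o z + 2 = X.graph.dist o x
  ht_adj : ∀ {a b : V}, X.graph.Adj a b → ht b = ht a + 1 ∨ ht a = ht b + 1
  ht_square : ∀ {a b c d : V}, X.IsSquare a b c d → ht a + ht c = ht b + ht d

theorem IsCAT0.subdivision (hX : X.IsCAT0) : IsGradedCAT0 X.subdivision Cube.dim where
  connected := subdivision_connected hX.1.1
  npc := subdivision_isNonpositivelyCurved hX.2
  quadrangle := SquareComplex.quadrangle (subdivision_isNonpositivelyCurved hX.2)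
    (subdivision_connected hX.1.1) (subdivision_uniqueNormalForms hX)
  ht_adj := by
    rintro a b (h | h)
    · exact Or.inl h.dim_eq
    · exact Or.inr h.dim_eq
  ht_square := by
    rintro a b c d (h | h | h | h) <;> have := h.dims <;> omega

/-! ### Automorphisms acting on cubes, and barycentres as fixed points. -/

/-- The action of cubical automorphisms on cubes. -/
instance : MulAction X.aut X.Cube where
  smul σ C := ⟨(σ : Equiv.Perm V) '' C.1, by
    obtain ⟨σ, hσ⟩ := σ
    obtain ⟨S, ⟨a, rfl⟩ | ⟨a, b, h, rfl⟩ | ⟨a, b, c, d, h, rfl⟩⟩ := C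
    · exact Or.inl ⟨σ a, by simp⟩
    · exact Or.inr (Or.inl ⟨σ a, σ b, (hσ.1 a b).2 h, by simp [Set.image_pair]⟩)
    · exact Or.inr (Or.inr ⟨σ a, σ b, σ c, σ d, (hσ.2 a b c d).2 h, by
        simp [Set.image_insert_eq]⟩)⟩
  one_smul C := Subtype.ext (by
    change ((1 : Equiv.Perm V) : V → V) '' C.1 = C.1
    simp)
  mul_smul σ τ C := Subtype.ext (by
    change ((σ * τ : Equiv.Perm V) : V → V) '' C.1 =
      (σ : Equiv.Perm V) '' ((τ : Equiv.Perm V) '' C.1)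
    rw [Set.image_image]
    rfl)

theorem smul_cube_val (σ : X.aut) (C : X.Cube) : (σ • C).1 = (σ : Equiv.Perm V) '' C.1 := rfl

theorem smul_vtx (σ : X.aut) (a : V) : σ • vtx X a = vtx X ((σ : Equiv.Perm V) a) :=
  Subtype.ext (Set.image_singleton)

theorem smul_edg (σ : X.aut) {a b : V} (h : X.graph.Adj a b) :
    σ • edg h = edg ((σ.2.1 a b).2 h) :=
  Subtype.ext (Set.image_pair _ _ _)

theorem smul_sqr (σ : X.aut) {a b c d : V} (h : X.IsSquare a b c d) :
    σ • sqr h = sqr ((σ.2.2 a b c d).2 h) :=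
  Subtype.ext (by rw [smul_cube_val]; simp only [sqr, Set.image_insert_eq, Set.image_singleton])

theorem dim_smul (σ : X.aut) (C : X.Cube) : (σ • C).dim = C.dim := by
  simp only [dim, smul_cube_val]
  rw [Set.ncard_image_of_injective _ (Equiv.injective _)]

theorem Cube.Cov.smul (σ : X.aut) {C D : X.Cube} (h : Cov C D) : Cov (σ • C) (σ • D) := by
  rcases h with ⟨x, y, h, rfl, rfl⟩ | ⟨x, y, z, y', h, rfl, rfl⟩
  · exact Or.inl ⟨_, _, _, smul_vtx σ x, smul_edg σ h⟩
  · exact Or.inr ⟨_, _, _, _, (σ.2.2 _ _ _ _).2 h, smul_edg σ _, smul_sqr σ h⟩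

theorem Cube.Corner.smul (σ : X.aut) {A B C D : X.Cube} (h : Corner A B C D) :
    Corner (σ • A) (σ • B) (σ • C) (σ • D) := by
  obtain ⟨x, y, z, y', h, rfl, rfl, rfl, rfl⟩ := h
  exact ⟨_, _, _, _, (σ.2.2 _ _ _ _).2 h, smul_vtx σ x, smul_edg σ _, smul_sqr σ h,
    smul_edg σ _⟩

theorem subdivision_adj_smul (σ : X.aut) {C D : X.Cube} (h : X.subdivision.graph.Adj C D) :
    X.subdivision.graph.Adj (σ • C) (σ • D) :=
  h.imp (fun h => h.smul σ) (fun h => h.smul σ)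

theorem subdivision_isSquare_smul (σ : X.aut) {A B C D : X.Cube}
    (h : X.subdivision.IsSquare A B C D) :
    X.subdivision.IsSquare (σ • A) (σ • B) (σ • C) (σ • D) := by
  rcases h with h | h | h | h
  · exact Or.inl (h.smul σ)
  · exact Or.inr (Or.inl (h.smul σ))
  · exact Or.inr (Or.inr (Or.inl (h.smul σ)))
  · exact Or.inr (Or.inr (Or.inr (h.smul σ)))

open Classical in
/-- The barycenter of an invariant cube is a fixed point. -/
theorem hasGlobalFixedPoint_of_cube {G : Type v} [Group G] (ρ : G →* X.aut) (C : X.Cube)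
    (hC : ∀ g, ρ g • C = C) : X.HasGlobalFixedPoint ρ := by
  have hpt : X.IsPoint fun v => if v ∈ C.1 then (C.1.ncard : ℝ)⁻¹ else 0 := by
    obtain ⟨S, ⟨a, rfl⟩ | ⟨a, b, h, rfl⟩ | ⟨a, b, c, d, h, rfl⟩⟩ := C
    · refine Or.inl ⟨a, by simp, fun v hv => by simp [hv]⟩
    · refine Or.inr (Or.inl ⟨a, b, h, 1 / 2, by norm_num, ?_, ?_, ?_⟩)
      · simp [Set.ncard_pair h.ne]; norm_num
      · simp [Set.ncard_pair h.ne]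
      · intro v h1 h2; simp [h1, h2]
    · have h1 : a ≠ b := (X.adj h).ne
      have h2 : b ≠ c := (X.adj (X.rotate h)).ne
      have h3 : c ≠ d := (X.adj (X.rotate (X.rotate h))).ne
      have h4 : d ≠ a := (X.adj (X.rotate (X.rotate (X.rotate h)))).ne
      have h5 := X.diag_ne h
      have h6 := isSquare_ne h
      have e : ({a, b, c, d} : Set V).ncard = 4 := by
        rw [Set.ncard_insert_of_notMem (by simp [h1, h5, h4.symm]),
          Set.ncard_insert_of_notMem (by simp [h2, h6]), Set.ncard_pair h3]
      refine Or.inr (Or.inr ⟨a, b, c, d, h, 1 / 2, by norm_num, 1 / 2, by norm_num, ?_⟩)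
      simp only [e]
      refine ⟨by simp; norm_num, by simp; norm_num, by simp; norm_num, by simp; norm_num, ?_⟩
      intro v h1 h2 h3 h4
      simp [h1, h2, h3, h4]
  refine ⟨⟨_, hpt⟩, fun g => Subtype.ext (funext fun v => ?_)⟩
  change (if ((ρ g : Equiv.Perm V)⁻¹ v) ∈ C.1 then (C.1.ncard : ℝ)⁻¹ else 0) = _
  have : ((ρ g : Equiv.Perm V)⁻¹ v) ∈ C.1 ↔ v ∈ C.1 := by
    conv_rhs => rw [← hC g, smul_cube_val]
    constructor
    · intro h
      exact ⟨_, h, by simp⟩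
    · rintro ⟨w, h, rfl⟩
      simpa using h
  simp only [this]

end SquareComplex

/-! ### Halfspaces: parallelism, convexity, medians. -/

namespace SquareComplex

variable {V : Type u} {X : SquareComplex V} {ht : V → ℤ}

/-- The vertices closer to `a` than to `b`. For adjacent vertices this is a halfspace. -/
def half (X : SquareComplex V) (a b : V) : Set V := {x | X.graph.dist x a < X.graph.dist x b}

theorem mem_half {a b x : V} : x ∈ X.half a b ↔ X.graph.dist x a < X.graph.dist x b := Iff.rfl

namespace IsGradedCAT0

/-- The height changes by one along each edge, so the graph is bipartite. In consequence the
distances from any point to two adjacent vertices differ by exactly one, and the two halfspaces of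
an edge are complementary. -/
theorem even_dist (hX : X.IsGradedCAT0 ht) (o x : V) :
    Even ((X.graph.dist o x : ℤ) - (ht x - ht o)) := by
  obtain ⟨l, hl, hlen⟩ := exists_isPath hX.connected o x
  rw [← hlen]
  clear hlen
  induction l generalizing x with
  | nil => cases hl; simp
  | cons y l ih =>
    cases hl with
    | cons h1 h2 =>
      have := ih y h2
      rw [Int.even_iff] at this ⊢
      rcases hX.ht_adj h1 with h | h <;> simp only [List.length_cons] <;> push_cast <;> omega

theorem dist_adj (hX : X.IsGradedCAT0 ht) {a b : V} (h : X.graph.Adj a b) (x : V) :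
    X.graph.dist x b = X.graph.dist x a + 1 ∨ X.graph.dist x a = X.graph.dist x b + 1 := by
  have h1 := hX.connected.dist_triangle (u := x) (v := a) (w := b)
  have h2 := hX.connected.dist_triangle (u := x) (v := b) (w := a)
  have h3 : X.graph.dist a b = 1 := SimpleGraph.dist_eq_one_iff_adj.2 h
  have h4 : X.graph.dist b a = 1 := SimpleGraph.dist_eq_one_iff_adj.2 h.symm
  have h5 := hX.even_dist x a
  have h6 := hX.even_dist x b
  rw [Int.even_iff] at h5 h6
  rcases hX.ht_adj h with h | h <;> omega

theorem notMem_half (hX : X.IsGradedCAT0 ht) {a b : V} (h : X.graph.Adj a b) {x : V} :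
    x ∉ X.half a b ↔ x ∈ X.half b a := by
  have := hX.dist_adj h x
  rw [mem_half, mem_half]
  omega

theorem left_mem_half {a b : V} (h : X.graph.Adj a b) : a ∈ X.half a b := by
  rw [mem_half, SimpleGraph.dist_self, SimpleGraph.dist_eq_one_iff_adj.2 h]
  exact one_pos

theorem right_notMem_half {a b : V} : b ∉ X.half a b := by
  rw [mem_half, SimpleGraph.dist_self]
  exact Nat.not_lt_zero _

/-- If `x` were closer to `a` than to `b` but closer to `c` than to `d`, then `b` and `d` would both
be farther from `x` than `a` and `c`. The quadrangle condition at `b` yields a square with diagonal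
`a`, `c` whose fourth vertex is closer to `x`; uniqueness of the square makes this vertex `d`. -/
theorem half_square_subset (hX : X.IsGradedCAT0 ht) {a b c d : V} (h : X.IsSquare a b c d) :
    X.half a b ⊆ X.half d c := by
  intro x hx
  by_contra hn
  have hdc : X.graph.Adj d c := X.adj (X.rotate (X.rotate (X.reflect (X.rotate h))))
  rw [hX.notMem_half hdc] at hn
  rw [mem_half] at hx hn
  have h1 := hX.dist_adj (X.adj h) x
  have h2 := hX.dist_adj (X.adj (X.rotate h)) x
  have h3 := hX.dist_adj hdc x
  have h4 := hX.dist_adj (X.adj (X.reflect h)) x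
  obtain ⟨z, hz, hz'⟩ := hX.quadrangle (o := x) (x := b) (y := a) (y' := c) (X.adj h).symm
    (X.adj (X.rotate h)) (X.diag_ne h) (by omega) (by omega)
  have h5 : X.IsSquare a b c z := X.rotate (X.rotate (X.rotate (X.reflect hz)))
  rcases X.diag_unique h h5 with h | h
  · have := h.2
    subst this
    omega
  · exact isSquare_ne h5 h.1

theorem half_square (hX : X.IsGradedCAT0 ht) {a b c d : V} (h : X.IsSquare a b c d) :
    X.half a b = X.half d c :=
  (hX.half_square_subset h).antisymm
    (hX.half_square_subset (X.rotate (X.rotate (X.reflect (X.rotate h)))))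

theorem exists_step (hX : X.IsGradedCAT0 ht) {x z : V} (h : x ≠ z) :
    ∃ b, X.graph.Adj x b ∧ X.graph.dist x z = X.graph.dist b z + 1 := by
  obtain ⟨p, hp⟩ := hX.connected.exists_walk_length_eq_dist x z
  cases p with
  | nil => exact absurd rfl h
  | @cons _ b _ h p =>
    refine ⟨b, h, ?_⟩
    have h1 := SimpleGraph.dist_le p
    rw [SimpleGraph.Walk.length_cons] at hp
    have := hX.dist_adj h z
    rw [SimpleGraph.dist_comm, SimpleGraph.dist_comm (u := z)] at this
    omega

/-- An edge joining the two sides of a halfspace is parallel to the edge defining it. -/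
theorem half_eq (hX : X.IsGradedCAT0 ht) {p q : V} (hpq : X.graph.Adj p q) (n : ℕ) :
    ∀ {a b : V}, X.graph.Adj a b → a ∈ X.half p q → b ∉ X.half p q → X.graph.dist a p = n →
      X.half a b = X.half p q ∧ ht b - ht a = ht q - ht p := by
  induction n with
  | zero =>
    intro a b hab ha hb h0
    obtain rfl := hX.connected.dist_eq_zero_iff.1 h0
    rw [hX.notMem_half hpq, mem_half] at hb
    have h1 : X.graph.dist b a = 1 := SimpleGraph.dist_eq_one_iff_adj.2 hab.symm
    have h2 : X.graph.dist b q = 0 := by omega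
    obtain rfl := hX.connected.dist_eq_zero_iff.1 h2
    exact ⟨rfl, rfl⟩
  | succ n ih =>
    intro a b hab ha hb h0
    have hne : a ≠ p := by
      rintro rfl
      simp at h0
    obtain ⟨a', h1, h2⟩ := hX.exists_step hne
    have e1 := hX.dist_adj hpq a
    have e2 := hX.dist_adj hpq b
    have e3 := hX.dist_adj hpq a'
    have e4 := hX.dist_adj hab p
    have e5 := hX.dist_adj hab q
    have e6 := hX.dist_adj h1 q
    rw [hX.notMem_half hpq, mem_half] at hb
    rw [mem_half] at ha
    have c1 : ∀ x y, X.graph.dist x y = X.graph.dist y x := fun _ _ => SimpleGraph.dist_comm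
    rw [c1 p, c1 p] at e4
    rw [c1 q, c1 q] at e5 e6
    -- Both `b` and the step `a'` towards `p` are closer to `q` than `a`. The square so obtained
    -- carries the edge from `a` to `b` to a parallel one nearer to `p`.
    obtain ⟨b', hb1, hb2⟩ := hX.quadrangle (o := q) hab h1
      (by rintro rfl; omega) (by rw [c1 q, c1 q]; omega) (by rw [c1 q, c1 q]; omega)
    have hb' : X.graph.Adj a' b' := X.adj (X.rotate (X.rotate (X.reflect (X.rotate hb1))))
    rw [c1 q, c1 q] at hb2
    have e7 := hX.dist_adj hpq b'
    have e8 := hX.dist_adj (X.adj (X.rotate hb1)) p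
    rw [c1 p, c1 p] at e8
    obtain ⟨h3, h4⟩ := ih hb' (by rw [mem_half]; omega)
      (by rw [hX.notMem_half hpq, mem_half]; omega) (by omega)
    refine ⟨(hX.half_square hb1).trans h3, ?_⟩
    have := hX.ht_square hb1
    omega

theorem half_eq_of_adj (hX : X.IsGradedCAT0 ht) {p q a b : V} (hpq : X.graph.Adj p q)
    (hab : X.graph.Adj a b) (ha : a ∈ X.half p q) (hb : b ∉ X.half p q) :
    X.half a b = X.half p q :=
  (hX.half_eq hpq _ hab ha hb rfl).1

theorem ht_eq_of_adj (hX : X.IsGradedCAT0 ht) {p q a b : V} (hpq : X.graph.Adj p q)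
    (hab : X.graph.Adj a b) (ha : a ∈ X.half p q) (hb : b ∉ X.half p q) :
    ht b - ht a = ht q - ht p :=
  (hX.half_eq hpq _ hab ha hb rfl).2

theorem exists_crossing (hX : X.IsGradedCAT0 ht) (S : Set V) (n : ℕ) :
    ∀ {x z : V}, X.graph.dist x z = n → x ∈ S → z ∉ S → ∃ a b, X.graph.Adj a b ∧ a ∈ S ∧ b ∉ S ∧
      X.graph.dist x z = X.graph.dist x a + 1 + X.graph.dist b z := by
  induction n with
  | zero =>
    intro x z h hx hz
    obtain rfl := hX.connected.dist_eq_zero_iff.1 h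
    exact absurd hx hz
  | succ n ih =>
    intro x z h hx hz
    obtain ⟨y, h1, h2⟩ := hX.exists_step (fun e : x = z => hz (e ▸ hx))
    by_cases hy : y ∈ S
    · obtain ⟨a, b, hab, ha, hb, h3⟩ := ih (by omega) hy hz
      refine ⟨a, b, hab, ha, hb, ?_⟩
      have h4 := hX.connected.dist_triangle (u := x) (v := y) (w := a)
      have h5 := hX.connected.dist_triangle (u := x) (v := a) (w := z)
      have h6 := hX.connected.dist_triangle (u := a) (v := b) (w := z)
      have h7 : X.graph.dist a b = 1 := SimpleGraph.dist_eq_one_iff_adj.2 hab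
      have h8 : X.graph.dist x y = 1 := SimpleGraph.dist_eq_one_iff_adj.2 h1
      omega
    · exact ⟨x, y, h1, hx, hy, by simp; omega⟩

/-- A path from `x` that leaves the halfspace does so along an edge parallel to the defining one,
and crossing this edge increases the distance to `y` as well, so the path cannot continue to a
geodesic to `y`. -/
theorem half_convex (hX : X.IsGradedCAT0 ht) {p q x y z : V} (hpq : X.graph.Adj p q)
    (hx : x ∈ X.half p q) (hy : y ∈ X.half p q)
    (hz : X.graph.dist x z + X.graph.dist z y = X.graph.dist x y) : z ∈ X.half p q := by
  by_contra hn
  obtain ⟨a, b, hab, ha, hb, h⟩ := hX.exists_crossing _ _ rfl hx hn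
  rw [← hX.half_eq_of_adj hpq hab ha hb, mem_half] at hy
  have h1 := hX.connected.dist_triangle (u := b) (v := z) (w := y)
  have h2 := hX.connected.dist_triangle (u := x) (v := a) (w := y)
  rw [SimpleGraph.dist_comm, SimpleGraph.dist_comm (u := y)] at hy
  omega

/-- If the first step `y` of a geodesic towards `u` leads away from `x`, a common step found further
along at `y` is transported back to `v` by the quadrangle condition. -/
theorem exists_common_step (hX : X.IsGradedCAT0 ht) (n : ℕ) :
    ∀ {v u x : V}, X.graph.dist v u = n →
      X.graph.dist x u < X.graph.dist x v + X.graph.dist v u →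
      ∃ p, X.graph.Adj v p ∧ X.graph.dist p u + 1 = X.graph.dist v u ∧
        X.graph.dist x p + 1 = X.graph.dist x v := by
  induction n with
  | zero =>
    intro v u x h h'
    obtain rfl := hX.connected.dist_eq_zero_iff.1 h
    omega
  | succ n ih =>
    intro v u x h h'
    obtain ⟨y, h1, h2⟩ := hX.exists_step (x := v) (z := u) (by rintro rfl; simp at h)
    rcases hX.dist_adj h1 x with h3 | h3
    · obtain ⟨p, hp1, hp2, hp3⟩ := ih (v := y) (u := u) (x := x) (by omega) (by omega)
      obtain ⟨z, hz1, hz2⟩ := hX.quadrangle (o := x) h1.symm hp1 (by rintro rfl; omega)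
        (by omega) (by omega)
      have hvz : X.graph.Adj v z := X.adj (X.rotate hz1)
      have hzp : X.graph.Adj z p := X.adj (X.rotate (X.rotate hz1))
      refine ⟨z, hvz, ?_, by omega⟩
      have h4 := hX.connected.dist_triangle (u := z) (v := p) (w := u)
      have h5 : X.graph.dist z p = 1 := SimpleGraph.dist_eq_one_iff_adj.2 hzp
      have h6 := hX.dist_adj hvz u
      rw [SimpleGraph.dist_comm, SimpleGraph.dist_comm (u := u)] at h6
      omega
    · exact ⟨y, h1, h2.symm, h3.symm⟩

/-- Move from `v` by steps that approach both `u` and `x`; when none is left, a geodesic from `x` to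
`u` passes through the current vertex, which is then the median. -/
theorem exists_median (hX : X.IsGradedCAT0 ht) (n : ℕ) :
    ∀ {v u x : V}, X.graph.dist v u = n →
      ∃ m, X.graph.dist v m + X.graph.dist m u = X.graph.dist v u ∧
        X.graph.dist x m + X.graph.dist m v = X.graph.dist x v ∧
        X.graph.dist x m + X.graph.dist m u = X.graph.dist x u := by
  induction n with
  | zero =>
    intro v u x h
    obtain rfl := hX.connected.dist_eq_zero_iff.1 h
    exact ⟨v, by simp⟩
  | succ n ih =>
    intro v u x h
    by_cases h' : X.graph.dist x u < X.graph.dist x v + X.graph.dist v u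
    · obtain ⟨p, h1, h2, h3⟩ := hX.exists_common_step _ rfl h'
      obtain ⟨m, m1, m2, m3⟩ := ih (v := p) (u := u) (x := x) (by omega)
      have h4 := hX.connected.dist_triangle (u := v) (v := p) (w := m)
      have h5 : X.graph.dist v p = 1 := SimpleGraph.dist_eq_one_iff_adj.2 h1
      have h6 := hX.connected.dist_triangle (u := v) (v := m) (w := u)
      have h7 := hX.connected.dist_triangle (u := x) (v := m) (w := v)
      have h8 : X.graph.dist m v = X.graph.dist v m := SimpleGraph.dist_comm
      have h9 : X.graph.dist m p = X.graph.dist p m := SimpleGraph.dist_comm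
      exact ⟨m, by omega, by omega, m3⟩
    · have := hX.connected.dist_triangle (u := x) (v := v) (w := u)
      exact ⟨v, by simp, by simp, by omega⟩

/-- A halfspace not containing `v` is contained in such a halfspace adjacent to `v`. -/
theorem exists_half (hX : X.IsGradedCAT0 ht) {p q v : V} (hpq : X.graph.Adj p q)
    (hv : v ∉ X.half p q) : ∃ a, X.graph.Adj v a ∧ X.half p q ⊆ X.half a v := by
  classical
  have hex : ∃ n, ∃ u ∈ X.half p q, X.graph.dist v u = n := ⟨_, p, left_mem_half hpq, rfl⟩
  obtain ⟨u, hu, hun⟩ := Nat.find_spec hex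
  have hmin : ∀ w ∈ X.half p q, X.graph.dist v u ≤ X.graph.dist v w := by
    intro w hw
    rw [hun]
    exact Nat.find_min' hex ⟨w, hw, rfl⟩
  obtain ⟨a, ha, h1⟩ := hX.exists_step (fun e : v = u => hv (e ▸ hu))
  refine ⟨a, ha, fun x hx => ?_⟩
  by_contra hn
  rw [hX.notMem_half ha.symm, mem_half] at hn
  -- The median of `v`, `u`, `x` lies in the halfspace by convexity, so it is the nearest point `u`.
  -- A geodesic from `x` to `v` may therefore run through `u` and `a`.
  obtain ⟨m, m1, m2, m3⟩ := hX.exists_median (x := x) _ (rfl : X.graph.dist v u = _)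
  have h2 := hmin m (hX.half_convex hpq hx hu m3)
  have h3 : X.graph.dist m u = 0 := by omega
  obtain rfl := hX.connected.dist_eq_zero_iff.1 h3
  have h4 := hX.connected.dist_triangle (u := x) (v := m) (w := a)
  have h5 : X.graph.dist m v = X.graph.dist v m := SimpleGraph.dist_comm
  have h6 : X.graph.dist m a = X.graph.dist a m := SimpleGraph.dist_comm
  omega

theorem exists_square_of_mem (hX : X.IsGradedCAT0 ht) {v a b x : V} (ha : X.graph.Adj v a)
    (hb : X.graph.Adj v b) (hne : a ≠ b) (hxa : x ∈ X.half a v) (hxb : x ∈ X.half b v) :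
    ∃ w, X.IsSquare v a w b ∧ X.graph.dist x w + 2 = X.graph.dist x v := by
  rw [mem_half] at hxa hxb
  have h1 := hX.dist_adj ha x
  have h2 := hX.dist_adj hb x
  exact hX.quadrangle (o := x) ha hb hne (by omega) (by omega)

theorem half_inj (hX : X.IsGradedCAT0 ht) {v a b : V} (ha : X.graph.Adj v a)
    (h : X.half a v ⊆ X.half b v) : a = b := by
  have h1 := h (left_mem_half ha.symm)
  rw [mem_half, SimpleGraph.dist_eq_one_iff_adj.2 ha.symm] at h1
  exact hX.connected.dist_eq_zero_iff.1 (by omega)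

end IsGradedCAT0

/-! ### Height-preserving actions; letters reset a halfspace at `v` or pass it on. -/

/-- An action by automorphisms preserving the height function. -/
structure IsGradedAction (X : SquareComplex V) (ht : V → ℤ) (A : Type v) [Group A]
    [MulAction A V] : Prop where
  cat0 : X.IsGradedCAT0 ht
  adj_smul : ∀ (g : A) {a b : V}, X.graph.Adj a b → X.graph.Adj (g • a) (g • b)
  square_smul : ∀ (g : A) {a b c d : V}, X.IsSquare a b c d →
    X.IsSquare (g • a) (g • b) (g • c) (g • d)
  ht_smul : ∀ (g : A) (a : V), ht (g • a) = ht a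

/-- Two neighbours of `v` span a square with `v`. -/
def Lk (X : SquareComplex V) (v a b : V) : Prop := ∃ w, X.IsSquare v a w b

theorem Lk.symm {v a b : V} (h : X.Lk v a b) : X.Lk v b a :=
  h.imp fun _ h => X.reflect h

theorem Lk.ne {v a b : V} (h : X.Lk v a b) : a ≠ b := by
  obtain ⟨w, h⟩ := h
  exact isSquare_ne h

theorem Lk.adj {v a b : V} (h : X.Lk v a b) : X.graph.Adj v a := by
  obtain ⟨w, h⟩ := h
  exact X.adj h

section

variable {A : Type v} [Group A] [MulAction A V]

/-- The neighbour `a` of `v` lies in the direction of `c • v`. -/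
def Dir (X : SquareComplex V) (v : V) (c : A) (a : V) : Prop :=
  X.graph.Adj v a ∧ c • v ∈ X.half a v

/-- The halfspace at `a`, pulled back by `c`, lies in a halfspace separating `v` from `c⁻¹ • v`. -/
def Reset (X : SquareComplex V) (v a : V) (c : A) : Prop :=
  ∃ b, X.Dir v c⁻¹ b ∧ ∀ x, c • x ∈ X.half a v → x ∈ X.half b v

/-- The halfspace at `a`, pulled back by `c`, is the halfspace at `b`. -/
def Pass (X : SquareComplex V) (v a : V) (c : A) (b : V) : Prop :=
  X.graph.Adj v b ∧ ∀ x, x ∈ X.half b v ↔ c • x ∈ X.half a v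

namespace IsGradedAction

theorem dist_smul (hA : X.IsGradedAction ht A) (g : A) (a b : V) :
    X.graph.dist (g • a) (g • b) = X.graph.dist a b := by
  have key : ∀ (g : A) (a b : V), X.graph.dist (g • a) (g • b) ≤ X.graph.dist a b := by
    intro g a b
    obtain ⟨p, hp⟩ := hA.cat0.connected.exists_walk_length_eq_dist a b
    rw [← hp]
    let f : X.graph →g X.graph := ⟨fun x => g • x, fun h => hA.adj_smul g h⟩
    rw [← SimpleGraph.Walk.length_map f p]
    exact SimpleGraph.dist_le _
  refine le_antisymm (key g a b) ?_
  have := key g⁻¹ (g • a) (g • b)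
  rwa [inv_smul_smul, inv_smul_smul] at this

theorem smul_mem_half (hA : X.IsGradedAction ht A) (g : A) {a b x : V} :
    g • x ∈ X.half (g • a) (g • b) ↔ x ∈ X.half a b := by
  rw [mem_half, mem_half, hA.dist_smul, hA.dist_smul]

theorem smul_mem_half_iff (hA : X.IsGradedAction ht A) (g : A) {a b x : V} :
    g • x ∈ X.half a b ↔ x ∈ X.half (g⁻¹ • a) (g⁻¹ • b) := by
  rw [← hA.smul_mem_half g (a := g⁻¹ • a) (b := g⁻¹ • b), smul_inv_smul, smul_inv_smul]

theorem adj_smul_iff (hA : X.IsGradedAction ht A) (g : A) {a b : V} :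
    X.graph.Adj (g • a) (g • b) ↔ X.graph.Adj a b :=
  ⟨fun h => by simpa using hA.adj_smul g⁻¹ h, fun h => hA.adj_smul g h⟩

/-- The alternative for a halfspace at `a` pulled back by `c`. -/
theorem reset_or_pass (hA : X.IsGradedAction ht A) {v a : V} {c : A} (ha : X.graph.Adj v a)
    (hc : c • v ∉ X.half a v) (hr : ¬ X.Reset v a c) :
    (∃ b, X.Pass v a c b ∧ ∀ p, X.Dir v c⁻¹ p → X.Lk v p b) ∧ ∀ h, X.Dir v c h → X.Lk v h a := by
  have hX := hA.cat0
  have ha' : X.graph.Adj (c⁻¹ • a) (c⁻¹ • v) := hA.adj_smul _ ha.symm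
  have e1 : ∀ x, c • x ∈ X.half a v ↔ x ∈ X.half (c⁻¹ • a) (c⁻¹ • v) :=
    fun x => hA.smul_mem_half_iff c
  constructor
  · obtain ⟨b, hb, hs⟩ := hX.exists_half (v := v) ha' (by rwa [← e1])
    have h1 : ¬ X.Dir v c⁻¹ b := fun h => hr ⟨b, h, fun x hx => hs ((e1 x).1 hx)⟩
    have h2 : c⁻¹ • v ∉ X.half b v := fun h => h1 ⟨hb, h⟩
    -- The pulled-back edge has one end in the halfspace at `b` and the other outside, because `b`
    -- is not a direction of `c⁻¹ • v`. So the inclusion of halfspaces is an equality.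
    have h3 := hX.half_eq_of_adj hb.symm ha' (hs (IsGradedCAT0.left_mem_half ha')) h2
    refine ⟨b, ⟨hb, fun x => by rw [e1, h3]⟩, ?_⟩
    intro p hp
    have hne : p ≠ b := by rintro rfl; exact h2 hp.2
    have h4 : c⁻¹ • a ∈ X.half p v := by
      by_contra h4
      have h5 := hX.half_eq_of_adj hp.1.symm ha'.symm hp.2 h4
      have h6 : v ∈ X.half (c⁻¹ • a) (c⁻¹ • v) := by
        rw [← hX.notMem_half ha'.symm, h5]
        exact IsGradedCAT0.right_notMem_half
      rw [h3] at h6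
      exact IsGradedCAT0.right_notMem_half h6
    obtain ⟨w, hw, -⟩ := hX.exists_square_of_mem hp.1 hb hne h4
      (hs (IsGradedCAT0.left_mem_half ha'))
    exact ⟨w, hw⟩
  · intro h hh
    by_contra hn
    have hne : h ≠ a := by rintro rfl; exact hc hh.2
    -- Without a square on `h` and `a` their halfspaces are disjoint. The pullback of the one at `a`
    -- then lies in the pullback of the complement of the one at `h`, which contains `c⁻¹ • v` but
    -- not `v`: a reset.
    have h1 : ∀ x, x ∈ X.half a v → x ∉ X.half h v := by
      intro x hx hx'
      obtain ⟨w, hw, -⟩ := hX.exists_square_of_mem hh.1 ha hne hx' hx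
      exact hn ⟨w, hw⟩
    have hh' : X.graph.Adj (c⁻¹ • v) (c⁻¹ • h) := hA.adj_smul _ hh.1
    have e2 : ∀ x, c • x ∈ X.half v h ↔ x ∈ X.half (c⁻¹ • v) (c⁻¹ • h) :=
      fun x => hA.smul_mem_half_iff c
    obtain ⟨b, hb, hs⟩ := hX.exists_half (v := v) hh' (by
      rw [← e2, hX.notMem_half hh.1]
      exact hh.2)
    refine hr ⟨b, ⟨hb, hs (IsGradedCAT0.left_mem_half hh')⟩, fun x hx => hs ?_⟩
    rw [← e2, ← hX.notMem_half hh.1.symm]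
    exact h1 _ hx

end IsGradedAction

end

end SquareComplex

/-! ### Counting letters. -/

/-- The number of elements of `Γ` that satisfy `P`. -/
noncomputable def cnt {A : Type v} (Γ : Finset A) (P : A → Prop) : ℝ :=
  open Classical in ∑ c ∈ Γ, if P c then 1 else 0

section cnt

variable {A : Type v} {Γ : Finset A} {P Q R : A → Prop}

theorem cnt_nonneg : 0 ≤ cnt Γ P :=
  Finset.sum_nonneg fun c _ => by split_ifs <;> norm_num

theorem cnt_mono (h : ∀ c ∈ Γ, P c → Q c) : cnt Γ P ≤ cnt Γ Q := by
  refine Finset.sum_le_sum fun c hc => ?_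
  by_cases hP : P c
  · rw [if_pos hP, if_pos (h c hc hP)]
  · rw [if_neg hP]
    split_ifs <;> norm_num

theorem cnt_le_add (h : ∀ c ∈ Γ, P c → Q c ∨ R c) : cnt Γ P ≤ cnt Γ Q + cnt Γ R := by
  rw [cnt, cnt, cnt, ← Finset.sum_add_distrib]
  refine Finset.sum_le_sum fun c hc => ?_
  by_cases hP : P c
  · rcases h c hc hP with h | h
    · rw [if_pos hP, if_pos h]
      split_ifs <;> norm_num
    · rw [if_pos hP, if_pos h]
      split_ifs <;> norm_num
  · rw [if_neg hP]
    split_ifs <;> norm_num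

theorem exists_of_cnt_lt (h : cnt Γ Q < cnt Γ P) : ∃ c ∈ Γ, P c ∧ ¬ Q c := by
  by_contra! hn
  exact h.not_ge (cnt_mono hn)

theorem exists_of_cnt_pos (h : 0 < cnt Γ P) : ∃ c ∈ Γ, P c := by
  by_contra! hn
  refine h.not_ge (Finset.sum_nonpos fun c hc => ?_)
  rw [if_neg (hn c hc)]

theorem cnt_eq_card [DecidablePred P] : cnt Γ P = ((Γ.filter P).card : ℝ) := by
  rw [cnt, Finset.card_filter]
  push_cast
  exact Finset.sum_congr rfl fun c _ => by congr

theorem sum_inv_of_symmetric {A : Type v} [Group A] {Γ : Finset A} (hΓ : ∀ c ∈ Γ, c⁻¹ ∈ Γ)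
    (f : A → ℝ) : ∑ c ∈ Γ, f c⁻¹ = ∑ c ∈ Γ, f c :=
  Finset.sum_bij' (fun c _ => c⁻¹) (fun c _ => c⁻¹) hΓ hΓ (by simp) (by simp) (by simp)

theorem cnt_inv {A : Type v} [Group A] {Γ : Finset A} (hΓ : ∀ c ∈ Γ, c⁻¹ ∈ Γ) (P : A → Prop) :
    cnt Γ (fun c => P c⁻¹) = cnt Γ P := by
  classical
  exact sum_inv_of_symmetric hΓ fun c => if P c then 1 else 0

end cnt

/-! ### Bad states, and the first use of minimal displacement. -/

namespace SquareComplex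

variable {V : Type u} {X : SquareComplex V} {ht : V → ℤ} {A : Type v} [Group A] [MulAction A V]

theorem Lk.not_triangle (hX : X.IsGradedCAT0 ht) {v a b c : V} (h1 : X.Lk v a b) (h2 : X.Lk v b c)
    (h3 : X.Lk v a c) : False := by
  obtain ⟨x, hx⟩ := h1
  obtain ⟨y, hy⟩ := h2
  obtain ⟨z, hz⟩ := h3
  exact link_triangle hX.npc hx hy hz

theorem Dir.eq_or_lk (hX : X.IsGradedCAT0 ht) {v a b : V} {c : A} (ha : X.Dir v c a)
    (hb : X.Dir v c b) : a = b ∨ X.Lk v a b := by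
  by_cases h : a = b
  · exact Or.inl h
  · obtain ⟨w, hw, -⟩ := hX.exists_square_of_mem ha.1 hb.1 h ha.2 hb.2
    exact Or.inr ⟨w, hw⟩

theorem exists_dir (hX : X.IsGradedCAT0 ht) {v : V} {c : A} (h : c • v ≠ v) :
    ∃ a, X.Dir v c a := by
  obtain ⟨a, h1, h2⟩ := hX.exists_step h.symm
  refine ⟨a, h1, ?_⟩
  rw [mem_half, SimpleGraph.dist_comm, SimpleGraph.dist_comm (v := v)]
  omega

theorem Dir.ne {v a : V} {c : A} (h : X.Dir v c a) : c • v ≠ v := by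
  intro e
  have := h.2
  rw [e] at this
  exact IsGradedCAT0.right_notMem_half this

theorem Pass.not_dir {v a b : V} {c : A} (h : X.Pass v a c b) : ¬ X.Dir v c a :=
  fun h' => IsGradedCAT0.right_notMem_half ((h.2 v).2 h'.2)

theorem Pass.inv {v a b : V} {c : A} (h : X.Pass v a c b) (ha : X.graph.Adj v a) :
    X.Pass v b c⁻¹ a := by
  refine ⟨ha, fun x => ?_⟩
  rw [h.2, smul_inv_smul]

theorem Pass.unique (hX : X.IsGradedCAT0 ht) {v a b b' : V} {c : A} (h : X.Pass v a c b)
    (h' : X.Pass v a c b') : b = b' :=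
  hX.half_inj h.1 fun x hx => (h'.2 x).2 ((h.2 x).1 hx)

theorem IsGradedAction.pass_of_fix (hA : X.IsGradedAction ht A) {v a : V} {c : A}
    (ha : X.graph.Adj v a) (h : c • v = v) : X.Pass v a c (c⁻¹ • a) := by
  have h' : c⁻¹ • v = v := by rw [inv_smul_eq_iff, h]
  refine ⟨?_, fun x => ?_⟩
  · rw [← hA.adj_smul_iff c, h, smul_inv_smul]
    exact ha
  · rw [hA.smul_mem_half_iff, h']

theorem IsGradedAction.lk_smul (hA : X.IsGradedAction ht A) {v a b : V} {c : A} (h : c • v = v)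
    (hl : X.Lk v a b) : X.Lk v (c • a) (c • b) := by
  obtain ⟨w, hw⟩ := hl
  have := hA.square_smul c hw
  rw [h] at this
  exact ⟨_, this⟩

/-- States with few resetting letters, from which moreover few letters lead outside. -/
def Bad (X : SquareComplex V) (v : V) (Γ : Finset A) (e : ℝ) : ℕ → V → Prop
  | 0, a => X.graph.Adj v a ∧ cnt Γ (X.Reset v a) < e
  | i + 1, a => (X.graph.Adj v a ∧ cnt Γ (X.Reset v a) < e) ∧
      cnt Γ (fun c => ∃ b, X.Pass v a c b ∧ ¬ Bad X v Γ e i b) < e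

section Bad

variable {v : V} {Γ : Finset A} {e : ℝ}

theorem Bad.zero {i : ℕ} {a : V} (h : X.Bad v Γ e i a) : X.Bad v Γ e 0 a := by
  cases i with
  | zero => exact h
  | succ i => exact h.1

theorem Bad.pred (i : ℕ) {a : V} (h : X.Bad v Γ e (i + 1) a) : X.Bad v Γ e i a := by
  induction i generalizing a with
  | zero => exact h.1
  | succ i ih =>
    refine ⟨h.1, (cnt_mono ?_).trans_lt h.2⟩
    rintro c - ⟨b, hb, hb'⟩
    exact ⟨b, hb, fun h => hb' (ih h)⟩

theorem Bad.mono {e' : ℝ} (he : e ≤ e') (i : ℕ) {a : V} (h : X.Bad v Γ e i a) :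
    X.Bad v Γ e' i a := by
  induction i generalizing a with
  | zero => exact ⟨h.1, h.2.trans_le he⟩
  | succ i ih =>
    refine ⟨⟨h.1.1, h.1.2.trans_le he⟩, (cnt_mono ?_).trans_lt (h.2.trans_le he)⟩
    rintro c - ⟨b, hb, hb'⟩
    exact ⟨b, hb, fun h => hb' (ih h)⟩

theorem Bad.adj {i : ℕ} {a : V} (h : X.Bad v Γ e i a) : X.graph.Adj v a := h.zero.1

theorem Bad.reset_lt {i : ℕ} {a : V} (h : X.Bad v Γ e i a) : cnt Γ (X.Reset v a) < e := h.zero.2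

end Bad

namespace IsGradedAction

variable {v : V} {Γ : Finset A} {e : ℝ}

theorem dir_or (hA : X.IsGradedAction ht A) {a : V} {c : A} (ha : X.graph.Adj v a)
    (hr : ¬ X.Reset v a c) : X.Dir v c a ∨
      ((∃ b, X.Pass v a c b ∧ ∀ p, X.Dir v c⁻¹ p → X.Lk v p b) ∧
        ∀ h, X.Dir v c h → X.Lk v h a) := by
  by_cases h : X.Dir v c a
  · exact Or.inl h
  · exact Or.inr (hA.reset_or_pass ha (fun h' => h ⟨ha, h'⟩) hr)

theorem eq_or_lk_of_not_reset (hA : X.IsGradedAction ht A) {a b : V} {c : A}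
    (ha : X.graph.Adj v a) (hr : ¬ X.Reset v a c) (hb : X.Dir v c b) : b = a ∨ X.Lk v b a := by
  rcases hA.dir_or ha hr with h | h
  · exact hb.eq_or_lk hA.cat0 h
  · exact Or.inr (h.2 b hb)

/-- If many letters point in the direction `p`, then all states with few resets are `p` or
adjacent to `p` in the link. -/
theorem eq_or_lk_of_bad (hA : X.IsGradedAction ht A) {p b : V}
    (hM : e ≤ cnt Γ (fun c => X.Dir v c p)) (hb : X.Bad v Γ e 0 b) : b = p ∨ X.Lk v p b := by
  by_contra! hn
  refine (hb.2.trans_le hM).not_ge (cnt_mono fun c _ hc => ?_)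
  by_contra hr
  rcases hA.eq_or_lk_of_not_reset hb.1 hr hc with h | h
  · exact hn.1 h.symm
  · exact hn.2 h

/-- The direction `x` is equal or linked to each of `p` and `b`; if it were linked to both, the link
of `v` would contain a triangle. -/
theorem eq_or_eq_of_not_reset (hA : X.IsGradedAction ht A) {p b x : V} {c : A}
    (hl : X.Lk v p b) (hp : ¬ X.Reset v p c) (hb : ¬ X.Reset v b c) (hx : X.Dir v c x) :
    x = p ∨ x = b := by
  rcases hA.eq_or_lk_of_not_reset hl.adj hp hx with h | h
  · exact Or.inl h
  rcases hA.eq_or_lk_of_not_reset hl.symm.adj hb hx with h' | h'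
  · exact Or.inr h'
  exact (Lk.not_triangle hA.cat0 h hl h').elim

-- Moving `v` to `p` changes the displacement of `c` at both ends, by one for each. The bound
-- separates into a term for `c` and the same term for `c⁻¹`, so that summation over a symmetric set
-- gives twice a sum over single letters.
open Classical in
theorem dist_edge_le (hA : X.IsGradedAction ht A) {p : V} {c : A} (hp : X.graph.Adj v p) :
    (X.graph.dist p (c • p) : ℝ) - X.graph.dist v (c • v) ≤
      (if X.Dir v c p then -1 else if X.Pass v p c p then 0 else 1) +
      (if X.Dir v c⁻¹ p then -1 else if X.Pass v p c⁻¹ p then 0 else 1) := by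
  have hX := hA.cat0
  have h1 := hX.dist_adj hp (c • p)
  have h2 := hX.dist_adj hp (c⁻¹ • v)
  have e1 : X.graph.dist (c⁻¹ • v) v = X.graph.dist v (c • v) := by
    rw [← hA.dist_smul c, smul_inv_smul]
  have e2 : X.graph.dist (c⁻¹ • v) p = X.graph.dist (c • p) v := by
    rw [← hA.dist_smul c, smul_inv_smul, SimpleGraph.dist_comm]
  have e3 : X.graph.dist p (c • p) = X.graph.dist (c • p) p := SimpleGraph.dist_comm
  -- Otherwise `c` would map the edge from `v` to `p` to a parallel edge with the opposite
  -- orientation, which heights forbid.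
  have key : X.Dir v c p → c • p ∈ X.half p v := by
    intro h
    by_contra hn
    have := hX.ht_eq_of_adj hp.symm (hA.adj_smul c hp) h.2 hn
    rw [hA.ht_smul, hA.ht_smul] at this
    have := hX.ht_adj hp
    omega
  have key' : X.Dir v c⁻¹ p ↔ X.graph.dist (c⁻¹ • v) p < X.graph.dist (c⁻¹ • v) v :=
    ⟨fun h => h.2, fun h => ⟨hp, h⟩⟩
  rw [mem_half] at key
  have b1 : (X.graph.dist p (c • p) : ℝ) ≤ X.graph.dist (c • p) v +
      (if X.Dir v c p then -1 else 1) := by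
    split_ifs with h
    · have h3 := key h
      have : X.graph.dist p (c • p) + 1 = X.graph.dist (c • p) v := by omega
      rw [← this]; push_cast; linarith
    · have : X.graph.dist p (c • p) ≤ X.graph.dist (c • p) v + 1 := by omega
      exact_mod_cast this
  have b2 : (X.graph.dist (c • p) v : ℝ) ≤ X.graph.dist v (c • v) +
      (if X.Dir v c⁻¹ p then -1 else 1) := by
    split_ifs with h
    · have h3 := key'.1 h
      have : X.graph.dist (c • p) v + 1 = X.graph.dist v (c • v) := by omega
      rw [← this]; push_cast; linarith
    · have : X.graph.dist (c • p) v ≤ X.graph.dist v (c • v) + 1 := by omega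
      exact_mod_cast this
  by_cases hP : X.Pass v p c p
  · have hP' := hP.inv hp
    rw [if_neg hP.not_dir, if_neg hP'.not_dir, if_pos hP, if_pos hP']
    have h3 := (hP.2 p).1 (IsGradedCAT0.left_mem_half hp.symm)
    rw [mem_half] at h3
    have : X.graph.dist p (c • p) ≤ X.graph.dist v (c • v) := by omega
    have : (X.graph.dist p (c • p) : ℝ) ≤ X.graph.dist v (c • v) := by exact_mod_cast this
    linarith
  · have hP' : ¬ X.Pass v p c⁻¹ p := fun h => hP (by simpa using h.inv hp)
    rw [if_neg hP, if_neg hP']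
    linarith

theorem cnt_dir_le (hA : X.IsGradedAction ht A) (hΓ : ∀ c ∈ Γ, c⁻¹ ∈ Γ)
    (hmin : ∀ u, ∑ c ∈ Γ, (X.graph.dist v (c • v) : ℝ) ≤ ∑ c ∈ Γ, (X.graph.dist u (c • u) : ℝ))
    {p : V} (hp : X.graph.Adj v p) :
    cnt Γ (fun c => X.Dir v c p) ≤ cnt Γ (fun c => ¬ X.Dir v c p ∧ ¬ X.Pass v p c p) := by
  classical
  have h1 : (0 : ℝ) ≤ ∑ c ∈ Γ, ((X.graph.dist p (c • p) : ℝ) - X.graph.dist v (c • v)) := by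
    rw [Finset.sum_sub_distrib]
    linarith [hmin p]
  let f : A → ℝ := fun c => if X.Dir v c p then -1 else if X.Pass v p c p then 0 else 1
  have h2 : ∑ c ∈ Γ, ((X.graph.dist p (c • p) : ℝ) - X.graph.dist v (c • v)) ≤
      ∑ c ∈ Γ, (f c + f c⁻¹) := Finset.sum_le_sum fun c _ => by
    convert hA.dist_edge_le (c := c) hp
  rw [Finset.sum_add_distrib, sum_inv_of_symmetric hΓ f] at h2
  have h3 : ∑ c ∈ Γ, f c = cnt Γ (fun c => ¬ X.Dir v c p ∧ ¬ X.Pass v p c p) -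
      cnt Γ (fun c => X.Dir v c p) := by
    rw [cnt, cnt, ← Finset.sum_sub_distrib]
    refine Finset.sum_congr rfl fun c _ => ?_
    by_cases h : X.Dir v c p
    · simp [f, h]
    · by_cases h' : X.Pass v p c p <;> simp [f, h, h']
  linarith

/-- Under minimality, many letters carry the halfspace at `p` to the halfspace at another bad
state. -/
theorem lt_cnt_pass (hA : X.IsGradedAction ht A) (hΓ : ∀ c ∈ Γ, c⁻¹ ∈ Γ)
    (hmin : ∀ u, ∑ c ∈ Γ, (X.graph.dist v (c • v) : ℝ) ≤ ∑ c ∈ Γ, (X.graph.dist u (c • u) : ℝ))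
    {p : V} {i : ℕ} (hp : X.Bad v Γ e (i + 1) p) :
    cnt Γ (fun c => X.Dir v c p) - 2 * e <
      cnt Γ (fun c => ∃ b, b ≠ p ∧ X.Pass v p c b ∧ X.Bad v Γ e i b) := by
  have h1 := hA.cnt_dir_le hΓ hmin hp.adj
  have h2 : cnt Γ (fun c => ¬ X.Dir v c p ∧ ¬ X.Pass v p c p) ≤ cnt Γ (X.Reset v p) +
      cnt Γ (fun c => ∃ b, b ≠ p ∧ X.Pass v p c b) := by
    refine cnt_le_add fun c _ ⟨h, h'⟩ => ?_
    by_cases hr : X.Reset v p c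
    · exact Or.inl hr
    · rcases hA.dir_or hp.adj hr with h3 | ⟨⟨b, hb, -⟩, -⟩
      · exact absurd h3 h
      · exact Or.inr ⟨b, by rintro rfl; exact h' hb, hb⟩
  have h3 : cnt Γ (fun c => ∃ b, b ≠ p ∧ X.Pass v p c b) ≤
      cnt Γ (fun c => ∃ b, X.Pass v p c b ∧ ¬ X.Bad v Γ e i b) +
      cnt Γ (fun c => ∃ b, b ≠ p ∧ X.Pass v p c b ∧ X.Bad v Γ e i b) := by
    refine cnt_le_add fun c _ ⟨b, h, h'⟩ => ?_
    by_cases hb : X.Bad v Γ e i b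
    · exact Or.inr ⟨b, h, h', hb⟩
    · exact Or.inl ⟨b, h', hb⟩
  linarith [hp.2, hp.reset_lt]

/-- All bad states other than `p` are linked to `p`. If there are at least two, most of the letters
that pass `p` to another bad state must fix `v`, since a direction of such a letter would have to
equal both of these states. Letters fixing `v` act on its link, and absence of triangles makes all
of them carry `p` to one and the same state `q`. -/
theorem exists_unique_bad (hA : X.IsGradedAction ht A) (hΓ : ∀ c ∈ Γ, c⁻¹ ∈ Γ)
    (hmin : ∀ u, ∑ c ∈ Γ, (X.graph.dist v (c • v) : ℝ) ≤ ∑ c ∈ Γ, (X.graph.dist u (c • u) : ℝ))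
    {p : V} (hp : X.Bad v Γ e 3 p) (hM : 32 * e ≤ cnt Γ (fun c => X.Dir v c p)) :
    ∃ q, X.Lk v p q ∧ X.Bad v Γ e 2 q ∧ ∀ b, X.Bad v Γ e 1 b → b = p ∨ b = q := by
  have he : 0 < e := cnt_nonneg.trans_lt hp.reset_lt
  have hN := hA.lt_cnt_pass hΓ hmin hp
  have hlk : ∀ {b i}, X.Bad v Γ e i b → b = p ∨ X.Lk v p b := fun hb =>
    hA.eq_or_lk_of_bad (by linarith) hb.zero
  obtain ⟨-, -, b₀, hb1, -, hb2⟩ := exists_of_cnt_pos (lt_trans (by linarith) hN)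
  have hl0 := (hlk hb2).resolve_left hb1
  by_cases hall : ∀ b, X.Bad v Γ e 0 b → b = p ∨ b = b₀
  · exact ⟨b₀, hl0, hb2, fun b hb => hall b hb.zero⟩
  push Not at hall
  obtain ⟨b₁, hb3, hb4, hb5⟩ := hall
  have hl1 := (hlk hb3).resolve_left hb4
  -- Of the more than `30 * e` letters passing `p` to another bad state, fewer than `3 * e` reset
  -- `p`, `b₀` or `b₁`; the rest fix `v`. This explains the bound `27 * e` below.
  let NF : A → Prop := fun c => c • v = v ∧ c⁻¹ • p ≠ p ∧ X.Bad v Γ e 2 (c⁻¹ • p)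
  have hNF : 27 * e < cnt Γ NF := by
    have h1 : cnt Γ (fun c => ∃ b, b ≠ p ∧ X.Pass v p c b ∧ X.Bad v Γ e 2 b) ≤
        cnt Γ (X.Reset v p) + cnt Γ (fun c => X.Reset v b₀ c ∨ X.Reset v b₁ c ∨ NF c) := by
      refine cnt_le_add fun c _ ⟨b, h1, h2, h3⟩ => ?_
      by_contra! hn
      obtain ⟨r1, r2, r3, r4⟩ := hn
      have hv : c • v = v := by
        by_contra hv
        obtain ⟨x, hx⟩ := exists_dir hA.cat0 hv
        have hxp : x ≠ p := by rintro rfl; exact h2.not_dir hx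
        have e1 := (hA.eq_or_eq_of_not_reset hl0 r1 r2 hx).resolve_left hxp
        have e2 := (hA.eq_or_eq_of_not_reset hl1 r1 r3 hx).resolve_left hxp
        exact hb5 (e2.symm.trans e1)
      have := h2.unique hA.cat0 (hA.pass_of_fix hp.adj hv)
      subst this
      exact r4 ⟨hv, h1, h3⟩
    have h2 : cnt Γ (fun c => X.Reset v b₀ c ∨ X.Reset v b₁ c ∨ NF c) ≤ _ :=
      cnt_le_add fun c _ h => h
    have h3 : cnt Γ (fun c => X.Reset v b₁ c ∨ NF c) ≤ _ := cnt_le_add fun c _ h => h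
    linarith [hp.reset_lt, hb2.reset_lt, hb3.reset_lt]
  -- an element of `NF` carries `p` to the image of `p` under the inverse of another one
  have hcr : ∀ f f', NF f → NF f' → (¬ ∃ b, X.Pass v (f⁻¹ • p) f' b ∧ ¬ X.Bad v Γ e 1 b) →
      f⁻¹ • p = f' • p := by
    intro f f' hf hf' hn
    have h1 := hA.pass_of_fix hf.2.2.adj hf'.1
    have h2 : X.Bad v Γ e 1 (f'⁻¹ • f⁻¹ • p) := by
      by_contra h
      exact hn ⟨_, h1, h⟩
    have h4 : f'⁻¹ • v = v := by rw [inv_smul_eq_iff, hf'.1]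
    have h3 := hA.lk_smul h4 ((hlk hf.2.2).resolve_left hf.2.1)
    rcases hlk h2 with h | h
    · exact inv_smul_eq_iff.1 h
    · exact (Lk.not_triangle hA.cat0 ((hlk hf'.2.2).resolve_left hf'.2.1) h3 h).elim
  obtain ⟨f, -, hf⟩ := exists_of_cnt_pos (lt_trans (by linarith) hNF)
  -- Compare both with `g • p` for one `g` in `NF` under which both states pass only to bad states;
  -- fewer than `2 * e` letters are excluded.
  have hq : ∀ f', NF f' → f'⁻¹ • p = f⁻¹ • p := by
    intro f' hf'
    obtain ⟨g, -, hg, hg'⟩ := exists_of_cnt_lt (Γ := Γ) (P := NF)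
      (Q := fun c => (∃ b, X.Pass v (f⁻¹ • p) c b ∧ ¬ X.Bad v Γ e 1 b) ∨
        ∃ b, X.Pass v (f'⁻¹ • p) c b ∧ ¬ X.Bad v Γ e 1 b)
      (lt_of_le_of_lt (cnt_le_add fun c _ h => h) (by linarith [hf.2.2.2, hf'.2.2.2]))
    push Not at hg'
    rw [hcr f g hf hg (by push Not; exact hg'.1), hcr f' g hf' hg (by push Not; exact hg'.2)]
  refine ⟨f⁻¹ • p, (hlk hf.2.2).resolve_left hf.2.1, hf.2.2, fun b hb => ?_⟩
  by_contra! hn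
  have hlb := (hlk hb).resolve_left hn.1
  obtain ⟨g, -, hg, hg'⟩ := exists_of_cnt_lt (Γ := Γ) (P := NF)
    (Q := fun c => (∃ b, X.Pass v (f⁻¹ • p) c b ∧ ¬ X.Bad v Γ e 1 b) ∨
      ∃ b', X.Pass v b c b' ∧ ¬ X.Bad v Γ e 0 b')
    (lt_of_le_of_lt (cnt_le_add fun c _ h => h) (by linarith [hf.2.2.2, hb.2]))
  push Not at hg'
  have h1 := hcr f g hf hg (by push Not; exact hg'.1)
  have h2 := hg'.2 _ (hA.pass_of_fix hb.adj hg.1)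
  have h4 : g⁻¹ • v = v := by rw [inv_smul_eq_iff, hg.1]
  have h3 := hA.lk_smul h4 hlb
  rcases hlk h2 with h | h
  · rw [inv_smul_eq_iff] at h
    exact hn.2 (h.trans h1.symm)
  · exact Lk.not_triangle hA.cat0 ((hlk hg.2.2).resolve_left hg.2.1) h3 h

end IsGradedAction

end SquareComplex

/-! ### Moving the base vertex to the opposite corner of a square. -/

namespace SquareComplex

variable {V : Type u} {X : SquareComplex V} {ht : V → ℤ} {A : Type v} [Group A] [MulAction A V]

/-- The letter `c` resets neither `p` nor `q`, and carries both only to states among them. -/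
def Preserves (X : SquareComplex V) (v p q : V) (c : A) : Prop :=
  (¬ X.Reset v p c ∧ ¬ X.Reset v q c) ∧
    (∀ b, X.Pass v p c b → b = p ∨ b = q) ∧ ∀ b, X.Pass v q c b → b = p ∨ b = q

namespace IsGradedAction

variable {v : V} {Γ : Finset A} {e : ℝ}

theorem dist_inv_smul (hA : X.IsGradedAction ht A) (c : A) (x y : V) :
    X.graph.dist (c⁻¹ • x) y = X.graph.dist x (c • y) := by
  rw [← hA.dist_smul c, smul_inv_smul]

/-- The first step of a geodesic from `c • v` to a point next to `v` in the direction of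
`c • v`. -/
theorem exists_dir_inv (hA : X.IsGradedAction ht A) {c : A} {x : V} {k : ℕ}
    (hx : X.graph.dist v x ≤ k) (hd : X.graph.dist x (c • v) + k = X.graph.dist v (c • v))
    (hne : x ≠ c • v) : ∃ b, X.Dir v c⁻¹ b ∧ X.graph.dist x (c • b) + 1 + k =
      X.graph.dist v (c • v) := by
  obtain ⟨b, h1, h2⟩ := hA.cat0.exists_step hne.symm
  have e1 : c • c⁻¹ • b = b := smul_inv_smul _ _
  have h3 := hA.cat0.connected.dist_triangle (u := v) (v := x) (w := b)
  rw [SimpleGraph.dist_comm, SimpleGraph.dist_comm (u := b)] at h2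
  refine ⟨c⁻¹ • b, ⟨?_, ?_⟩, ?_⟩
  · rw [← hA.adj_smul_iff c, e1]
    exact h1
  · rw [mem_half, hA.dist_inv_smul, hA.dist_inv_smul, e1]
    omega
  · rw [e1]
    omega

/-- A geodesic from `v` to `c • v` can begin with `x` and end with `c • y`. The edges from `x` to
`w` and from `c • y` to `c • w` are parallel, so `w` and `c • w` are no farther apart than `x` and
`c • y`, which is two less than the old displacement. -/
theorem dist_single (hA : X.IsGradedAction ht A) {x x' y y' w : V} {c : A}
    (hx : X.IsSquare v x w x') (hy : X.IsSquare v y w y') (h1 : X.Dir v c x)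
    (h2 : ∀ b, X.Dir v c⁻¹ b → b = y) (h3 : X.Pass v x' c y') :
    X.graph.dist w (c • w) + 2 ≤ X.graph.dist v (c • v) := by
  have hX := hA.cat0
  have hd := h1.2
  rw [mem_half, SimpleGraph.dist_comm, SimpleGraph.dist_comm (v := v)] at hd
  have hd' := hX.dist_adj h1.1 (c • v)
  rw [SimpleGraph.dist_comm, SimpleGraph.dist_comm (v := v)] at hd'
  have hev := hX.even_dist v (c • v)
  rw [hA.ht_smul, sub_self, sub_zero, Int.even_iff] at hev
  obtain ⟨b, hb, hb'⟩ := hA.exists_dir_inv (v := v) (x := x) (c := c) (k := 1)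
    (SimpleGraph.dist_eq_one_iff_adj.2 h1.1).le (by omega) (by
      intro e
      have : X.graph.dist x (c • v) = 0 := by rw [← e, SimpleGraph.dist_self]
      omega)
  obtain rfl := h2 b hb
  have s1 : X.half w x = X.half x' v := hX.half_square (X.reflect (X.rotate (X.rotate hx)))
  have s2 : X.half (c • w) (c • b) = X.half x' v := by
    have := hX.half_square (hA.square_smul c (X.reflect (X.rotate (X.rotate hy))))
    rw [this]
    ext z
    have := hA.smul_mem_half c (a := y') (b := v) (x := c⁻¹ • z)
    rw [smul_inv_smul] at this
    rw [this, h3.2, smul_inv_smul]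
  have hwx : X.graph.Adj w x := (X.adj (X.rotate hx)).symm
  have hwb : X.graph.Adj w b := (X.adj (X.rotate hy)).symm
  have k1 : w ∈ X.half (c • w) (c • b) := by
    rw [s2, ← s1]
    exact IsGradedCAT0.left_mem_half hwx
  have k2 : c • b ∉ X.half w x := by
    rw [s1, ← s2]
    exact IsGradedCAT0.right_notMem_half
  rw [mem_half] at k1 k2
  have k3 := hX.dist_adj hwx (c • b)
  rw [SimpleGraph.dist_comm (v := w), SimpleGraph.dist_comm (v := x)] at k2 k3
  omega

/-- A geodesic from `v` to `c • v` can pass through `w` after two steps, and through `c • p` or `c •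
q` just before its end. These are adjacent to `c • w`, so three steps are saved and one is spent. -/
theorem dist_double (hA : X.IsGradedAction ht A) {p q w : V} {c : A} (hs : X.IsSquare v p w q)
    (h1 : X.Dir v c p) (h2 : X.Dir v c q) (h3 : X.Dir v c⁻¹ p) (h4 : X.Dir v c⁻¹ q)
    (h5 : ∀ b, X.Dir v c⁻¹ b → b = p ∨ b = q) (hne : c • v ≠ w) :
    X.graph.dist w (c • w) + 2 ≤ X.graph.dist v (c • v) := by
  have hX := hA.cat0
  obtain ⟨w', hw', hd⟩ := hX.exists_square_of_mem h1.1 h2.1 (isSquare_ne hs) h1.2 h2.2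
  obtain rfl := corner_unique hs hw'
  rw [SimpleGraph.dist_comm, SimpleGraph.dist_comm (v := v)] at hd
  have hvw : X.graph.dist v w ≤ 2 := by
    have := hX.connected.dist_triangle (u := v) (v := p) (w := w)
    rw [SimpleGraph.dist_eq_one_iff_adj.2 (X.adj hs),
      SimpleGraph.dist_eq_one_iff_adj.2 (X.adj (X.rotate hs))] at this
    exact this
  obtain ⟨b, hb, hb'⟩ := hA.exists_dir_inv hvw hd hne.symm
  have key : X.graph.Adj b w := by
    rcases h5 b hb with rfl | rfl
    · exact X.adj (X.rotate hs)
    · exact X.adj (X.rotate (X.reflect hs))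
  have := hX.connected.dist_triangle (u := w) (v := c • b) (w := c • w)
  rw [hA.dist_smul, SimpleGraph.dist_eq_one_iff_adj.2 key] at this
  omega

/-- The state `x'` passes to a state in the pair that is linked to every direction of `c⁻¹ • v`.
Those directions also lie in the pair, so only the other element remains for them. This supplies the
hypotheses of `dist_single`. -/
theorem exists_pass_of_single (hA : X.IsGradedAction ht A) {p q x x' : V} {c : A}
    (hl : X.Lk v p q) (hc : X.Preserves v p q c) (hc' : X.Preserves v p q c⁻¹)
    (hx : x = p ∧ x' = q ∨ x = q ∧ x' = p) (h1 : X.Dir v c x) (h2 : ¬ X.Dir v c x') :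
    ∃ y y', (y = p ∧ y' = q ∨ y = q ∧ y' = p) ∧ X.Dir v c⁻¹ y ∧ (∀ b, X.Dir v c⁻¹ b → b = y) ∧
      X.Pass v x' c y' := by
  have hX := hA.cat0
  have hx' : X.graph.Adj v x' := by
    rcases hx with ⟨-, rfl⟩ | ⟨-, rfl⟩
    · exact hl.symm.adj
    · exact hl.adj
  have hr : ¬ X.Reset v x' c := by
    rcases hx with ⟨-, rfl⟩ | ⟨-, rfl⟩
    · exact hc.1.2
    · exact hc.1.1
  obtain ⟨⟨b, hb, hb'⟩, -⟩ := (hA.dir_or hx' hr).resolve_left h2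
  have hbpq : b = p ∨ b = q := by
    rcases hx with ⟨-, rfl⟩ | ⟨-, rfl⟩
    · exact hc.2.2 b hb
    · exact hc.2.1 b hb
  have hne : c⁻¹ • v ≠ v := fun h => h1.ne ((inv_smul_eq_iff.1 h).symm)
  obtain ⟨y, hy⟩ := exists_dir hX hne
  have hin : ∀ z, X.Dir v c⁻¹ z → (z = p ∨ z = q) ∧ z ≠ b := fun z hz =>
    ⟨hA.eq_or_eq_of_not_reset hl hc'.1.1 hc'.1.2 hz, (hb' z hz).ne⟩
  have hy' := hin y hy
  refine ⟨y, b, ?_, hy, fun z hz => ?_, hb⟩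
  · rcases hy' with ⟨rfl | rfl, h⟩ <;> rcases hbpq with rfl | rfl <;> simp_all
  · have := hin z hz
    rcases this with ⟨rfl | rfl, h⟩ <;> rcases hbpq with rfl | rfl <;> simp_all

theorem lk_square {p q x x' w : V} (hs : X.IsSquare v p w q)
    (hx : x = p ∧ x' = q ∨ x = q ∧ x' = p) : X.IsSquare v x w x' := by
  rcases hx with ⟨rfl, rfl⟩ | ⟨rfl, rfl⟩
  · exact hs
  · exact X.reflect hs

theorem smul_diag_of_fix (hA : X.IsGradedAction ht A) {p q w : V} {c : A}
    (hs : X.IsSquare v p w q) (hc : X.Preserves v p q c) (h : c • v = v) : c • w = w := by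
  have hp := hc.2.1 _ (hA.pass_of_fix (X.adj hs) h)
  have hq := hc.2.2 _ (hA.pass_of_fix (X.adj (X.reflect hs)) h)
  have h' : c⁻¹ • v = v := by rw [inv_smul_eq_iff, h]
  have hs' := hA.square_smul c⁻¹ hs
  rw [h'] at hs'
  have hne := isSquare_ne hs'
  have : X.IsSquare v p (c⁻¹ • w) q := by
    rcases hp with hp | hp <;> rcases hq with hq | hq <;> rw [hp, hq] at hs' hne
    · exact absurd rfl hne
    · exact hs'
    · exact X.reflect hs'
    · exact absurd rfl hne
  have := corner_unique hs this
  rw [eq_inv_smul_iff] at this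
  exact this

theorem dist_diag_le (hA : X.IsGradedAction ht A) {p q w : V} (hs : X.IsSquare v p w q) (c : A) :
    X.graph.dist w (c • w) ≤ X.graph.dist v (c • v) + 4 := by
  have hc := hA.cat0.connected
  have h0 : X.graph.dist v w ≤ 2 := by
    have := hc.dist_triangle (u := v) (v := p) (w := w)
    rw [SimpleGraph.dist_eq_one_iff_adj.2 (X.adj hs),
      SimpleGraph.dist_eq_one_iff_adj.2 (X.adj (X.rotate hs))] at this
    exact this
  have h1 := hc.dist_triangle (u := w) (v := v) (w := c • w)
  have h2 := hc.dist_triangle (u := v) (v := c • v) (w := c • w)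
  rw [hA.dist_smul] at h2
  rw [SimpleGraph.dist_comm] at h1
  have : X.graph.dist w v = X.graph.dist v w := SimpleGraph.dist_comm
  have : X.graph.dist w (c • w) = X.graph.dist (c • w) w := SimpleGraph.dist_comm
  omega

/-- How a preserving letter changes the displacement when `v` is moved to the opposite vertex of
the square. -/
theorem dist_diag (hA : X.IsGradedAction ht A) {p q w : V} {c : A} (hs : X.IsSquare v p w q)
    (hc : X.Preserves v p q c) (hc' : X.Preserves v p q c⁻¹) :
    (c • v = v ∧ X.graph.dist w (c • w) ≤ X.graph.dist v (c • v)) ∨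
    (c • v ≠ v ∧ X.graph.dist w (c • w) + 2 ≤ X.graph.dist v (c • v)) ∨
    (c • v = w ∧ X.Dir v c p ∧ X.Dir v c q ∧
      X.graph.dist w (c • w) ≤ X.graph.dist v (c • v)) := by
  have hl : X.Lk v p q := ⟨w, hs⟩
  by_cases hv : c • v = v
  · refine Or.inl ⟨hv, ?_⟩
    rw [hA.smul_diag_of_fix hs hc hv, SimpleGraph.dist_self]
    exact Nat.zero_le _
  refine Or.inr ?_
  have single : ∀ x x', (x = p ∧ x' = q ∨ x = q ∧ x' = p) → X.Dir v c x → ¬ X.Dir v c x' →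
      X.graph.dist w (c • w) + 2 ≤ X.graph.dist v (c • v) := by
    intro x x' hx h1 h2
    obtain ⟨y, y', h3, h4, h5, h6⟩ := hA.exists_pass_of_single hl hc hc' hx h1 h2
    exact hA.dist_single (lk_square hs hx) (lk_square hs h3) h1 h5 h6
  by_cases h1 : X.Dir v c p
  swap
  · obtain ⟨x, hx⟩ := exists_dir hA.cat0 hv
    rcases hA.eq_or_eq_of_not_reset hl hc.1.1 hc.1.2 hx with rfl | rfl
    · exact absurd hx h1
    · exact Or.inl ⟨hv, single _ _ (Or.inr ⟨rfl, rfl⟩) hx h1⟩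
  by_cases h2 : X.Dir v c q
  swap
  · exact Or.inl ⟨hv, single _ _ (Or.inl ⟨rfl, rfl⟩) h1 h2⟩
  by_cases hw : c • v = w
  · refine Or.inr ⟨hw, h1, h2, ?_⟩
    have : X.graph.dist w (c • w) = X.graph.dist (c • v) (c • w) := by rw [hw]
    rw [this, hA.dist_smul, hw]
  have hne : c⁻¹ • v ≠ v := fun h => hv ((inv_smul_eq_iff.1 h).symm)
  have hcc : X.Preserves v p q c⁻¹⁻¹ := by rwa [inv_inv]
  have inv_single : ∀ x x', (x = p ∧ x' = q ∨ x = q ∧ x' = p) → X.Dir v c⁻¹ x →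
      X.Dir v c⁻¹ x' := by
    intro x x' hx h3
    by_contra h4
    obtain ⟨y, -, -, -, h5, -⟩ := hA.exists_pass_of_single hl hc' hcc hx h3 h4
    rw [inv_inv] at h5
    exact hl.ne ((h5 p h1).trans (h5 q h2).symm)
  have h34 : X.Dir v c⁻¹ p ∧ X.Dir v c⁻¹ q := by
    obtain ⟨x, hx⟩ := exists_dir hA.cat0 hne
    rcases hA.eq_or_eq_of_not_reset hl hc'.1.1 hc'.1.2 hx with rfl | rfl
    · exact ⟨hx, inv_single _ _ (Or.inl ⟨rfl, rfl⟩) hx⟩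
    · exact ⟨inv_single _ _ (Or.inr ⟨rfl, rfl⟩) hx, hx⟩
  exact Or.inl ⟨hv, hA.dist_double hs h1 h2 h34.1 h34.2
    (fun b hb => hA.eq_or_eq_of_not_reset hl hc'.1.1 hc'.1.2 hb) hw⟩

/-- At a vertex of minimal displacement, few letters point in a direction that is robustly
preserved. -/
theorem cnt_dir_lt (hA : X.IsGradedAction ht A) (hΓ : ∀ c ∈ Γ, c⁻¹ ∈ Γ)
    (hmin : ∀ u, ∑ c ∈ Γ, (X.graph.dist v (c • v) : ℝ) ≤ ∑ c ∈ Γ, (X.graph.dist u (c • u) : ℝ))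
    {p : V} (hp : X.Bad v Γ e 3 p) : cnt Γ (fun c => X.Dir v c p) < 32 * e := by
  classical
  by_contra! hM
  have he : 0 < e := cnt_nonneg.trans_lt hp.reset_lt
  have hN := hA.lt_cnt_pass hΓ hmin hp
  obtain ⟨q, hl, hq, hall⟩ := hA.exists_unique_bad hΓ hmin hp hM
  obtain ⟨w, hs⟩ := hl
  have hl : X.Lk v p q := ⟨w, hs⟩
  have hP : cnt Γ (fun c => ¬ X.Preserves v p q c) < 4 * e := by
    have h1 : cnt Γ (fun c => ¬ X.Preserves v p q c) ≤
        cnt Γ (fun c => X.Reset v p c ∨ X.Reset v q c) +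
        cnt Γ (fun c => (∃ b, X.Pass v p c b ∧ ¬ X.Bad v Γ e 2 b) ∨
          ∃ b, X.Pass v q c b ∧ ¬ X.Bad v Γ e 1 b) := by
      refine cnt_le_add fun c _ h => ?_
      by_contra! hn
      exact h ⟨hn.1, fun b hb => hall b (Bad.pred 1 (hn.2.1 b hb)),
        fun b hb => hall b (hn.2.2 b hb)⟩
    have h2 := cnt_le_add (Γ := Γ) fun c _ (h : X.Reset v p c ∨ X.Reset v q c) => h
    have h3 := cnt_le_add (Γ := Γ) fun c _ (h : (∃ b, X.Pass v p c b ∧ ¬ X.Bad v Γ e 2 b) ∨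
          ∃ b, X.Pass v q c b ∧ ¬ X.Bad v Γ e 1 b) => h
    have h4 : cnt Γ (fun c => X.Reset v p c) < e := hp.reset_lt
    have h5 : cnt Γ (fun c => X.Reset v q c) < e := hq.reset_lt
    linarith [hp.2, hq.2]
  let Ok : A → Prop := fun c => X.Preserves v p q c ∧ X.Preserves v p q c⁻¹
  have hOk : cnt Γ (fun c => ¬ Ok c) < 8 * e := by
    have h1 : cnt Γ (fun c => ¬ Ok c) ≤ cnt Γ (fun c => ¬ X.Preserves v p q c) +
        cnt Γ (fun c => ¬ X.Preserves v p q c⁻¹) :=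
      cnt_le_add fun c _ h => not_and_or.1 h
    rw [cnt_inv hΓ fun c => ¬ X.Preserves v p q c] at h1
    linarith
  let Dn : A → Prop := fun c => Ok c ∧ c • v ≠ v ∧
    X.graph.dist w (c • w) + 2 ≤ X.graph.dist v (c • v)
  -- Minimality of `v` tested against `w`: letters in `Dn` lose at least two, letters outside `Ok`
  -- gain at most four, and the others gain nothing. Hence fewer than `24 * e` letters are outside
  -- `Ok` or in `Dn`, against at least `32 * e` pointing to `p` and more than `30 * e` passing `p`
  -- to another bad state.
  have hDn : 2 * cnt Γ Dn ≤ 4 * cnt Γ (fun c => ¬ Ok c) := by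
    have h1 : ∑ c ∈ Γ, ((X.graph.dist w (c • w) : ℝ) - X.graph.dist v (c • v)) ≤
        ∑ c ∈ Γ, (4 * (if ¬ Ok c then 1 else 0) - 2 * (if Dn c then 1 else 0)) := by
      refine Finset.sum_le_sum fun c _ => ?_
      by_cases hok : Ok c
      · rw [if_neg (not_not.2 hok)]
        by_cases hd : Dn c
        · rw [if_pos hd]
          have : (X.graph.dist w (c • w) : ℝ) + 2 ≤ X.graph.dist v (c • v) := by
            exact_mod_cast hd.2.2
          linarith
        · rw [if_neg hd]
          have : X.graph.dist w (c • w) ≤ X.graph.dist v (c • v) := by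
            rcases hA.dist_diag hs hok.1 hok.2 with h | h | h
            · exact h.2
            · exact absurd ⟨hok, h⟩ hd
            · exact h.2.2.2
          have : (X.graph.dist w (c • w) : ℝ) ≤ X.graph.dist v (c • v) := by exact_mod_cast this
          linarith
      · rw [if_pos hok, if_neg (fun h : Dn c => hok h.1)]
        have : (X.graph.dist w (c • w) : ℝ) ≤ X.graph.dist v (c • v) + 4 := by
          exact_mod_cast hA.dist_diag_le hs c
        linarith
    rw [Finset.sum_sub_distrib, Finset.sum_sub_distrib, ← Finset.mul_sum, ← Finset.mul_sum] at h1
    have h2 : ∑ c ∈ Γ, (if ¬ Ok c then (1 : ℝ) else 0) = cnt Γ (fun c => ¬ Ok c) := by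
      rw [cnt]
      exact Finset.sum_congr rfl fun c _ => by congr
    have h3 : ∑ c ∈ Γ, (if Dn c then (1 : ℝ) else 0) = cnt Γ Dn := by
      rw [cnt]
      exact Finset.sum_congr rfl fun c _ => by congr
    rw [h2, h3] at h1
    linarith [hmin w]
  -- some letter moves `v` to the opposite vertex of the square
  have hw : ht w = ht v := by
    obtain ⟨c, -, h1, h2⟩ := exists_of_cnt_lt (Γ := Γ) (P := fun c => X.Dir v c p)
      (Q := fun c => ¬ Ok c ∨ Dn c)
      (lt_of_le_of_lt (cnt_le_add fun c _ h => h) (by linarith))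
    push Not at h2
    rcases hA.dist_diag hs h2.1.1 h2.1.2 with h | h | h
    · exact absurd h.1 h1.ne
    · exact absurd ⟨h2.1, h⟩ h2.2
    · rw [← h.1, hA.ht_smul]
  -- some letter fixes `v` and exchanges its two neighbours
  have hpq : ht q = ht p := by
    obtain ⟨c, -, ⟨b, hb1, hb2, -⟩, h2⟩ := exists_of_cnt_lt (Γ := Γ)
      (P := fun c => ∃ b, b ≠ p ∧ X.Pass v p c b ∧ X.Bad v Γ e 2 b)
      (Q := fun c => ¬ Ok c ∨ Dn c)
      (lt_of_le_of_lt (cnt_le_add fun c _ h => h) (by linarith))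
    push Not at h2
    rcases hA.dist_diag hs h2.1.1 h2.1.2 with h | h | h
    · have h3 := hb2.unique hA.cat0 (hA.pass_of_fix hl.adj h.1)
      have h4 := (h2.1.1.2.1 b hb2).resolve_left hb1
      rw [← h4, h3, hA.ht_smul]
    · exact absurd ⟨h2.1, h⟩ h2.2
    · exact absurd h.2.1 hb2.not_dir
  -- With `ht w = ht v` and `ht q = ht p`, the relation on the square gives `ht v = ht p`, but
  -- heights of adjacent vertices differ by one.
  have h1 := hA.cat0.ht_square hs
  have h2 := hA.cat0.ht_adj hl.adj
  omega

end IsGradedAction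

end SquareComplex

/-! ### The automaton of halfspaces at a vertex of minimal displacement. -/

namespace SquareComplex

variable {V : Type u} {X : SquareComplex V} {ht : V → ℤ} {A : Type v} [Group A] [MulAction A V]

/-- A finite set of halfspaces next to `v`, each of which is carried into another one by many
inverse letters. -/
def HasAutomaton (X : SquareComplex V) (v : V) (Γ : Finset A) (e : ℝ) (B : ℕ) : Prop :=
  ∃ S : Finset V, S.card ≤ B ∧ (∀ a ∈ S, X.graph.Adj v a) ∧
    (∀ a ∈ S, e ≤ cnt Γ fun c => ∃ b ∈ S, ∀ x, c • x ∈ X.half a v → x ∈ X.half b v) ∧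
    ∃ a ∈ S, ∃ c ∈ Γ, c⁻¹ • v ∈ X.half a v

theorem HasAutomaton.mono {v : V} {Γ : Finset A} {e e' : ℝ} {B : ℕ} (he : e' ≤ e)
    (h : X.HasAutomaton v Γ e B) : X.HasAutomaton v Γ e' B := by
  obtain ⟨S, h1, h2, h3, h4⟩ := h
  exact ⟨S, h1, h2, fun a ha => he.trans (h3 a ha), h4⟩

open Classical in
/-- The states reached from `U` by at most `k` passes. -/
noncomputable def passes (X : SquareComplex V) (v : V) (Γ : Finset A) (U : Finset V) :
    ℕ → Finset V
  | 0 => U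
  | k + 1 => passes X v Γ U k ∪ (passes X v Γ U k ×ˢ Γ).image
      fun x => if h : ∃ b, X.Pass v x.1 x.2 b then h.choose else v

theorem card_passes (v : V) (Γ : Finset A) (U : Finset V) (k : ℕ) :
    (X.passes v Γ U k).card ≤ U.card * (Γ.card + 1) ^ k := by
  classical
  induction k with
  | zero => simp [passes]
  | succ k ih =>
    refine (Finset.card_union_le _ _).trans ?_
    refine (Nat.add_le_add_left Finset.card_image_le _).trans ?_
    rw [Finset.card_product, pow_succ]
    calc _ = (X.passes v Γ U k).card * (Γ.card + 1) := by ring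
      _ ≤ _ := by rw [← mul_assoc]; exact Nat.mul_le_mul_right _ ih

theorem mem_passes (hX : X.IsGradedCAT0 ht) {v a b : V} {Γ : Finset A} {U : Finset V} {k : ℕ}
    {c : A} (ha : a ∈ X.passes v Γ U k) (hc : c ∈ Γ) (h : X.Pass v a c b) :
    b ∈ X.passes v Γ U (k + 1) := by
  classical
  refine Finset.mem_union_right _ (Finset.mem_image.2 ⟨(a, c), Finset.mk_mem_product ha hc, ?_⟩)
  have h' : ∃ b, X.Pass v a c b := ⟨b, h⟩
  rw [dif_pos h']
  exact h'.choose_spec.unique hX h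

theorem passes_mono {v : V} {Γ : Finset A} {U : Finset V} {k l : ℕ} (h : k ≤ l) :
    X.passes v Γ U k ⊆ X.passes v Γ U l := by
  classical
  induction h with
  | refl => exact subset_rfl
  | step _ ih => exact ih.trans Finset.subset_union_left

/-- The directions of one letter are pairwise linked, and there are no triangles in the link, so
there are at most two of them. -/
theorem exists_dirs (hX : X.IsGradedCAT0 ht) (v : V) (Γ : Finset A) :
    ∃ U : Finset V, U.card ≤ 2 * Γ.card ∧ ∀ c ∈ Γ, ∀ a, X.Dir v c a → a ∈ U := by
  classical
  have h : ∀ c : A, ∃ f : Bool → V, ∀ a, X.Dir v c a → a = f true ∨ a = f false := by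
    intro c
    by_cases h1 : ∃ a, X.Dir v c a
    · obtain ⟨a, ha⟩ := h1
      by_cases h2 : ∃ b, X.Dir v c b ∧ b ≠ a
      · obtain ⟨b, hb, hne⟩ := h2
        refine ⟨fun i => if i then a else b, fun x hx => ?_⟩
        by_contra! hn
        have hn1 : x ≠ a := hn.1
        have hn2 : x ≠ b := hn.2
        exact Lk.not_triangle hX ((hx.eq_or_lk hX ha).resolve_left hn1)
          ((ha.eq_or_lk hX hb).resolve_left hne.symm) ((hx.eq_or_lk hX hb).resolve_left hn2)
      · push Not at h2
        exact ⟨fun _ => a, fun x hx => Or.inl (h2 x hx)⟩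
    · exact ⟨fun _ => v, fun a ha => absurd ⟨a, ha⟩ h1⟩
  choose f hf using h
  refine ⟨(Finset.univ ×ˢ Γ).image fun x : Bool × A => f x.2 x.1, ?_, fun c hc a ha => ?_⟩
  · refine Finset.card_image_le.trans ?_
    rw [Finset.card_product]
    rfl
  · rw [Finset.mem_image]
    rcases hf c a ha with rfl | rfl
    · exact ⟨(true, c), by simp [hc], rfl⟩
    · exact ⟨(false, c), by simp [hc], rfl⟩

namespace IsGradedAction

variable {v : V} {Γ : Finset A} {e : ℝ}

/-- A state that is not bad has at least `2 * e` resets or at least `2 * e` passes to states that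
are not bad one level down. Resets lead to directions, which are not bad at level three unless they
lie in the discarded set `Rm`; discarding costs at most `e` letters. -/
theorem hasAutomaton_of_not_bad (hA : X.IsGradedAction ht A) (hΓ : ∀ c ∈ Γ, c⁻¹ ∈ Γ)
    (Rm : V → Prop) (h1 : cnt Γ (fun c => ∃ a, Rm a ∧ X.Dir v c a) ≤ e)
    (h2 : ∀ a, X.graph.Adj v a → ¬ Rm a → (∃ c ∈ Γ, X.Dir v c a) → ¬ X.Bad v Γ (2 * e) 3 a)
    (h3 : e < cnt Γ (fun c => c • v ≠ v)) :
    X.HasAutomaton v Γ e (2 * Γ.card * (Γ.card + 1) ^ 3) := by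
  classical
  have he : 0 ≤ e := cnt_nonneg.trans h1
  have hX := hA.cat0
  obtain ⟨U, hU, hU'⟩ := exists_dirs hX v Γ
  -- A state at level `i` has used up `3 - i` passes, so three passes always suffice and the
  -- automaton stays finite.
  let S := (X.passes v Γ U 3).filter fun a => X.graph.Adj v a ∧
    ∃ i ≤ 3, a ∈ X.passes v Γ U (3 - i) ∧ ¬ X.Bad v Γ (2 * e) i a
  have hS : ∀ a i, i ≤ 3 → X.graph.Adj v a → a ∈ X.passes v Γ U (3 - i) →
      ¬ X.Bad v Γ (2 * e) i a → a ∈ S := fun a i hi ha hp hb =>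
    Finset.mem_filter.2 ⟨passes_mono (Nat.sub_le 3 i) hp, ha, i, hi, hp, hb⟩
  have hS3 : ∀ a c, c ∈ Γ → X.Dir v c a → ¬ Rm a → a ∈ S := fun a c hc hd hr =>
    hS a 3 le_rfl hd.1 (hU' c hc a hd) (h2 a hd.1 hr ⟨c, hc, hd⟩)
  refine ⟨S, ?_, fun a ha => (Finset.mem_filter.1 ha).2.1, ?_, ?_⟩
  · refine (Finset.card_filter_le _ _).trans ((card_passes v Γ U 3).trans ?_)
    exact Nat.mul_le_mul_right _ hU
  · intro a ha
    obtain ⟨-, hadj, i, hi, hp, hb⟩ := Finset.mem_filter.1 ha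
    by_cases hr : 2 * e ≤ cnt Γ (X.Reset v a)
    · have h4 : cnt Γ (X.Reset v a) ≤
          cnt Γ (fun c => ∃ b ∈ S, ∀ x, c • x ∈ X.half a v → x ∈ X.half b v) +
          cnt Γ (fun c => ∃ a, Rm a ∧ X.Dir v c⁻¹ a) := by
        refine cnt_le_add fun c hc ⟨b, hb1, hb2⟩ => ?_
        by_cases hRm : Rm b
        · exact Or.inr ⟨b, hRm, hb1⟩
        · exact Or.inl ⟨b, hS3 b c⁻¹ (hΓ c hc) hb1 hRm, hb2⟩
      rw [cnt_inv hΓ fun c => ∃ a, Rm a ∧ X.Dir v c a] at h4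
      linarith
    · rw [not_le] at hr
      cases i with
      | zero => exact absurd ⟨hadj, hr⟩ hb
      | succ i =>
        have h4 : ¬ cnt Γ (fun c => ∃ b, X.Pass v a c b ∧ ¬ X.Bad v Γ (2 * e) i b) < 2 * e :=
          fun h => hb ⟨⟨hadj, hr⟩, h⟩
        rw [not_lt] at h4
        have h5 : cnt Γ (fun c => ∃ b, X.Pass v a c b ∧ ¬ X.Bad v Γ (2 * e) i b) ≤
            cnt Γ (fun c => ∃ b ∈ S, ∀ x, c • x ∈ X.half a v → x ∈ X.half b v) := by
          refine cnt_mono fun c hc ⟨b, hb1, hb2⟩ => ⟨b, hS b i (by omega) hb1.1 ?_ hb2,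
            fun x => (hb1.2 x).2⟩
          have := mem_passes hX hp hc hb1
          rwa [show 3 - (i + 1) + 1 = 3 - i by omega] at this
        linarith
  · obtain ⟨c, hc, hv, hn⟩ := exists_of_cnt_lt (h1.trans_lt h3)
    obtain ⟨a, ha⟩ := exists_dir hX hv
    push Not at hn
    refine ⟨a, hS3 a c hc ha fun h => hn a h ha, c⁻¹, hΓ c hc, ?_⟩
    rw [inv_inv]
    exact ha.2

/-- A vertex of minimal displacement that is moved by `t` letters admits an automaton with at
least `t / 2195456` legal letters at each state. -/
theorem hasAutomaton (hA : X.IsGradedAction ht A) (hΓ : ∀ c ∈ Γ, c⁻¹ ∈ Γ)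
    (hmin : ∀ u, ∑ c ∈ Γ, (X.graph.dist v (c • v) : ℝ) ≤ ∑ c ∈ Γ, (X.graph.dist u (c • u) : ℝ))
    (hpos : 0 < cnt Γ (fun c => c • v ≠ v)) :
    X.HasAutomaton v Γ (cnt Γ (fun c => c • v ≠ v) / 2195456)
      (2 * Γ.card * (Γ.card + 1) ^ 3) := by
  have hX := hA.cat0
  obtain ⟨t, ht'⟩ : ∃ t, t = cnt Γ (fun c => c • v ≠ v) := ⟨_, rfl⟩
  -- The budget of the first case is 134 = 32·4 + 4 + 1 + 1, and 2195456 = 134·16384, where `e /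
  -- 16384` is the smallest threshold used below.
  obtain ⟨e, he⟩ : ∃ e, t = 134 * e := ⟨t / 134, by ring⟩
  rw [← ht'] at hpos ⊢
  have he0 : 0 < e := by linarith
  -- Suppose two bad states are not linked. Every direction of a letter that resets neither is
  -- linked to both. If such a direction `a` were bad for `4 * e`, then a letter moving `v` would
  -- point to `a` or reset one of `a`, `a₁`, `a₂`, since otherwise there is a triangle in the link;
  -- that accounts for fewer than `134 * e` letters.
  by_cases hcase : ∃ a₁ a₂, X.Bad v Γ e 0 a₁ ∧ X.Bad v Γ e 0 a₂ ∧ a₁ ≠ a₂ ∧ ¬ X.Lk v a₁ a₂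
  · obtain ⟨a₁, a₂, hb1, hb2, hne, hl⟩ := hcase
    have key : ∀ {c : A} {x : V}, X.Dir v c x → ¬ X.Reset v a₁ c → ¬ X.Reset v a₂ c →
        X.Lk v a₁ x ∧ X.Lk v a₂ x := by
      intro c x hx r1 r2
      rcases hA.eq_or_lk_of_not_reset hb1.1 r1 hx with rfl | e1
      · rcases hA.eq_or_lk_of_not_reset hb2.1 r2 hx with rfl | e2
        · exact absurd rfl hne
        · exact absurd e2 hl
      · rcases hA.eq_or_lk_of_not_reset hb2.1 r2 hx with rfl | e2
        · exact absurd e1.symm hl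
        · exact ⟨e1.symm, e2.symm⟩
    refine HasAutomaton.mono (e := 2 * e) (by linarith) (hA.hasAutomaton_of_not_bad hΓ
      (fun b => ¬ (X.Lk v a₁ b ∧ X.Lk v a₂ b)) ?_ ?_ (by rw [← ht']; linarith))
    · have := cnt_le_add (Γ := Γ) (P := fun c => ∃ a, ¬ (X.Lk v a₁ a ∧ X.Lk v a₂ a) ∧ X.Dir v c a)
        (Q := X.Reset v a₁) (R := X.Reset v a₂) fun c _ ⟨a, h1, h2⟩ => by
          by_contra! hn
          exact h1 (key h2 hn.1 hn.2)
      linarith [hb1.2, hb2.2]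
    · intro a _ ha _ hb
      rw [not_not] at ha
      have h1 := hA.cnt_dir_lt hΓ hmin hb
      have h2 := hb.reset_lt
      have h3 : cnt Γ (fun c => c • v ≠ v) ≤ cnt Γ (fun c => X.Dir v c a) +
          cnt Γ (fun c => X.Reset v a c ∨ X.Reset v a₁ c ∨ X.Reset v a₂ c) := by
        refine cnt_le_add fun c _ hc => ?_
        by_contra! hn
        obtain ⟨x, hx⟩ := exists_dir hX hc
        have h4 := key hx hn.2.2.1 hn.2.2.2
        have h5 := ((hA.dir_or hb.adj hn.2.1).resolve_left hn.1).2 x hx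
        exact Lk.not_triangle hX h4.1 h5 ha.1
      have h4 := cnt_le_add (Γ := Γ) fun c _
        (h : X.Reset v a c ∨ X.Reset v a₁ c ∨ X.Reset v a₂ c) => h
      have h5 := cnt_le_add (Γ := Γ) fun c _ (h : X.Reset v a₁ c ∨ X.Reset v a₂ c) => h
      have e1 : cnt Γ (fun c => X.Reset v a c) < 2 * (2 * e) := h2
      have e2 : cnt Γ (fun c => X.Reset v a₁ c) < e := hb1.2
      have e3 : cnt Γ (fun c => X.Reset v a₂ c) < e := hb2.2
      linarith
  push Not at hcase
  -- Now bad states are pairwise linked, so there are at most two, ordered here by the number of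
  -- letters pointing to them. The default values `v` are used when there are none.
  obtain ⟨k₁, k₂, hk, hle⟩ : ∃ k₁ k₂, (∀ b, X.Bad v Γ e 0 b → b = k₁ ∨ b = k₂) ∧
      cnt Γ (fun c => X.Dir v c k₂) ≤ cnt Γ (fun c => X.Dir v c k₁) := by
    obtain ⟨k₁, k₂, hk⟩ : ∃ k₁ k₂, (∀ b, X.Bad v Γ e 0 b → b = k₁ ∨ b = k₂) := by
      by_cases h1 : ∃ b, X.Bad v Γ e 0 b
      · obtain ⟨b, hb⟩ := h1
        by_cases h2 : ∃ b', X.Bad v Γ e 0 b' ∧ b ≠ b'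
        · obtain ⟨b', hb', hne⟩ := h2
          refine ⟨b, b', fun x hx => ?_⟩
          by_contra! hn
          exact Lk.not_triangle hX (hcase x b hx hb hn.1) (hcase b b' hb hb' hne)
            (hcase x b' hx hb' hn.2)
        · push Not at h2
          exact ⟨b, b, fun x hx => Or.inl (h2 x hx).symm⟩
      · push Not at h1
        exact ⟨v, v, fun b hb => absurd hb (h1 b)⟩
    rcases le_total (cnt Γ (fun c => X.Dir v c k₂)) (cnt Γ (fun c => X.Dir v c k₁)) with h | h
    · exact ⟨k₁, k₂, hk, h⟩
    · exact ⟨k₂, k₁, fun b hb => (hk b hb).symm, h⟩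
  have hsmall : ∀ {e' a}, e' ≤ e → a ≠ k₁ → a ≠ k₂ → ¬ X.Bad v Γ e' 3 a := by
    intro e' a h' h1 h2 hb
    rcases hk a ((hb.mono h' 3).zero) with h | h
    · exact h1 h
    · exact h2 h
  -- The thresholds are nested: a state with at least `e / 4` letters pointing to it is not bad for
  -- `e / 128`, and one with at least `e / 256` is not bad for `e / 8192`, both by `cnt_dir_lt`.
  -- States with fewer are discarded.
  by_cases h1 : cnt Γ (fun c => X.Dir v c k₁) < e / 4
  · refine HasAutomaton.mono (e := e / 2) (by linarith) (hA.hasAutomaton_of_not_bad hΓ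
      (fun b => b = k₁ ∨ b = k₂) ?_ ?_ (by rw [← ht']; linarith))
    · have := cnt_le_add (Γ := Γ) (P := fun c => ∃ a, (a = k₁ ∨ a = k₂) ∧ X.Dir v c a)
        (Q := fun c => X.Dir v c k₁) (R := fun c => X.Dir v c k₂) fun c _ ⟨a, h, h'⟩ => by
          rcases h with rfl | rfl
          · exact Or.inl h'
          · exact Or.inr h'
      linarith
    · intro a _ ha _
      push Not at ha
      exact hsmall (by linarith) ha.1 ha.2
  rw [not_lt] at h1
  by_cases h2 : cnt Γ (fun c => X.Dir v c k₂) < e / 256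
  · refine HasAutomaton.mono (e := e / 256) (by linarith) (hA.hasAutomaton_of_not_bad hΓ
      (fun b => b = k₂) ?_ ?_ (by rw [← ht']; linarith))
    · refine (cnt_mono fun c _ ⟨a, h, h'⟩ => ?_).trans h2.le
      rw [← h]
      exact h'
    · intro a _ ha _ hb
      by_cases hak : a = k₁
      · have := hA.cnt_dir_lt hΓ hmin hb
        rw [hak] at this
        linarith
      · exact hsmall (by linarith) hak ha hb
  rw [not_lt] at h2
  refine HasAutomaton.mono (e := e / 16384) (by linarith) (hA.hasAutomaton_of_not_bad hΓ
    (fun _ => False) ?_ ?_ (by rw [← ht']; linarith))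
  · refine le_of_eq_of_le ?_ (by linarith : 0 ≤ e / 16384)
    simp [cnt]
  · intro a _ _ _ hb
    have := hA.cnt_dir_lt hΓ hmin hb
    by_cases h3 : a = k₁
    · rw [h3] at this
      linarith
    · by_cases h4 : a = k₂
      · rw [h4] at this
        linarith
      · exact hsmall (by linarith) h3 h4 hb

end IsGradedAction

end SquareComplex

/-! ### Spheres and cancellation in the free group. -/

namespace SquareComplex

open FreeGroup hiding IsReduced norm

variable {n : ℕ}

/-- The reduced words of length `k`. -/
noncomputable def redWords (n k : ℕ) : Finset (List (Fin n × Bool)) :=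
  ((List.finite_length_eq (Fin n × Bool) k).subset
    (fun w (h : w.length = k ∧ FreeGroup.IsReduced w) => h.1)).toFinset

theorem mem_redWords {k : ℕ} {w : List (Fin n × Bool)} :
    w ∈ redWords n k ↔ w.length = k ∧ FreeGroup.IsReduced w := by
  exact Set.Finite.mem_toFinset _

theorem isReduced_cons_cons {x y : Fin n × Bool} {w : List (Fin n × Bool)} :
    FreeGroup.IsReduced (x :: y :: w) ↔ x ≠ (y.1, !y.2) ∧ FreeGroup.IsReduced (y :: w) := by
  rw [FreeGroup.IsReduced, FreeGroup.IsReduced, List.isChain_cons_cons]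
  refine and_congr_left fun _ => ?_
  obtain ⟨i, a⟩ := x
  obtain ⟨j, b⟩ := y
  cases a <;> cases b <;> simp

theorem card_redWords_succ (k : ℕ) :
    (redWords n (k + 2)).card = (redWords n (k + 1)).card * (2 * n - 1) := by
  classical
  have h1 : ((redWords n (k + 1)).sigma fun w => Finset.univ.filter fun x : Fin n × Bool =>
      FreeGroup.IsReduced (x :: w)).card = (redWords n (k + 2)).card := by
    refine Finset.card_bij (fun x _ => x.2 :: x.1) ?_ ?_ ?_
    · rintro ⟨w, x⟩ h
      simp only [Finset.mem_sigma, mem_redWords, Finset.mem_filter, Finset.mem_univ,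
        true_and] at h
      exact mem_redWords.2 ⟨by rw [List.length_cons, h.1.1], h.2⟩
    · rintro ⟨w, x⟩ - ⟨w', x'⟩ - h
      simp only [List.cons.injEq] at h
      obtain ⟨rfl, rfl⟩ := h
      rfl
    · intro w hw
      rw [mem_redWords] at hw
      cases w with
      | nil => simp at hw
      | cons x w =>
        refine ⟨⟨w, x⟩, ?_, rfl⟩
        simp only [Finset.mem_sigma, mem_redWords, Finset.mem_filter, Finset.mem_univ, true_and]
        exact ⟨⟨by simpa using hw.1, hw.2.infix (List.suffix_cons _ _).isInfix⟩, hw.2⟩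
  rw [← h1, Finset.card_sigma, Finset.sum_const_nat]
  intro w hw
  rw [mem_redWords] at hw
  cases w with
  | nil => simp at hw
  | cons y w =>
    have : (Finset.univ.filter fun x : Fin n × Bool => FreeGroup.IsReduced (x :: y :: w)) =
        Finset.univ.erase (y.1, !y.2) := by
      ext x
      simp only [Finset.mem_filter, Finset.mem_univ, true_and, Finset.mem_erase, and_true,
        isReduced_cons_cons, hw.2]
    rw [this, Finset.card_erase_of_mem (Finset.mem_univ _)]
    simp [mul_comm]

theorem card_redWords_one : (redWords n 1).card = 2 * n := by
  classical
  have : redWords n 1 = Finset.univ.image fun x : Fin n × Bool => [x] := by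
    ext w
    simp only [mem_redWords, Finset.mem_image, Finset.mem_univ, true_and, List.length_eq_one_iff]
    constructor
    · rintro ⟨⟨x, rfl⟩, -⟩
      exact ⟨x, rfl⟩
    · rintro ⟨x, rfl⟩
      exact ⟨⟨x, rfl⟩, FreeGroup.IsReduced.singleton⟩
  rw [this, Finset.card_image_of_injective _ (fun x y h => by simpa using h)]
  simp [mul_comm]

theorem card_redWords (k : ℕ) : (redWords n (k + 1)).card = 2 * n * (2 * n - 1) ^ k := by
  induction k with
  | zero => rw [card_redWords_one, pow_zero, mul_one]
  | succ k ih => rw [card_redWords_succ, ih, pow_succ, mul_assoc]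

theorem exists_cancel (x : List (Fin n × Bool)) :
    ∀ y : List (Fin n × Bool), FreeGroup.IsReduced x → FreeGroup.IsReduced y →
      ∃ u p w, x = u ++ p ∧ y = invRev p ++ w ∧ FreeGroup.IsReduced (u ++ w) := by
  induction x using List.reverseRecOn with
  | nil => exact fun y _ hy => ⟨[], [], y, rfl, rfl, hy⟩
  | append_singleton x a ih =>
    intro y hx hy
    cases y with
    | nil => exact ⟨x ++ [a], [], [], by simp, by simp [invRev], by simpa using hx⟩
    | cons b y =>
      by_cases h : b = (a.1, !a.2)
      · obtain ⟨u, p, w, h1, h2, h3⟩ := ih y (hx.infix (List.prefix_append _ _).isInfix)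
          (hy.infix (List.suffix_cons _ _).isInfix)
        refine ⟨u, p ++ [a], w, by rw [h1, List.append_assoc], ?_, h3⟩
        rw [invRev_append, h2, h]
        simp [invRev]
      · refine ⟨x ++ [a], [], b :: y, by simp, by simp [invRev], ?_⟩
        refine FreeGroup.IsReduced.append_overlap hx ?_ (by simp)
        change FreeGroup.IsReduced (a :: b :: y)
        refine isReduced_cons_cons.2 ⟨?_, hy⟩
        rintro rfl
        simp at h

theorem exists_cancel_mul (g c : FreeGroup (Fin n)) :
    ∃ u p w, g.toWord = u ++ p ∧ c.toWord = invRev p ++ w ∧ (g * c).toWord = u ++ w := by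
  obtain ⟨u, p, w, h1, h2, h3⟩ := exists_cancel g.toWord c.toWord isReduced_toWord isReduced_toWord
  refine ⟨u, p, w, h1, h2, ?_⟩
  rw [← h3.reduce_eq, ← toWord_mk]
  congr 1
  rw [← mk_toWord (x := g), ← mk_toWord (x := c), h1, h2, ← mul_mk, ← mul_mk, ← mul_mk, ← inv_mk]
  group

/-- The sphere of radius `m` in the free group. -/
noncomputable def sphere (n m : ℕ) : Finset (FreeGroup (Fin n)) := (redWords n m).image FreeGroup.mk

theorem mem_sphere {m : ℕ} {g : FreeGroup (Fin n)} : g ∈ sphere n m ↔ g.norm = m := by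
  rw [sphere, Finset.mem_image]
  constructor
  · rintro ⟨w, hw, rfl⟩
    rw [mem_redWords] at hw
    rw [FreeGroup.norm, toWord_mk, hw.2.reduce_eq, hw.1]
  · intro h
    exact ⟨g.toWord, mem_redWords.2 ⟨h, isReduced_toWord⟩, mk_toWord⟩

theorem card_sphere (m : ℕ) : (sphere n m).card = (redWords n m).card := by
  refine Finset.card_image_of_injOn fun x hx y hy h => ?_
  rw [← (mem_redWords.1 hx).2.reduce_eq, ← (mem_redWords.1 hy).2.reduce_eq]
  exact reduce.sound h

theorem inv_mem_sphere {m : ℕ} {g : FreeGroup (Fin n)} (h : g ∈ sphere n m) :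
    g⁻¹ ∈ sphere n m := by
  rw [mem_sphere] at h ⊢
  rw [norm_inv_eq, h]

/-- Few letters cancel substantially with a given element. -/
theorem card_cancel_le (m l : ℕ) (g : FreeGroup (Fin n)) :
    ((sphere n m).filter fun c => (g * c).norm + 2 * l < g.norm + m).card ≤
      (redWords n (m - l)).card := by
  refine Finset.card_le_card_of_injOn (fun c => c.toWord.drop l) ?_ ?_
  · intro c hc
    rw [Finset.mem_coe, Finset.mem_filter, mem_sphere, FreeGroup.norm] at hc
    refine mem_redWords.2 ⟨by rw [List.length_drop, hc.1], ?_⟩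
    exact isReduced_toWord.infix (List.drop_suffix _ _).isInfix
  · have key : ∀ c ∈ (sphere n m).filter fun c => (g * c).norm + 2 * l < g.norm + m,
        c.toWord.take l = (invRev g.toWord).take l := by
      intro c hc
      rw [Finset.mem_filter, mem_sphere] at hc
      obtain ⟨u, p, w, h1, h2, h3⟩ := exists_cancel_mul g c
      simp only [FreeGroup.norm, h1, h2, h3, List.length_append, invRev_length] at hc
      rw [h1, h2, invRev_append, List.take_append_of_le_length (by rw [invRev_length]; omega),
        List.take_append_of_le_length (by rw [invRev_length]; omega)]
    intro c hc c' hc' h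
    apply toWord_injective
    rw [← List.take_append_drop l c.toWord, ← List.take_append_drop l c'.toWord, key c hc,
      key c' hc']
    exact congrArg _ h

/-- An element has few decompositions as a product with little cancellation. -/
theorem card_split_le (m l : ℕ) (hl : l ≤ m) (h : FreeGroup (Fin n)) :
    ((sphere n m).filter fun c => (h * c⁻¹).norm + m ≤ h.norm + 2 * l).card ≤
      (redWords n l).card := by
  refine Finset.card_le_card_of_injOn (fun c => c.toWord.take l) ?_ ?_
  · intro c hc
    rw [Finset.mem_coe, Finset.mem_filter, mem_sphere, FreeGroup.norm] at hc
    refine mem_redWords.2 ⟨by rw [List.length_take, hc.1, min_eq_left hl], ?_⟩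
    exact isReduced_toWord.infix (List.take_prefix _ _).isInfix
  · have key : ∀ c ∈ (sphere n m).filter fun c => (h * c⁻¹).norm + m ≤ h.norm + 2 * l,
        c.toWord.drop l = h.toWord.drop (h.norm - (m - l)) := by
      intro c hc
      rw [Finset.mem_filter, mem_sphere] at hc
      obtain ⟨u, p, w, h1, h2, h3⟩ := exists_cancel_mul h c⁻¹
      have h4 : c.toWord = invRev w ++ p := by
        rw [← inv_inv c, toWord_inv, h2, invRev_append, invRev_invRev]
      simp only [FreeGroup.norm, h1, h3, h4, List.length_append, invRev_length] at hc ⊢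
      rw [List.drop_append, List.drop_append, List.drop_of_length_le (by rw [invRev_length]; omega),
        List.drop_of_length_le (l := u) (by omega), invRev_length]
      congr 2
      omega
    intro c hc c' hc' e
    apply toWord_injective
    rw [← List.take_append_drop l c.toWord, ← List.take_append_drop l c'.toWord, key c hc,
      key c' hc']
    exact congrArg (· ++ _) e

theorem even_norm_mul (g c : FreeGroup (Fin n)) : Even ((g * c).norm + g.norm + c.norm) := by
  obtain ⟨u, p, w, h1, h2, h3⟩ := exists_cancel_mul g c
  simp only [FreeGroup.norm, h1, h2, h3, List.length_append, invRev_length]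
  exact ⟨u.length + w.length + p.length, by ring⟩

end SquareComplex

/-! ### Counting the group elements read by an automaton. -/

namespace SquareComplex

open FreeGroup hiding IsReduced norm

variable {n m B : ℕ}

/-- An automaton reading elements of the sphere of radius `m`, with an initial state and an
initial element. -/
abbrev Automaton (n m B : ℕ) : Type :=
  (Fin B → sphere n m → Fin B → Prop) × Fin B × sphere n m

/-- The products of elements read by the automaton. -/
inductive Automaton.Run (M : Automaton n m B) : ℕ → Fin B → FreeGroup (Fin n) → Prop
  | start : Run M 0 M.2.1 M.2.2
  | step {j : ℕ} {q q' : Fin B} {g : FreeGroup (Fin n)} (c : sphere n m) :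
      Run M j q g → M.1 q c q' → Run M (j + 1) q' (g * c)

/-- At least `θ` letters can be read at each state. -/
def Automaton.IsGood (M : Automaton n m B) (θ : ℝ) : Prop :=
  ∀ q, θ ≤ cnt (sphere n m) fun c => ∃ (h : c ∈ sphere n m) (q' : Fin B), M.1 q ⟨c, h⟩ q'

/-- Only multiplications with at most `l` cancelled letters are kept. At least `β * |redWords n l|`
legal letters remain for each element, and a product arises in at most `|redWords n l|` ways, so the
set grows by a factor `β`. The condition `2 * l < m` keeps the products nontrivial. -/
theorem Automaton.IsGood.exists_runs {M : Automaton n m B} {θ β : ℝ} (hM : M.IsGood θ) {l : ℕ}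
    (hl : 2 * l < m) (hl0 : 0 < (redWords n l).card)
    (hβ : β * (redWords n l).card + (redWords n (m - l)).card ≤ θ) (hβ0 : 0 ≤ β) (j : ℕ) :
    ∃ G : Finset (FreeGroup (Fin n)), β ^ j ≤ G.card ∧ ∀ g ∈ G, (∃ q, M.Run j q g) ∧
      0 < g.norm ∧ g.norm ≤ (j + 1) * m ∧ Even (g.norm + (j + 1) * m) := by
  classical
  induction j with
  | zero =>
    refine ⟨{↑M.2.2}, by simp, fun g hg => ?_⟩
    obtain rfl := Finset.mem_singleton.1 hg
    have := mem_sphere.1 M.2.2.2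
    exact ⟨⟨_, .start⟩, by omega, by omega, by rw [this]; exact ⟨m, by ring⟩⟩
  | succ j ih =>
    obtain ⟨G, hG, hG'⟩ := ih
    have : Nonempty (Fin B) := ⟨M.2.1⟩
    choose! q hq using fun g (hg : g ∈ G) => (hG' g hg).1
    let P : FreeGroup (Fin n) → FreeGroup (Fin n) → Prop := fun g c =>
      g.norm + m ≤ (g * c).norm + 2 * l ∧ ∃ (h : c ∈ sphere n m) (q' : Fin B), M.1 (q g) ⟨c, h⟩ q'
    let S : Finset (Σ _ : FreeGroup (Fin n), FreeGroup (Fin n)) :=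
      G.sigma fun g => (sphere n m).filter (P g)
    have h1 : (G.card : ℝ) * (β * (redWords n l).card) ≤ S.card := by
      rw [Finset.card_sigma, ← nsmul_eq_mul, ← Finset.sum_const]
      push_cast
      refine Finset.sum_le_sum fun g _ => ?_
      have h2 := hM (q g)
      have h3 : cnt (sphere n m) (fun c => ∃ (h : c ∈ sphere n m) (q' : Fin B),
          M.1 (q g) ⟨c, h⟩ q') ≤ cnt (sphere n m) (P g) +
          cnt (sphere n m) (fun c => (g * c).norm + 2 * l < g.norm + m) := by
        refine cnt_le_add fun c _ h => ?_
        by_cases h' : (g * c).norm + 2 * l < g.norm + m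
        · exact Or.inr h'
        · exact Or.inl ⟨not_lt.1 h', h⟩
      rw [cnt_eq_card (P := P g),
        cnt_eq_card (P := fun c => (g * c).norm + 2 * l < g.norm + m)] at h3
      have h4 : (((sphere n m).filter fun c => (g * c).norm + 2 * l < g.norm + m).card : ℝ) ≤
          (redWords n (m - l)).card := by exact_mod_cast card_cancel_le m l g
      linarith
    have h2 : S.card ≤ (redWords n l).card * (S.image fun x => x.1 * x.2).card := by
      refine Finset.card_le_mul_card_image S _ fun h _ => ?_
      refine le_trans ?_ (card_split_le m l (by omega) h)
      refine Finset.card_le_card_of_injOn (fun x => x.2) ?_ ?_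
      · rintro ⟨g, c⟩ hx
        simp only [Finset.mem_coe, Finset.mem_filter, S, Finset.mem_sigma, P] at hx ⊢
        obtain ⟨⟨-, h1, h2, -⟩, rfl⟩ := hx
        exact ⟨h1, by rw [mul_inv_cancel_right]; exact h2⟩
      · rintro ⟨g, c⟩ hx ⟨g', c'⟩ hx' (rfl : c = c')
        simp only [Finset.mem_coe, Finset.mem_filter] at hx hx'
        have := hx.2.trans hx'.2.symm
        simp only [mul_left_inj] at this
        rw [this]
    refine ⟨S.image fun x => x.1 * x.2, ?_, ?_⟩
    · have h3 : (S.card : ℝ) ≤ (redWords n l).card * (S.image fun x => x.1 * x.2).card := by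
        exact_mod_cast h2
      have h4 : (0 : ℝ) < (redWords n l).card := by exact_mod_cast hl0
      refine le_of_mul_le_mul_left ?_ h4
      refine le_trans ?_ (h1.trans h3)
      rw [pow_succ]
      have := mul_le_mul_of_nonneg_right hG (mul_nonneg hβ0 h4.le)
      linarith
    · intro h hh
      obtain ⟨⟨g, c⟩, hx, rfl⟩ := Finset.mem_image.1 hh
      simp only [S, Finset.mem_sigma, Finset.mem_filter, P] at hx
      obtain ⟨hg, -, h8, hc, q', hq'⟩ := hx
      obtain ⟨-, h3, h4, h5⟩ := hG' g hg
      have h6 := norm_mul_le g c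
      have h7 := even_norm_mul g c
      have e := mem_sphere.1 hc
      rw [e] at h6 h7
      rw [Nat.even_iff] at h5 h7 ⊢
      have e2 : (j + 1 + 1) * m = (j + 1) * m + m := by ring
      rw [e2]
      dsimp only
      exact ⟨⟨q', .step ⟨c, hc⟩ (hq g hg) hq'⟩, by omega, by omega, by omega⟩

theorem exists_letter (hn : 2 ≤ n) (a b c : Fin n × Bool) : ∃ x, x ≠ a ∧ x ≠ b ∧ x ≠ c := by
  classical
  by_contra! h
  have h1 : (Finset.univ : Finset (Fin n × Bool)) ⊆ {a, b, c} := fun x _ => by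
    by_cases hx : x = a
    · simp [hx]
    · by_cases hy : x = b
      · simp [hy]
      · simp [h x hx hy]
  have h2 := (Finset.card_le_card h1).trans Finset.card_le_three
  simp at h2
  omega

/-- Conjugation by a power of a letter adds an even number of letters when nothing cancels at either
end, whence the parity condition. -/
theorem exists_conj_relator (hn : 2 ≤ n) {L : ℕ} {g : FreeGroup (Fin n)} (h0 : 0 < g.norm)
    (hL : g.norm ≤ L) (hev : Even (g.norm + L)) : ∃ (s : Fin (L + 1)) (x : Fin n × Bool)
      (W : ReducedWord n L), FreeGroup.mk W.1.toList =
        FreeGroup.mk (List.replicate s x) * g * (FreeGroup.mk (List.replicate s x))⁻¹ := by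
  obtain ⟨a, w, ha⟩ := List.exists_cons_of_length_pos (l := g.toWord) h0
  obtain ⟨w', b, hb⟩ : ∃ w' b, g.toWord = w' ++ [b] :=
    ⟨_, _, (List.dropLast_append_getLast (l := g.toWord) (by simp [ha])).symm⟩
  -- The power of `x` must not cancel against the first letter `a`, nor its inverse against the last
  -- letter `b`; the repeated `b` only fills the third slot.
  obtain ⟨x, hxa, hxb, -⟩ := exists_letter hn (a.1, !a.2) b b
  obtain ⟨s, hs⟩ : ∃ s, L = g.norm + (s + s) := by
    rw [Nat.even_iff] at hev
    exact ⟨(L - g.norm) / 2, by omega⟩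
  have hrep : ∀ x : Fin n × Bool, FreeGroup.IsReduced (List.replicate s x) := fun x =>
    List.isChain_replicate_of_rel _ (fun _ => rfl)
  have hred : FreeGroup.IsReduced (List.replicate s x ++ (g.toWord ++
      List.replicate s (x.1, !x.2))) := by
    refine List.isChain_append.2 ⟨hrep x, List.isChain_append.2 ⟨isReduced_toWord, hrep _, ?_⟩, ?_⟩
    · intro c hc d hd
      rw [hb, List.getLast?_append, List.getLast?_singleton] at hc
      obtain rfl : b = c := by simpa using hc
      obtain rfl := List.eq_of_mem_replicate (List.mem_of_mem_head? hd)
      intro h1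
      obtain ⟨i, ε⟩ := x
      obtain ⟨j, δ⟩ := b
      cases ε <;> cases δ <;> simp_all
    · intro c hc d hd
      rw [ha] at hd
      obtain rfl : a = d := by simpa using hd
      obtain rfl := List.eq_of_mem_replicate (List.mem_of_mem_getLast? hc)
      intro h1
      obtain ⟨i, ε⟩ := c
      obtain ⟨j, δ⟩ := a
      cases ε <;> cases δ <;> simp_all
  refine ⟨⟨s, by omega⟩, x, ⟨⟨_, ?_⟩, hred⟩, ?_⟩
  · have : g.toWord.length = g.norm := rfl
    simp only [List.length_append, List.length_replicate]
    omega
  · simp only [List.Vector.toList]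
    rw [← mul_mk, ← mul_mk, mk_toWord, inv_mk, mul_assoc]
    simp [invRev]

/-- An element is recovered from its padded relator once the exponent and the conjugating letter are
known, which gives the factors `L + 1` and `2 * n`. -/
theorem card_le_card_relators (hn : 2 ≤ n) {L : ℕ} {G : Finset (FreeGroup (Fin n))}
    {P : FreeGroup (Fin n) → Prop}
    (hG : ∀ g ∈ G, P g ∧ 0 < g.norm ∧ g.norm ≤ L ∧ Even (g.norm + L)) :
    G.card ≤ (L + 1) * (2 * n) * Nat.card {W : ReducedWord n L //
      ∃ t g, P g ∧ FreeGroup.mk W.1.toList = t * g * t⁻¹} := by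
  choose s x W hW using fun g : G => exists_conj_relator hn (hG g g.2).2.1 (hG g g.2).2.2.1
    (hG g g.2).2.2.2
  let f : G → Fin (L + 1) × (Fin n × Bool) × {W : ReducedWord n L //
      ∃ t g, P g ∧ FreeGroup.mk W.1.toList = t * g * t⁻¹} := fun g =>
    (s g, x g, ⟨W g, _, _, (hG g g.2).1, hW g⟩)
  have hf : Function.Injective f := by
    intro g g' h
    simp only [f, Prod.mk.injEq, Subtype.mk.injEq] at h
    have h1 := hW g
    rw [h.1, h.2.1, h.2.2, hW g'] at h1
    exact Subtype.ext (mul_left_cancel (mul_right_cancel h1)).symm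
  have := Nat.card_le_card_of_injective f hf
  rw [Nat.card_prod, Nat.card_prod, Nat.card_prod, Nat.card_eq_fintype_card] at this
  simp only [Fintype.card_coe, Nat.card_fin, Nat.card_eq_fintype_card (α := Bool),
    Fintype.card_bool] at this
  calc _ ≤ _ := this
    _ = _ := by ring

end SquareComplex

/-! ### From an action without invariant cube to an automaton. -/

namespace SquareComplex

open FreeGroup hiding IsReduced norm

variable {n m B : ℕ}

theorem HasAutomaton.exists_automaton {V : Type u} {X : SquareComplex V} {v : V}
    [MulAction (FreeGroup (Fin n)) V] {e : ℝ} (h : X.HasAutomaton v (sphere n m) e B) :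
    ∃ M : Automaton n m B, M.IsGood e ∧ ∀ j q g, M.Run j q g → g • v ≠ v := by
  obtain ⟨S, hB, -, hS, a, ha, c, hc, hca⟩ := h
  obtain ⟨f, hf⟩ : ∃ f : Fin B → S, Function.Surjective f := by
    obtain ⟨i⟩ := Function.Embedding.nonempty_of_card_le (α := S) (β := Fin B) (by simpa using hB)
    have : Nonempty S := ⟨⟨a, ha⟩⟩
    exact ⟨_, Function.invFun_surjective i.injective⟩
  obtain ⟨q, hq⟩ := hf ⟨a, ha⟩
  refine ⟨⟨fun q c q' => ∀ x, (c : FreeGroup (Fin n)) • x ∈ X.half (f q) v → x ∈ X.half (f q') v,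
    q, ⟨c, hc⟩⟩, ?_, ?_⟩
  · intro q
    refine (hS (f q) (f q).2).trans (cnt_mono fun c hc ⟨b, hb, h⟩ => ⟨hc, ?_⟩)
    obtain ⟨q', hq'⟩ := hf ⟨b, hb⟩
    refine ⟨q', ?_⟩
    dsimp only
    rw [hq']
    exact h
  · intro j q g hr hg
    -- The invariant of a run: the inverse of the product carries `v` into the halfspace of the
    -- current state, which does not contain `v`.
    have key : g⁻¹ • v ∈ X.half (f q) v := by
      clear hg
      induction hr with
      | start => simpa [hq] using hca
      | step c _ h ih =>
        refine h _ ?_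
        rw [smul_smul, mul_inv_rev, mul_inv_cancel_left]
        exact ih
    have : g⁻¹ • v = v := by rw [inv_smul_eq_iff, hg]
    rw [this] at key
    exact IsGradedCAT0.right_notMem_half key

/-- If a vertex is moved at all, then it is moved by many words of a given odd length. -/
theorem card_sphere_le_cnt {V : Type u} [MulAction (FreeGroup (Fin n)) V] (hn : 2 ≤ n) {v : V}
    (hv : ∃ g : FreeGroup (Fin n), g • v ≠ v) {k : ℕ} (hk : Odd k) :
    ((sphere n k).card : ℝ) ≤ cnt (sphere n (k + 2)) (fun c => c • v ≠ v) := by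
  classical
  rw [cnt_eq_card, Nat.cast_le]
  -- If two letters `a`, `b` send `v` to different vertices, then of the words `y z a` and `y z b`
  -- at least one moves `v`. The letter `z` keeps both reduced, and the prefix `y` makes the choice
  -- injective.
  by_cases hab : ∃ a b : Fin n × Bool, FreeGroup.mk [a] • v ≠ FreeGroup.mk [b] • v
  · obtain ⟨a, b, hab⟩ := hab
    have key : ∀ y ∈ sphere n k, ∃ c, (c ∈ sphere n (k + 2) ∧ c • v ≠ v) ∧
        c.toWord.take k = y.toWord := by
      intro y hy
      have hy' : y.toWord.length = k := mem_sphere.1 hy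
      obtain ⟨w, z₀, hw⟩ : ∃ w z₀, y.toWord = w ++ [z₀] :=
        ⟨_, _, (List.dropLast_append_getLast (l := y.toWord) (by
          rintro e
          rw [e] at hy'
          obtain ⟨i, hi⟩ := hk
          simp at hy'
          omega)).symm⟩
      obtain ⟨z, hz0, hza, hzb⟩ := exists_letter hn (z₀.1, !z₀.2) (a.1, !a.2) (b.1, !b.2)
      have hred : ∀ a : Fin n × Bool, z ≠ (a.1, !a.2) →
          FreeGroup.IsReduced (y.toWord ++ [z, a]) := by
        intro a hza
        rw [hw]
        refine FreeGroup.IsReduced.append_overlap (L₂ := [z₀]) (hw ▸ isReduced_toWord) ?_ (by simp)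
        refine isReduced_cons_cons.2 ⟨?_, isReduced_cons_cons.2 ⟨hza, .singleton⟩⟩
        rintro rfl
        simp at hz0
      have hmk : ∀ a : Fin n × Bool, z ≠ (a.1, !a.2) →
          (FreeGroup.mk (y.toWord ++ [z, a])).toWord = y.toWord ++ [z, a] := fun a hza => by
        rw [toWord_mk, (hred a hza).reduce_eq]
      have hsm : ∀ a : Fin n × Bool, FreeGroup.mk (y.toWord ++ [z, a]) • v =
          FreeGroup.mk (y.toWord ++ [z]) • FreeGroup.mk [a] • v := fun a => by
        rw [smul_smul, mul_mk, List.append_assoc]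
        rfl
      have hmem : ∀ a : Fin n × Bool, z ≠ (a.1, !a.2) → FreeGroup.mk (y.toWord ++ [z, a]) • v ≠ v →
          ∃ c, (c ∈ sphere n (k + 2) ∧ c • v ≠ v) ∧ c.toWord.take k = y.toWord := by
        intro a hza hm
        refine ⟨_, ⟨mem_sphere.2 ?_, hm⟩, ?_⟩
        · rw [FreeGroup.norm, hmk a hza]
          simp [hy']
        · rw [hmk a hza, ← hy', List.take_left]
      by_cases h : FreeGroup.mk (y.toWord ++ [z, a]) • v = v
      · refine hmem b hzb fun h' => hab ?_
        rw [hsm] at h h'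
        exact smul_left_cancel _ (h.trans h'.symm)
      · exact hmem a hza h
    choose! f hf using key
    refine Finset.card_le_card_of_injOn f (fun y hy => ?_) (fun y hy y' hy' h => ?_)
    · rw [Finset.mem_coe, Finset.mem_filter]
      exact (hf y hy).1
    · apply toWord_injective
      rw [← (hf y hy).2, ← (hf y' hy').2, h]
  · push Not at hab
    -- All letters now agree on `v`, inverses included, so the image of `v` under a word depends
    -- only on the parity of its length, and every word of odd length moves `v`.
    let a : Fin n × Bool := (⟨0, by omega⟩, true)
    have hpar : ∀ w : List (Fin n × Bool), (Even w.length → FreeGroup.mk w • v = v) ∧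
        (Odd w.length → FreeGroup.mk w • v = FreeGroup.mk [a] • v) := by
      intro w
      induction w with
      | nil => exact ⟨fun _ => one_smul _ v, fun h => by simp at h⟩
      | cons b w ih =>
        have e : FreeGroup.mk (b :: w) • v = FreeGroup.mk [b] • FreeGroup.mk w • v := by
          rw [smul_smul, mul_mk]
          rfl
        rw [List.length_cons, e, Nat.even_add_one, Nat.not_even_iff_odd, Nat.odd_add_one,
          Nat.not_odd_iff_even]
        refine ⟨fun h => ?_, fun h => ?_⟩
        · rw [ih.2 h, hab a (b.1, !b.2)]
          have : FreeGroup.mk [(b.1, !b.2)] = (FreeGroup.mk [b])⁻¹ := by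
            rw [inv_mk]
            rfl
          rw [this, smul_inv_smul]
        · rw [ih.1 h, hab b a]
    have ha : FreeGroup.mk [a] • v ≠ v := by
      obtain ⟨g, hg⟩ := hv
      intro ha
      refine hg ?_
      rw [← mk_toWord (x := g)]
      rcases Nat.even_or_odd g.toWord.length with h | h
      · exact (hpar _).1 h
      · rw [(hpar _).2 h, ha]
    rw [Finset.filter_true_of_mem, card_sphere, card_sphere]
    · obtain ⟨i, rfl⟩ := hk
      rw [card_redWords, show 2 * i + 1 + 2 = (2 * i + 2) + 1 by ring, card_redWords]
      refine Nat.mul_le_mul_left _ (Nat.pow_le_pow_right (by omega) (by omega))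
    · intro c hc
      rw [← mk_toWord (x := c), (hpar _).2]
      · exact ha
      · rw [show c.toWord.length = _ from mem_sphere.1 hc]
        obtain ⟨i, rfl⟩ := hk
        exact ⟨i + 1, by ring⟩

/-- An action of the free group without invariant cube on a CAT(0) square complex yields an
automaton all of whose words act nontrivially. -/
theorem exists_automaton {V : Type u} {X : SquareComplex V} (hX : X.IsCAT0) (hn : 2 ≤ n)
    (φ : FreeGroup (Fin n) →* X.aut) (hφ : ∀ C : X.Cube, ∃ g, φ g • C ≠ C) {k : ℕ} (hk : Odd k) :
    ∃ M : Automaton n (k + 2) (2 * (sphere n (k + 2)).card * ((sphere n (k + 2)).card + 1) ^ 3),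
      M.IsGood ((sphere n k).card / 2195456) ∧ ∀ j q g, M.Run j q g → φ g ≠ 1 := by
  let _ : MulAction (FreeGroup (Fin n)) X.Cube := MulAction.compHom _ φ
  have hA : X.subdivision.IsGradedAction (fun C => (Cube.dim C : ℤ)) (FreeGroup (Fin n)) :=
    { cat0 := hX.subdivision
      adj_smul := fun g _ _ h => subdivision_adj_smul (φ g) h
      square_smul := fun g _ _ _ _ h => subdivision_isSquare_smul (φ g) h
      ht_smul := fun g C => by exact_mod_cast dim_smul (φ g) C }
  let Φ : X.Cube → ℕ := fun u =>
    ∑ c ∈ sphere n (k + 2), X.subdivision.graph.dist u (c • u)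
  have hne : (Set.range Φ).Nonempty := by
    have := hX.subdivision.connected.nonempty
    exact Set.range_nonempty Φ
  obtain ⟨v, hv⟩ := Nat.sInf_mem hne
  have hmin : ∀ u, ∑ c ∈ sphere n (k + 2), (X.subdivision.graph.dist v (c • v) : ℝ) ≤
      ∑ c ∈ sphere n (k + 2), (X.subdivision.graph.dist u (c • u) : ℝ) := by
    intro u
    have : Φ v ≤ Φ u := hv ▸ Nat.sInf_le ⟨u, rfl⟩
    exact_mod_cast this
  have hT := card_sphere_le_cnt hn (v := v) (hφ v) hk
  have hpos : (0 : ℝ) < (sphere n k).card := by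
    rw [card_sphere, Nat.cast_pos]
    obtain ⟨i, rfl⟩ := hk
    rw [card_redWords]
    exact Nat.mul_pos (by omega) (Nat.pow_pos (by omega))
  obtain ⟨M, hM, hM'⟩ := (hA.hasAutomaton (fun c hc => inv_mem_sphere hc) hmin
    (hpos.trans_le hT)).exists_automaton
  refine ⟨M, fun q => le_trans ?_ (hM q), fun j q g hr h => hM' j q g hr ?_⟩
  · linarith
  · change φ g • v = v
    rw [h, one_smul]

end SquareComplex

/-! ### Relators excluded by an automaton, and the union bound. -/

namespace SquareComplex

open FreeGroup hiding IsReduced norm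

variable {n m B : ℕ}

/-- The relators of length `L` conjugate to a word read by the automaton. -/
def Automaton.relators (M : Automaton n m B) (L : ℕ) : Set (ReducedWord n L) :=
  {W | ∃ t g, (∃ j q, M.Run j q g) ∧ FreeGroup.mk W.1.toList = t * g * t⁻¹}

theorem card_reducedWord (n L : ℕ) : Nat.card (ReducedWord n L) = (redWords n L).card := by
  rw [← Nat.card_eq_finsetCard]
  exact Nat.card_congr
    { toFun := fun W => ⟨W.1.toList, mem_redWords.2 ⟨W.1.toList_length, W.2⟩⟩
      invFun := fun w => ⟨⟨w.1, (mem_redWords.1 w.2).1⟩, (mem_redWords.1 w.2).2⟩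
      left_inv := fun _ => rfl
      right_inv := fun _ => rfl }

/-- As `m` is odd, one of two consecutive numbers of letters has the parity needed for padding to
length `L`. -/
theorem exists_parity {m L : ℕ} (hm : Odd m) (hL : 2 * m ≤ L) : ∃ J, (J + 1) * m ≤ L ∧
    L ≤ (J + 3) * m ∧ L / m ≤ J + 2 ∧ Even ((J + 1) * m + L) := by
  have hm0 : 0 < m := hm.pos
  have h1 : 2 ≤ L / m := (Nat.le_div_iff_mul_le hm0).2 hL
  obtain ⟨q, hq⟩ : ∃ q, L / m = q + 2 := ⟨L / m - 2, by omega⟩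
  have h2 : L / m * m + L % m = L := Nat.div_add_mod' L m
  have h3 : L % m < m := Nat.mod_lt L hm0
  have h4 : 0 ≤ L % m := Nat.zero_le _
  rw [hq] at h2
  obtain ⟨s, rfl⟩ := hm
  by_cases hpar : Even ((q + 1) * (2 * s + 1) + L)
  · refine ⟨q, ?_, ?_, by omega, hpar⟩
    · linarith
    · linarith
  · refine ⟨q + 1, ?_, ?_, by omega, ?_⟩
    · linarith
    · linarith
    · rw [Nat.not_even_iff_odd] at hpar
      have := hpar.add_odd (⟨s, rfl⟩ : Odd (2 * s + 1))
      rwa [show (q + 1 + 1) * (2 * s + 1) + L = (q + 1) * (2 * s + 1) + L + (2 * s + 1) by ring]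

theorem sq_le_two_pow (q : ℕ) : (q + 1) ^ 2 ≤ 4 * 2 ^ q := by
  induction q with
  | zero => norm_num
  | succ q ih =>
    rcases Nat.lt_or_ge q 2 with h | h
    · interval_cases q <;> norm_num
    · rw [pow_succ 2 q]
      nlinarith

theorem Automaton.IsGood.le_card_relators (hn : 7 ≤ n) {r : ℕ} {M : Automaton n (2 * r + 21) B}
    (hM : M.IsGood ((sphere n (2 * r + 19)).card / 2195456)) {L J : ℕ}
    (hL : (J + 1) * (2 * r + 21) ≤ L) (hev : Even ((J + 1) * (2 * r + 21) + L)) :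
    ((2 * (n : ℝ) - 1) ^ (2 * r + 10) / 4390912) ^ J ≤
      (L + 1) * (2 * n) * Nat.card (M.relators L) := by
  have hb : ((2 * n - 1 : ℕ) : ℝ) = 2 * (n : ℝ) - 1 := by
    rw [Nat.cast_sub (by omega)]
    push_cast
    ring
  have hn' : (7 : ℝ) ≤ n := by exact_mod_cast hn
  obtain ⟨b, hb'⟩ : ∃ b, b = 2 * (n : ℝ) - 1 := ⟨_, rfl⟩
  rw [← hb'] at hb ⊢
  have hb13 : 13 ≤ b := by linarith
  -- With `l = 9` the letters that cancel too much are at most half of the guaranteed ones, as b^7 ≥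
  -- 13^7 ≥ 4390912 = 2·2195456; the value of `β` accounts exactly for the other half.
  obtain ⟨G, hG, hG'⟩ := hM.exists_runs (l := 9) (β := b ^ (2 * r + 10) / 4390912) (by omega)
    (by rw [card_redWords 8]; exact Nat.mul_pos (by omega) (Nat.pow_pos (by omega))) (by
      rw [card_sphere, card_redWords 8, show 2 * r + 21 - 9 = (2 * r + 11) + 1 by omega,
        card_redWords, card_redWords (2 * r + 18)]
      push_cast
      rw [hb]
      have h1 : b ^ (2 * r + 18) = b ^ (2 * r + 11) * b ^ 7 := by ring
      have h2 : b ^ (2 * r + 10) * b ^ 8 = b ^ (2 * r + 11) * b ^ 7 := by ring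
      have h3 : (13 : ℝ) ^ 7 ≤ b ^ 7 := pow_le_pow_left₀ (by norm_num) hb13 7
      have h4 : 0 < b ^ (2 * r + 11) := by positivity
      have h5 : b ^ (2 * r + 11) * 4390912 ≤ b ^ (2 * r + 11) * b ^ 7 :=
        mul_le_mul_of_nonneg_left (by linarith) h4.le
      have h6 : b ^ (2 * r + 10) / 4390912 * (2 * n * b ^ 8) =
        2 * n * (b ^ (2 * r + 11) * b ^ 7 / 4390912) := by rw [← h2]; ring
      rw [h6, h1]
      have h7 : b ^ (2 * r + 11) * b ^ 7 / 4390912 + b ^ (2 * r + 11) ≤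
        b ^ (2 * r + 11) * b ^ 7 / 2195456 := by linarith
      have h8 := mul_le_mul_of_nonneg_left h7 (by positivity : (0 : ℝ) ≤ 2 * n)
      linarith) (by positivity) J
  refine hG.trans ?_
  have := card_le_card_relators (by omega : 2 ≤ n) (L := L) (G := G)
    (P := fun g => ∃ j q, M.Run j q g) fun g hg => by
      obtain ⟨⟨q, h1⟩, h2, h3, h4⟩ := hG' g hg
      refine ⟨⟨J, q, h1⟩, h2, h3.trans hL, ?_⟩
      rw [Nat.even_iff] at h4 hev ⊢
      omega
  exact_mod_cast this

/-- For fixed `a` the entries of the tuple avoid `S a` independently, with probability at most (1 -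
p)^|ι| ≤ exp(-p|ι|); sum over `a`. -/
theorem one_sub_le_ratio {ι W A : Type*} [Finite ι] [Finite W] [Nonempty W] [Finite A]
    (S : A → Set W) (P : (ι → W) → Prop) (hP : ∀ R, ¬ P R → ∃ a, ∀ i, R i ∉ S a) (p : ℝ)
    (hp : ∀ a, p * Nat.card W ≤ Nat.card (S a)) :
    1 - Nat.card A * Real.exp (-(p * Nat.card ι)) ≤
      (Nat.card {R // P R} : ℝ) / Nat.card (ι → W) := by
  classical
  have := Fintype.ofFinite ι
  have := Fintype.ofFinite W
  have := Fintype.ofFinite A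
  have hw : (0 : ℝ) < Nat.card W := by exact_mod_cast Nat.card_pos
  have h1 : Nat.card {R // P R} + Nat.card {R // ¬ P R} = Nat.card (ι → W) := by
    rw [← Nat.card_sum]
    exact Nat.card_congr (Equiv.sumCompl P)
  have h2 : ∀ a, (Nat.card {R : ι → W // ∀ i, R i ∉ S a} : ℝ) ≤
      Real.exp (-(p * Nat.card ι)) * Nat.card (ι → W) := by
    intro a
    have e1 : Nat.card {R : ι → W // ∀ i, R i ∉ S a} =
        Nat.card {w // w ∉ S a} ^ Nat.card ι := by
      rw [← Nat.card_fun]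
      exact Nat.card_congr (Equiv.subtypePiEquivPi (p := fun _ w => w ∉ S a))
    have e2 : Nat.card (S a) + Nat.card {w // w ∉ S a} = Nat.card W := by
      rw [← Nat.card_sum]
      exact Nat.card_congr (Equiv.sumCompl (· ∈ S a))
    have e3 : (Nat.card (S a) : ℝ) + Nat.card {w // w ∉ S a} = Nat.card W := by exact_mod_cast e2
    have e4 : (Nat.card {w // w ∉ S a} : ℝ) ≤ Real.exp (-p) * Nat.card W := by
      have := mul_le_mul_of_nonneg_right (Real.one_sub_le_exp_neg p) hw.le
      linarith [hp a]
    rw [e1, Nat.card_fun]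
    push_cast
    refine (pow_le_pow_left₀ (Nat.cast_nonneg _) e4 _).trans ?_
    rw [mul_pow, ← Real.exp_nat_mul]
    refine le_of_eq ?_
    congr 2
    ring
  have h3 : (Nat.card {R // ¬ P R} : ℝ) ≤
      Nat.card A * (Real.exp (-(p * Nat.card ι)) * Nat.card (ι → W)) := by
    choose f hf using fun R : {R // ¬ P R} => hP R R.2
    have e1 := Nat.card_le_card_of_injective
      (fun R : {R // ¬ P R} => (⟨f R, R.1, hf R⟩ : Σ a, {R : ι → W // ∀ i, R i ∉ S a}))
      (fun R R' h => by
        exact Subtype.ext (congrArg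
          (fun x : (Σ a, {R : ι → W // ∀ i, R i ∉ S a}) => x.2.1) h))
    rw [Nat.card_sigma] at e1
    have e2 : (Nat.card {R // ¬ P R} : ℝ) ≤
        ∑ a, (Nat.card {R : ι → W // ∀ i, R i ∉ S a} : ℝ) := by exact_mod_cast e1
    refine e2.trans ((Finset.sum_le_sum fun a _ => h2 a).trans ?_)
    rw [Finset.sum_const, nsmul_eq_mul, Finset.card_univ, Nat.card_eq_fintype_card (α := A)]
  have h4 : (0 : ℝ) < Nat.card (ι → W) := by exact_mod_cast Nat.card_pos
  have h5 : (Nat.card {R // P R} : ℝ) + Nat.card {R // ¬ P R} = Nat.card (ι → W) := by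
    exact_mod_cast h1
  rw [le_div_iff₀ h4]
  linarith

theorem exists_automaton_of_not_hasPropertyFC2 (hn : 2 ≤ n) {d : ℝ} {L : ℕ} (R : Relators n d L)
    (hR : ¬ HasPropertyFC2.{u, 0} (relatorGroup R)) {k : ℕ} (hk : Odd k) :
    ∃ M : Automaton n (k + 2) (2 * (sphere n (k + 2)).card * ((sphere n (k + 2)).card + 1) ^ 3),
      M.IsGood ((sphere n k).card / 2195456) ∧ ∀ i, R i ∉ M.relators L := by
  unfold HasPropertyFC2 at hR
  push Not at hR
  obtain ⟨V, X, hX, ρ, hρ⟩ := hR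
  let π : FreeGroup (Fin n) →* relatorGroup R := PresentedGroup.mk _
  obtain ⟨M, hM, hM'⟩ := exists_automaton hX hn (ρ.comp π) (fun C => by
    by_contra! h
    refine hρ (hasGlobalFixedPoint_of_cube ρ C fun g => ?_)
    obtain ⟨g, rfl⟩ := PresentedGroup.mk_surjective _ g
    exact h g) hk
  refine ⟨M, hM, fun i => ?_⟩
  rintro ⟨t, g, ⟨j, q, hg⟩, h⟩
  have h1 : π (FreeGroup.mk (R i).1.toList) = 1 := PresentedGroup.one_of_mem ⟨i, rfl⟩
  rw [h, _root_.map_mul, _root_.map_mul, _root_.map_inv, mul_inv_eq_one, mul_eq_left] at h1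
  refine hM' j q g hg ?_
  rw [MonoidHom.comp_apply, h1, _root_.map_one]

end SquareComplex

/-! ### Comparison of exponents, and the main theorem. -/

namespace SquareComplex

theorem half_pow_le_numRelators {n : ℕ} {d : ℝ} (hn : 1 ≤ n) (hD : 1 ≤ (2 * (n : ℝ) - 1) ^ d)
    (L : ℕ) : ((2 * (n : ℝ) - 1) ^ d) ^ L ≤ 2 * numRelators n d L := by
  have hb : (0 : ℝ) ≤ 2 * (n : ℝ) - 1 := by
    have : (1 : ℝ) ≤ n := by exact_mod_cast hn
    linarith
  have h1 : 1 ≤ ((2 * (n : ℝ) - 1) ^ d) ^ L := one_le_pow₀ hD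
  rw [numRelators, Real.rpow_mul_natCast hb]
  have h2 := Nat.lt_floor_add_one (((2 * (n : ℝ) - 1) ^ d) ^ L)
  have h3 : (1 : ℝ) ≤ ⌊((2 * (n : ℝ) - 1) ^ d) ^ L⌋₊ := by
    exact_mod_cast (Nat.one_le_floor_iff _).2 h1
  linarith

/-- The expected number of relators conjugate to a word read by `M` grows at least linearly in `L`,
uniformly in `M` and its number of states. In fact the count gains a factor two per letter of the
automaton, and all but a linear part of this is spent on the polynomial loss from padding. -/
theorem exists_many_relators {n : ℕ} {d : ℝ} (hn : 7 ≤ n) (hD : 1 < (2 * (n : ℝ) - 1) ^ d) :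
    ∃ (r : ℕ) (c : ℝ), 0 < c ∧ ∀ L, 2 * (2 * r + 21) ≤ L → ∀ (B : ℕ)
      (M : Automaton n (2 * r + 21) B), M.IsGood ((sphere n (2 * r + 19)).card / 2195456) →
      c * ((L / (2 * r + 21) : ℕ) + 1) * Nat.card (ReducedWord n L) ≤
        Nat.card (M.relators L) * numRelators n d L := by
  have hb : ((2 * n - 1 : ℕ) : ℝ) = 2 * (n : ℝ) - 1 := by
    rw [Nat.cast_sub (by omega)]
    push_cast
    ring
  have hn' : (7 : ℝ) ≤ n := by exact_mod_cast hn
  have hN := half_pow_le_numRelators (by omega : 1 ≤ n) hD.le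
  obtain ⟨b, hb'⟩ : ∃ b, b = 2 * (n : ℝ) - 1 := ⟨_, rfl⟩
  rw [← hb'] at hb hN hD
  obtain ⟨D, hD'⟩ : ∃ D, D = b ^ d := ⟨_, rfl⟩
  rw [← hD'] at hN hD
  have hb13 : 13 ≤ b := by linarith
  -- The loss 4390912·b^11 per letter of the automaton is the same for every length `m`, so it is
  -- outweighed by `D ^ m` once `m` is large.
  obtain ⟨r, hr⟩ := pow_unbounded_of_one_lt (2 * (4390912 * b ^ 11)) hD
  obtain ⟨m, hm⟩ : ∃ m, m = 2 * r + 21 := ⟨_, rfl⟩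
  have hDm : 2 * (4390912 * b ^ 11) ≤ D ^ m :=
    hr.le.trans (pow_le_pow_right₀ hD.le (by omega))
  have hm0 : (0 : ℝ) < m := by
    rw [Nat.cast_pos]
    omega
  have hb0 : 0 < b := by linarith
  refine ⟨r, 1 / (128 * m * n ^ 2 * b ^ (3 * m)), by positivity, fun L hL B M hM => ?_⟩
  rw [← hm] at hL
  obtain ⟨J, h1, h2, h3, h4⟩ := exists_parity (m := m) ⟨r + 10, by omega⟩ hL
  have h5 := hM.le_card_relators hn (L := L) (J := J) (by rwa [← hm]) (by rwa [← hm])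
  rw [← hb'] at h5
  obtain ⟨q, hq⟩ : ∃ q, q = L / m := ⟨_, rfl⟩
  rw [← hq] at h3
  rw [show L / (2 * r + 21) = q by rw [hq, hm]]
  have hq2 : (L : ℝ) + 1 ≤ (q + 1) * m := by
    have : L < (q + 1) * m := by
      rw [hq, mul_comm]
      exact Nat.lt_mul_div_succ L (by omega)
    exact_mod_cast this
  -- One factor `q + 1` pays for the factor `L + 1` of the padding, the other is the growth in the
  -- conclusion.
  have hpow : ((q : ℝ) + 1) ^ 2 ≤ 16 * 2 ^ J := by
    have e1 := sq_le_two_pow q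
    have e2 : 2 ^ q ≤ 2 ^ (J + 2) := Nat.pow_le_pow_right (by norm_num) h3
    have : (q + 1) ^ 2 ≤ 16 * 2 ^ J := by
      rw [pow_add] at e2
      omega
    exact_mod_cast this
  have hw : (Nat.card (ReducedWord n L) : ℝ) ≤ 2 * n * (b ^ (J * m) * b ^ (3 * m)) := by
    obtain ⟨L', rfl⟩ : ∃ L', L = L' + 1 := ⟨L - 1, by omega⟩
    rw [card_reducedWord, card_redWords]
    push_cast
    rw [hb, ← pow_add]
    refine mul_le_mul_of_nonneg_left (pow_le_pow_right₀ (by linarith) ?_) (by positivity)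
    have : (J + 3) * m = J * m + 3 * m := by ring
    omega
  have hprod : 2 ^ J * b ^ (J * m) ≤
      ((L + 1) * (2 * n) * Nat.card (M.relators L)) * (2 * numRelators n d L) := by
    have e1 : (2 * (4390912 * b ^ 11)) ^ J ≤ 2 * (numRelators n d L : ℝ) := by
      refine (pow_le_pow_left₀ (by positivity) hDm J).trans (le_trans ?_ (hN L))
      rw [← pow_mul]
      refine pow_le_pow_right₀ hD.le ?_
      have : (J + 1) * m = m * J + m := by ring
      omega
    have e2 := mul_le_mul h5 e1 (by positivity) (by positivity)
    refine le_of_eq_of_le ?_ e2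
    rw [← mul_pow, mul_comm J m, pow_mul, ← mul_pow, hm]
    congr 1
    rw [show 2 * r + 21 = (2 * r + 10) + 11 by ring, pow_add]
    ring
  have hX : (0 : ℝ) < (L + 1) * (2 * n) * 2 := by positivity
  refine le_of_mul_le_mul_left ?_ hX
  have hgoal : (L + 1) * (2 * n) * 2 *
      (1 / (128 * m * n ^ 2 * b ^ (3 * m)) * ((q : ℝ) + 1) * Nat.card (ReducedWord n L)) ≤
      2 ^ J * b ^ (J * m) := by
    calc _ ≤ ((q + 1) * m) * (2 * n) * 2 * (1 / (128 * m * n ^ 2 * b ^ (3 * m)) * ((q : ℝ) + 1) *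
          (2 * n * (b ^ (J * m) * b ^ (3 * m)))) := by gcongr
      _ = ((q : ℝ) + 1) ^ 2 / 16 * b ^ (J * m) := by
        field_simp
        ring
      _ ≤ _ := by
        refine mul_le_mul_of_nonneg_right ?_ (by positivity)
        linarith
  refine hgoal.trans (hprod.trans (le_of_eq ?_))
  ring

end SquareComplex

theorem mainTheorem3 (d : ℝ) (hd0 : 0 < d) (hd1 : d < 1) (n : ℕ) (hn : 7 ≤ n)
    (hnd : 24 ≤ (2 * (n : ℝ) - 1) ^ d) :
    HoldsWithOverwhelmingProbability n d (fun G [Group G] => HasPropertyFC2.{u, 0} G) := by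
  obtain ⟨r, c, hc, hr⟩ := SquareComplex.exists_many_relators hn
    (by linarith : 1 < (2 * (n : ℝ) - 1) ^ d)
  -- A finite set that depends on `n` and `r` but not on `L`, nor on the complex or its universe.
  let A : Type := {M : SquareComplex.Automaton n (2 * r + 19 + 2)
    (2 * (SquareComplex.sphere n (2 * r + 19 + 2)).card * ((SquareComplex.sphere n (2 * r + 19 + 2)).card + 1) ^ 3) //
      M.IsGood ((SquareComplex.sphere n (2 * r + 19)).card / 2195456)}
  have hlim : Tendsto (fun L : ℕ => 1 - (Nat.card A : ℝ) *
      Real.exp (-(c * ((L / (2 * r + 21) : ℕ) + 1)))) atTop (𝓝 1) := by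
    have h1 : Tendsto (fun L : ℕ => c * (((L / (2 * r + 21) : ℕ) : ℝ) + 1)) atTop atTop :=
      Tendsto.const_mul_atTop hc (tendsto_atTop_add_const_right _ _
        (tendsto_natCast_atTop_atTop.comp (Nat.tendsto_div_const_atTop (by omega))))
    have h2 := ((Real.tendsto_exp_neg_atTop_nhds_zero.comp h1).const_mul
      (Nat.card A : ℝ)).const_sub 1
    simpa using h2
  refine tendsto_of_tendsto_of_tendsto_of_le_of_le' hlim tendsto_const_nhds ?_ ?_
  · filter_upwards [eventually_ge_atTop (2 * (2 * r + 21))] with L hL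
    have hN := SquareComplex.half_pow_le_numRelators (by omega : 1 ≤ n)
      (by linarith : 1 ≤ (2 * (n : ℝ) - 1) ^ d) L
    have hN0 : (0 : ℝ) < numRelators n d L := by
      have : (1 : ℝ) ≤ ((2 * (n : ℝ) - 1) ^ d) ^ L := one_le_pow₀ (by linarith)
      linarith
    have : Nonempty (ReducedWord n L) := by
      obtain ⟨L', rfl⟩ : ∃ L', L = L' + 1 := ⟨L - 1, by omega⟩
      refine (Nat.card_pos_iff.1 ?_).1
      rw [SquareComplex.card_reducedWord, SquareComplex.card_redWords]
      exact Nat.mul_pos (by omega) (Nat.pow_pos (by omega))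
    have key := SquareComplex.one_sub_le_ratio (fun M : A => M.1.relators L)
      (fun R : Relators n d L => HasPropertyFC2.{u, 0} (relatorGroup R)) (fun R hR => by
        obtain ⟨M, hM, h⟩ := SquareComplex.exists_automaton_of_not_hasPropertyFC2 (by omega) R hR
          (k := 2 * r + 19) ⟨r + 9, by ring⟩
        exact ⟨⟨M, hM⟩, h⟩)
      (c * ((L / (2 * r + 21) : ℕ) + 1) / numRelators n d L) (fun M => by
        rw [div_mul_eq_mul_div, div_le_iff₀ hN0]
        exact hr L hL _ M.1 M.2)
    rw [Nat.card_fin, div_mul_cancel₀ _ hN0.ne'] at key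
    exact key
  · refine Eventually.of_forall fun L => div_le_one_of_le₀ ?_ (Nat.cast_nonneg _)
    exact_mod_cast Nat.card_le_card_of_injective _ Subtype.val_injective
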